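/- Let $(\Omega,\mathscr F,\mathbb F,\mathbf P)$ be a filtered probability space with right-continuous filtration $\mathbb F=(\mathscr F_t)_{t\ge 0}$, and let $Z$ be a càdlàg Lévy process with respect to $\mathbb F$ with characteristic triplet $(\sigma^2,b,\nu)$, that is, $Z$ is adapted, $Z_0=0$ a.s., $Z_t-Z_s$ is independent of $\mathscr F_s$ and $$\mathbf E\,e^{iu(Z_t-Z_s)}=\exp\Big((t-s)\Big[iub-\tfrac{\sigma^2u^2}{2}+\int_{\mathbb R}\big(e^{iuz}-1-iuz\mathbb I(|z|\le 1)\big)\,\nu(dz)\Big]\Big),\qquad 0\le s\le t,\ u\in\mathbb R,$$ where $b\in\mathbb R$, $\nu(\{0\})=0$ and $\int(z^2\wedge 1)\,\nu(dz)<\infty$. Assume that * $\sigma>0$, and * for some $\alpha\in(0,2)$ the tail $H(R):=\nu(\{z:|z|>R\})$, $R>0$, is positive and regularly varying at infinity of index $-\alpha$, i.e. $\lim_{R\to\infty}H(xR)/H(R)=x^{-\alpha}$ for every $x>0$. Put $\tilde H(R)=\alpha\int_R^\infty \frac{H(z)}{z}\,dz$ for $R>0$ and define the scaling $\phi_T$,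 $T>0$, by $1/\phi_T=\tilde H^{-1}(1/T)=\inf\{u>0:\tilde H(u)=1/T\}$. Let $\theta_0>0$ and let $X$ be an $\mathbb F$-adapted càdlàg process (with arbitrary $\mathscr F_0$-measurable initial value $X_0$) satisfying almost surely $$X_t=X_0-\theta_0\int_0^tX_s\,ds+Z_t,\qquad t\ge 0.$$ Let $\mathbf P^{\theta_0}$ be the law of $X$ on the space $\mathbb D=D([0,\infty),\mathbb R)$ of càdlàg functions $\omega$ with the $\sigma$-algebra generated by the coordinates, and let $\mathbf P^{\theta_0}_T$ be its restriction to $\mathscr G_T=\bigcap_{s>T}\sigma(\omega_r: r\le s)$. Then there is a random variable $\mathcal S^{(\alpha/2)}$ with the Laplace transform $$\mathbf E\,e^{-\lambda\mathcal S^{(\alpha/2)}}=e^{-\Gamma(1-\frac{\alpha}{2})\lambda^{\alpha/2}},\qquad \lambda\ge 0,$$ (a spectrally positive $\alpha/2$-stable random variable), and for every such random variable $$\mathrm{Law}\Big(\phi_T^2\int_0^T\omega_s^2\,ds\ \Big|\ \mathbf P^{\theta_0}_T\Big)\longrightarrow \mathrm{Law}\Big(\frac{\mathcal S^{(\alpha/2)}}{2\theta_0}\Big)\qquad\text{weakly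 as }T\to\infty .$$ -/

import Mathlib

open MeasureTheory ProbabilityTheory Filter Topology
open scoped NNReal

noncomputable section

namespace LevyOU

/-- Right-continuous with finite left limits. -/
def IsCadlag (f : ℝ≥0 → ℝ) : Prop :=
  ∀ t, ContinuousWithinAt f (Set.Ici t) t ∧ ∃ l, Tendsto f (𝓝[<] t) (𝓝 l)

/-- The path space `D([0,∞), ℝ)`.  As a subtype of `ℝ≥0 → ℝ` it carries the σ-algebra generated by
the coordinate projections, which is the Borel σ-algebra of the Skorokhod topology. -/
abbrev PathSpace : Type := {w : ℝ≥0 → ℝ // IsCadlag w}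

/-- The right-continuous canonical filtration `𝒢_t = ⋂_{s > t} σ(w_r : r ≤ s)` of the path space. -/
def canonicalFiltration :
    Filtration ℝ≥0 (inferInstance : MeasurableSpace PathSpace) where
  seq t := ⨅ s > t, ⨆ r ≤ s, MeasurableSpace.comap (fun w : PathSpace => w.1 r) inferInstance
  mono' t t' h := le_iInf₂ fun s hs => iInf₂_le s (lt_of_le_of_lt h hs)
  le' t := by
    refine (iInf₂_le (t + 1) (lt_add_of_pos_right t one_pos)).trans (iSup₂_le fun r _ => ?_)
    exact ((measurable_pi_apply r).comp measurable_subtype_coe).comap_le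

/-- `ν` is a Lévy measure on `ℝ`. -/
structure IsLevyMeasure (ν : Measure ℝ) : Prop where
  zero : ν {0} = 0
  integral_lt_top : ∫⁻ z, ENNReal.ofReal (min (z ^ 2) 1) ∂ν < ⊤

/-- The Lévy–Khintchine exponent with the characteristics `(σ², b, ν)` and truncation at `1`. -/
def levyExponent (σ b : ℝ) (ν : Measure ℝ) (u : ℝ) : ℂ :=
  Complex.I * (u * b : ℝ) - ((σ ^ 2 * u ^ 2 / 2 : ℝ) : ℂ) +
    ∫ z, (Complex.exp (Complex.I * (u * z : ℝ)) - 1 -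
      Complex.I * (if |z| ≤ 1 then ((u * z : ℝ) : ℂ) else 0)) ∂ν

/-- `Z` is a Lévy process with respect to the filtration `F`, with the characteristic triplet
`(σ², b, ν)`. -/
structure IsLevyProcess {Ω : Type*} {mΩ : MeasurableSpace Ω} (F : Filtration ℝ≥0 mΩ)
    (P : Measure Ω) (σ b : ℝ) (ν : Measure ℝ) (Z : ℝ≥0 → Ω → ℝ) : Prop where
  adapted : ∀ t, Measurable[F t] (Z t)
  zero : ∀ᵐ ω ∂P, Z 0 ω = 0
  cadlag : ∀ᵐ ω ∂P, IsCadlag fun t => Z t ω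
  indep : ∀ s t, s ≤ t →
    Indep (MeasurableSpace.comap (fun ω => Z t ω - Z s ω) inferInstance) (F s) P
  charFun_incr : ∀ s t, s ≤ t → ∀ u : ℝ,
    charFun (P.map fun ω => Z t ω - Z s ω) u =
      Complex.exp (((t : ℝ) - (s : ℝ) : ℝ) * levyExponent σ b ν u)

/-- `X` is an `F`-adapted process with càdlàg paths that solves
`X_t = X_0 - θ ∫₀ᵗ X_s ds + Z_t`, `t ≥ 0`, almost surely. -/
structure IsOUSolution {Ω : Type*} {mΩ : MeasurableSpace Ω} (F : Filtration ℝ≥0 mΩ)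
    (P : Measure Ω) (θ : ℝ) (Z : ℝ≥0 → Ω → ℝ) (X : Ω → PathSpace) : Prop where
  adapted : ∀ t, Measurable[F t] fun ω => (X ω).1 t
  eqn : ∀ᵐ ω ∂P, ∀ t : ℝ≥0,
    (X ω).1 t = (X ω).1 0 - θ * (∫ s in (0 : ℝ)..t, (X ω).1 s.toNNReal) + Z t ω

theorem IsOUSolution.measurable {Ω : Type*} {mΩ : MeasurableSpace Ω} {F : Filtration ℝ≥0 mΩ}
    {P : Measure Ω} {θ : ℝ} {Z : ℝ≥0 → Ω → ℝ} {X : Ω → PathSpace}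
    (h : IsOUSolution F P θ Z X) : Measurable X :=
  Measurable.subtype_mk (measurable_pi_lambda _ fun t => (h.adapted t).mono (F.le t) le_rfl)

/-- The law `P^θ` of the Ornstein–Uhlenbeck type process on the path space. -/
def IsOUSolution.pathLaw {Ω : Type*} {mΩ : MeasurableSpace Ω} {F : Filtration ℝ≥0 mΩ}
    {P : Measure Ω} {θ : ℝ} {Z : ℝ≥0 → Ω → ℝ} {X : Ω → PathSpace}
    (_h : IsOUSolution F P θ Z X) : Measure PathSpace :=
  P.map X

/-- The restriction `P^θ_T` of `P^θ` to the σ-algebra `𝒢_T`. -/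
def IsOUSolution.pathLawUpTo {Ω : Type*} {mΩ : MeasurableSpace Ω} {F : Filtration ℝ≥0 mΩ}
    {P : Measure Ω} {θ : ℝ} {Z : ℝ≥0 → Ω → ℝ} {X : Ω → PathSpace}
    (h : IsOUSolution F P θ Z X) (T : ℝ≥0) : @Measure PathSpace (canonicalFiltration T) :=
  h.pathLaw.trim (canonicalFiltration.le T)

instance {Ω : Type*} {mΩ : MeasurableSpace Ω} {F : Filtration ℝ≥0 mΩ}
    {P : Measure Ω} [IsProbabilityMeasure P] {θ : ℝ} {Z : ℝ≥0 → Ω → ℝ} {X : Ω → PathSpace}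
    (h : IsOUSolution F P θ Z X) (T : ℝ≥0) :
    @IsProbabilityMeasure PathSpace (canonicalFiltration T) (h.pathLawUpTo T) := by
  have : IsProbabilityMeasure h.pathLaw :=
    Measure.isProbabilityMeasure_map h.measurable.aemeasurable
  exact ⟨by rw [IsOUSolution.pathLawUpTo, trim_measurableSet_eq _ .univ, measure_univ]⟩

/-- The two-sided tail `H(R) = ν(|z| > R)` of the Lévy measure. -/
def tail (ν : Measure ℝ) (R : ℝ) : ℝ := ν.real {z | R < |z|}

/-- `f : (0,∞) → (0,∞)` is regularly varying at infinity of index `ρ` (used here only for the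
monotone function `tail ν`, so that no measurability has to be required). -/
def RegularlyVarying (f : ℝ → ℝ) (ρ : ℝ) : Prop :=
  (∀ R, 0 < R → 0 < f R) ∧
    ∀ x, 0 < x → Tendsto (fun R => f (x * R) / f R) atTop (𝓝 (x ^ ρ))

/-- `H̃(R) = α ∫_R^∞ H(z) / z dz`. -/
def smoothTail (α : ℝ) (ν : Measure ℝ) (R : ℝ) : ℝ :=
  α * ∫ z in Set.Ioi R, tail ν z / z

/-- The scaling `φ_T`, given by `1 / φ_T = H̃⁻¹(1/T) = inf {u > 0 : H̃(u) = 1/T}`. -/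
def scaling (α : ℝ) (ν : Measure ℝ) (T : ℝ) : ℝ :=
  (sInf {u : ℝ | 0 < u ∧ smoothTail α ν u = 1 / T})⁻¹

/-- `μ` has the Laplace transform `exp (-Γ(1-a) l^a)`, `l ≥ 0`, of the spectrally positive
`a`-stable law. -/
def HasStableLaplace (a : ℝ) (μ : ProbabilityMeasure ℝ) : Prop :=
  ∀ l : ℝ, 0 ≤ l →
    ∫ x, Real.exp (-(l * x)) ∂(μ : Measure ℝ) = Real.exp (-(Real.Gamma (1 - a) * l ^ a))

end LevyOU

end

/-! Convergence in law on the half-line follows from convergence of Laplace transforms, so the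
object to control is `E exp(-a² Q / 2)` with `Q` the integral of `X²` over `[0,T]` and `a² = 2 l
φ_T²`.

For fixed `T`, the implicit Euler scheme of mesh `δ = T/n` uses only increments of `Z` and converges
pathwise, so `Q` may be replaced by `δ ∑ y_k²`. This is the squared norm of a vector linear in the
data, `X_0 w_0 + ∑ ΔZ_j w_j`. Gaussian randomisation writes `exp(-a² ‖v‖² / 2)` as the mean of
`exp(i a ⟪v, ξ⟫)` over a standard Gaussian `ξ`. Averaging over `Z` first, by independence of the
increments, gives the mean over `ξ` of `χ(a g_0) exp(∑ δ ψ(a g_j))`. Here `χ` is the characteristic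
function of `X_0`, `ψ` the Lévy exponent and `g_j = ⟪w_j, ξ⟫`. No stochastic calculus is needed
(`IsLevyProcess.integral_exp_neg_sum_sq`).

The `g_j` form a Gaussian sequence with covariances at most `ρ^|j-l| / (2θ)`, where `1 - ρ` is of
order `δ`, and variances close to `1/(2θ)` away from the terminal time. Hence centred sums `∑ δ
(f(g_j) - E f(g_j))`, for `f` the identity or a character, have size `√T` instead of `T`. The drift
contributes order `a √T`; the Gaussian part and the small jumps contribute `a² T`. Both vanish
because `T φ_T² → 0` when `α < 2`. For jumps `|z| > 1`, replacing `exp(i a z g_j)` by its mean costs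
`√T ∫ min(1, c a |z|) ν(dz)`, which also vanishes. What is left is `T ∫ (1 - exp(-a² z² / (4θ)))
ν(dz)` over `|z| > 1`. By regular variation and `T H(1/φ_T) → 1` it tends to `Γ(1 - α/2)
(l/(2θ))^(α/2)`. The estimate is assembled in `IsLevyProcess.abs_integral_exp_neg_sum_sq_sub_le`,
its limit in `IsOUSolution.tendsto_integral_exp`.

The passage from Laplace transforms to laws combines tightness with the point-separating algebra of
polynomials in `exp(-x)`. The same tightness gives existence of the stable law, as a weak limit
point of the energies themselves. -/

noncomputable section

namespace LevyOU

/-! ### Potter bounds and Karamata's theorem for monotone functions -/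

section RegularVariation

variable {f : ℝ → ℝ} {α : ℝ}

/-- Potter's upper bound for a monotone regularly varying function. -/
theorem RegularlyVarying.exists_forall_mul_le (hf : RegularlyVarying f (-α))
    (hanti : AntitoneOn f (Set.Ioi 0)) {β : ℝ} (hβ : 0 < β) (hβα : β < α) :
    ∃ R₀, 1 ≤ R₀ ∧ ∀ R, R₀ ≤ R → ∀ x, 1 ≤ x → f (x * R) ≤ 2 ^ β * x ^ (-β) * f R := by
  -- The strict inequality of exponents turns the limit at `x = 2` into a bound for one doubling.
  -- Iteration covers powers of two, and monotonicity fills the gaps at the cost of `2 ^ β`.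
  have h2 : (2 : ℝ) ^ (-α) < 2 ^ (-β) :=
    Real.rpow_lt_rpow_of_exponent_lt one_lt_two (by linarith)
  obtain ⟨R₁, hR₁⟩ := eventually_atTop.1 ((hf.2 2 two_pos).eventually_lt_const h2)
  refine ⟨max R₁ 1, le_max_right _ _, fun R hR x hx => ?_⟩
  have hR1 : 1 ≤ R := (le_max_right _ _).trans hR
  have iter : ∀ n : ℕ, f (2 ^ n * R) ≤ (2 ^ (-β)) ^ n * f R := by
    intro n
    induction n with
    | zero => simp
    | succ n ih =>
      have hn : (1 : ℝ) ≤ 2 ^ n := one_le_pow₀ one_le_two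
      have hle : R ≤ 2 ^ n * R := le_mul_of_one_le_left (by linarith) hn
      have h := hR₁ (2 ^ n * R) (((le_max_left _ _).trans hR).trans hle)
      have hpos := hf.1 (2 ^ n * R) (by linarith)
      rw [div_lt_iff₀ hpos] at h
      calc f (2 ^ (n + 1) * R) = f (2 * (2 ^ n * R)) := by ring_nf
        _ ≤ 2 ^ (-β) * f (2 ^ n * R) := h.le
        _ ≤ 2 ^ (-β) * ((2 ^ (-β)) ^ n * f R) := by gcongr
        _ = _ := by ring
  obtain ⟨n, hn1, hn2⟩ := exists_nat_pow_near hx one_lt_two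
  have hfR := hf.1 R (by linarith)
  have hn0 : (0 : ℝ) < 2 ^ n := by positivity
  calc f (x * R) ≤ f (2 ^ n * R) :=
        hanti (Set.mem_Ioi.2 (by positivity)) (Set.mem_Ioi.2 (by positivity)) (by gcongr)
    _ ≤ (2 ^ (-β)) ^ n * f R := iter n
    _ = (2 ^ n : ℝ) ^ (-β) * f R := by
        rw [← Real.rpow_natCast, ← Real.rpow_mul two_pos.le, mul_comm (-β), Real.rpow_mul two_pos.le,
          Real.rpow_natCast]
    _ ≤ (x / 2) ^ (-β) * f R := by
        have hx2 : x / 2 ≤ 2 ^ n := by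
          rw [pow_succ] at hn2
          linarith
        exact mul_le_mul_of_nonneg_right
          (Real.rpow_le_rpow_of_nonpos (by positivity) hx2 (neg_nonpos.2 hβ.le)) hfR.le
    _ = _ := by
        rw [Real.div_rpow (by linarith) two_pos.le, Real.rpow_neg two_pos.le, div_inv_eq_mul,
          mul_comm (x ^ (-β))]

/-- Potter's lower bound for a monotone regularly varying function. -/
theorem RegularlyVarying.exists_forall_le_mul (hf : RegularlyVarying f (-α))
    (hanti : AntitoneOn f (Set.Ioi 0)) {γ : ℝ} (hγ : 0 < γ) (hαγ : α < γ) :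
    ∃ R₀, 1 ≤ R₀ ∧ ∀ R, R₀ ≤ R → ∀ x, 1 ≤ x → f R ≤ 2 ^ γ * x ^ γ * f (x * R) := by
  have h2 : (2 : ℝ) ^ (-γ) < 2 ^ (-α) :=
    Real.rpow_lt_rpow_of_exponent_lt one_lt_two (by linarith)
  obtain ⟨R₁, hR₁⟩ := eventually_atTop.1 ((hf.2 2 two_pos).eventually_const_lt h2)
  refine ⟨max R₁ 1, le_max_right _ _, fun R hR x hx => ?_⟩
  have hR1 : 1 ≤ R := (le_max_right _ _).trans hR
  have iter : ∀ n : ℕ, f R ≤ (2 ^ γ) ^ n * f (2 ^ n * R) := by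
    intro n
    induction n with
    | zero => simp
    | succ n ih =>
      have hn : (1 : ℝ) ≤ 2 ^ n := one_le_pow₀ one_le_two
      have hle : R ≤ 2 ^ n * R := le_mul_of_one_le_left (by linarith) hn
      have h := hR₁ (2 ^ n * R) (((le_max_left _ _).trans hR).trans hle)
      have hpos := hf.1 (2 ^ n * R) (by linarith)
      rw [lt_div_iff₀ hpos, Real.rpow_neg two_pos.le, inv_mul_lt_iff₀ (by positivity)] at h
      calc f R ≤ (2 ^ γ) ^ n * f (2 ^ n * R) := ih
        _ ≤ (2 ^ γ) ^ n * (2 ^ γ * f (2 * (2 ^ n * R))) := by gcongr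
        _ = (2 ^ γ) ^ (n + 1) * f (2 ^ (n + 1) * R) := by ring_nf
  obtain ⟨n, hn1, hn2⟩ := exists_nat_pow_near hx one_lt_two
  have hfR := hf.1 (2 ^ (n + 1) * R) (by positivity)
  calc f R ≤ (2 ^ γ) ^ (n + 1) * f (2 ^ (n + 1) * R) := iter (n + 1)
    _ = (2 ^ (n + 1) : ℝ) ^ γ * f (2 ^ (n + 1) * R) := by
        rw [← Real.rpow_natCast, ← Real.rpow_mul two_pos.le, mul_comm γ, Real.rpow_mul two_pos.le,
          Real.rpow_natCast]
    _ ≤ (2 * x) ^ γ * f (2 ^ (n + 1) * R) := by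
        gcongr
        rw [pow_succ]
        linarith
    _ ≤ (2 * x) ^ γ * f (x * R) := by
        gcongr
        exact hanti (Set.mem_Ioi.2 (by positivity)) (Set.mem_Ioi.2 (by positivity)) (by gcongr)
    _ = _ := by rw [Real.mul_rpow two_pos.le (by linarith)]

/-- Nothing is known about `f` on `(-∞, 0]`; truncating the argument at `R` gives a function
antitone on the whole line. -/
theorem measurable_max_of_antitoneOn (hanti : AntitoneOn f (Set.Ioi 0)) {R : ℝ} (hR : 0 < R) :
    Measurable fun x => f (max x R) := by
  refine Antitone.measurable fun x y hxy => ?_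
  exact hanti (lt_max_of_lt_right hR) (lt_max_of_lt_right hR) (max_le_max_right _ hxy)

theorem aestronglyMeasurable_div_of_antitoneOn (hanti : AntitoneOn f (Set.Ioi 0)) {R : ℝ}
    (hR : 0 < R) (c : ℝ) (hc : 0 < c) :
    AEStronglyMeasurable (fun x => f (c * x) / x) (volume.restrict (Set.Ioi R)) := by
  have h : Measurable fun x => f (max (c * x) (c * R)) / x :=
    ((measurable_max_of_antitoneOn hanti (mul_pos hc hR)).comp (measurable_const_mul c)).div
      measurable_id
  refine h.aestronglyMeasurable.congr ?_
  filter_upwards [ae_restrict_mem measurableSet_Ioi] with x hx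
  rw [max_eq_left (by have : R < x := hx; gcongr)]

/-- At infinity Potter's bound with exponent `α / 2` dominates by `z ^ (-α/2 - 1)`; on `(R, R₀]` the
integrand is at most `f R / R`. -/
theorem RegularlyVarying.integrableOn_div (hf : RegularlyVarying f (-α))
    (hanti : AntitoneOn f (Set.Ioi 0)) (hα : 0 < α) {R : ℝ} (hR : 0 < R) :
    IntegrableOn (fun z => f z / z) (Set.Ioi R) := by
  obtain ⟨R₀, hR₀, hb⟩ := hf.exists_forall_mul_le hanti (half_pos hα) (half_lt_self hα)
  have hR₀' : 0 < R₀ := by linarith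
  have hmeas : ∀ {S : ℝ}, 0 < S →
      AEStronglyMeasurable (fun x => f x / x) (volume.restrict (Set.Ioi S)) := fun hS => by
    simpa using aestronglyMeasurable_div_of_antitoneOn hanti hS 1 one_pos
  have htail : IntegrableOn (fun z => f z / z) (Set.Ioi R₀) := by
    have hInt : IntegrableOn (fun z : ℝ => 2 ^ (α / 2) * R₀ ^ (α / 2) * f R₀ * z ^ (-(α / 2) - 1))
        (Set.Ioi R₀) :=
      (integrableOn_Ioi_rpow_of_lt (by linarith) hR₀').const_mul _
    refine Integrable.mono' hInt (hmeas hR₀') ?_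
    filter_upwards [ae_restrict_mem measurableSet_Ioi] with x hx
    have hx' : R₀ < x := hx
    have hx0 : 0 < x := hR₀'.trans hx'
    have h := hb R₀ le_rfl (x / R₀) ((one_le_div hR₀').2 hx'.le)
    rw [div_mul_cancel₀ _ hR₀'.ne', Real.div_rpow hx0.le hR₀'.le, Real.rpow_neg hR₀'.le,
      div_inv_eq_mul] at h
    rw [Real.norm_of_nonneg (div_nonneg (hf.1 x hx0).le hx0.le), Real.rpow_sub_one hx0.ne',
      ← mul_div_assoc]
    gcongr
    linarith
  have hmid : IntegrableOn (fun z => f z / z) (Set.Ioc R R₀) := by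
    refine Integrable.mono' (g := fun _ => f R / R) (integrable_const _)
      ((hmeas hR).mono_measure (Measure.restrict_mono Set.Ioc_subset_Ioi_self le_rfl)) ?_
    filter_upwards [ae_restrict_mem measurableSet_Ioc] with x hx
    have hx0 : 0 < x := hR.trans hx.1
    rw [Real.norm_of_nonneg (div_nonneg (hf.1 x hx0).le hx0.le)]
    exact div_le_div₀ (hf.1 R hR).le (hanti hR hx0 hx.1.le) hR hx.1.le
  exact (hmid.union htail).mono_set fun x hx => (le_or_gt x R₀).imp (fun h => ⟨hx, h⟩) fun h => h

/-- Karamata's theorem for the tail integral. -/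
theorem RegularlyVarying.tendsto_integral_div_self (hf : RegularlyVarying f (-α))
    (hanti : AntitoneOn f (Set.Ioi 0)) (hα : 0 < α) :
    Tendsto (fun R => (α * ∫ z in Set.Ioi R, f z / z) / f R) atTop (𝓝 1) := by
  obtain ⟨R₀, hR₀, hb⟩ := hf.exists_forall_mul_le hanti (half_pos hα) (half_lt_self hα)
  -- After the substitution `z = R x` regular variation gives the pointwise limit of the integrand
  -- and Potter's bound an integrable majorant.
  have hlim : Tendsto (fun R => ∫ x in Set.Ioi (1 : ℝ), f (R * x) / x / f R) atTop
      (𝓝 (∫ x in Set.Ioi (1 : ℝ), x ^ (-α - 1))) := by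
    refine tendsto_integral_filter_of_dominated_convergence
      (fun x => 2 ^ (α / 2) * x ^ (-(α / 2) - 1)) ?_ ?_ ?_ ?_
    · filter_upwards [eventually_gt_atTop 0] with R hR
      exact (aestronglyMeasurable_div_of_antitoneOn hanti one_pos R hR).mul_const (f R)⁻¹
    · filter_upwards [eventually_ge_atTop R₀] with R hR
      filter_upwards [ae_restrict_mem measurableSet_Ioi] with x hx
      have hx' : 1 < x := hx
      have hR0 : 0 < R := by linarith
      have hfR := hf.1 R hR0
      have hfx := hf.1 (R * x) (by positivity)
      rw [Real.norm_of_nonneg (by positivity), div_le_iff₀ hfR, Real.rpow_sub_one (by linarith),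
        ← mul_div_assoc, div_mul_eq_mul_div]
      gcongr
      rw [mul_comm R x]
      exact hb R hR x hx'.le
    · exact (integrableOn_Ioi_rpow_of_lt (by linarith) one_pos).const_mul _
    · filter_upwards [ae_restrict_mem measurableSet_Ioi] with x hx
      have hx0 : 0 < x := lt_trans one_pos hx
      have h := (hf.2 x hx0).div_const x
      rw [← Real.rpow_sub_one hx0.ne'] at h
      refine h.congr fun R => ?_
      rw [mul_comm R x, div_right_comm]
  have hval : α * ∫ x in Set.Ioi (1 : ℝ), x ^ (-α - 1) = 1 := by
    rw [integral_Ioi_rpow_of_lt (by linarith) one_pos]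
    simp
    field_simp
  rw [← hval]
  refine (hlim.const_mul α).congr' ?_
  filter_upwards [eventually_gt_atTop 0] with R hR
  have hsub := integral_comp_mul_left_Ioi (fun z => f z / z) 1 hR
  rw [mul_one, smul_eq_mul] at hsub
  rw [mul_div_assoc, integral_div]
  congr 2
  have h1 : ∀ x, f (R * x) / x = R * (f (R * x) / (R * x)) := fun x => by
    rw [← mul_div_assoc, mul_div_mul_left _ _ hR.ne']
  simp_rw [h1]
  rw [integral_const_mul, hsub, mul_inv_cancel_left₀ hR.ne']

end RegularVariation

/-! ### The smoothed tail and the scaling `φ_T` -/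

section Scaling

variable {ν : Measure ℝ} {α : ℝ}

theorem IsLevyMeasure.integrable_min_sq (hν : IsLevyMeasure ν) :
    Integrable (fun z : ℝ => min (z ^ 2) 1) ν := by
  refine ⟨by fun_prop, ?_⟩
  rw [hasFiniteIntegral_iff_ofReal (ae_of_all _ fun z => le_min (sq_nonneg z) zero_le_one)]
  exact hν.integral_lt_top

theorem measurableSet_lt_abs (R : ℝ) : MeasurableSet {z : ℝ | R < |z|} :=
  measurableSet_lt measurable_const measurable_norm

theorem IsLevyMeasure.measure_lt_abs_lt_top (hν : IsLevyMeasure ν) {R : ℝ} (hR : 0 < R) :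
    ν {z | R < |z|} < ⊤ := by
  refine (measure_mono fun z (hz : R < |z|) => ?_).trans_lt
    (hν.integrable_min_sq.measure_norm_ge_lt_top (lt_min (pow_pos hR 2) one_pos))
  rw [Set.mem_ofPred_eq, Real.norm_of_nonneg (le_min (sq_nonneg z) zero_le_one), ← sq_abs z]
  exact min_le_min_right _ (by gcongr)

theorem IsLevyMeasure.isFiniteMeasure_restrict (hν : IsLevyMeasure ν) {R : ℝ} (hR : 0 < R) :
    IsFiniteMeasure (ν.restrict {z | R < |z|}) :=
  MeasureTheory.isFiniteMeasure_restrict.2 (hν.measure_lt_abs_lt_top hR).ne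

theorem IsLevyMeasure.antitoneOn_tail (hν : IsLevyMeasure ν) :
    AntitoneOn (tail ν) (Set.Ioi 0) := fun _ hR _ _ hRS =>
  measureReal_mono (fun _ hz => lt_of_le_of_lt hRS hz) (hν.measure_lt_abs_lt_top hR).ne

theorem RegularlyVarying.tendsto_atTop_zero {f : ℝ → ℝ} (hf : RegularlyVarying f (-α))
    (hanti : AntitoneOn f (Set.Ioi 0)) (hα : 0 < α) : Tendsto f atTop (𝓝 0) := by
  obtain ⟨R₀, hR₀, hb⟩ := hf.exists_forall_mul_le hanti (half_pos hα) (half_lt_self hα)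
  have hR₀' : 0 < R₀ := by linarith
  have h1 : Tendsto (fun x : ℝ => 2 ^ (α / 2) * (x / R₀) ^ (-(α / 2)) * f R₀) atTop (𝓝 0) := by
    have := (tendsto_rpow_neg_atTop (half_pos hα)).comp (tendsto_id.atTop_div_const hR₀')
    simpa using (this.const_mul (2 ^ (α / 2))).mul_const (f R₀)
  refine squeeze_zero' ?_ ?_ h1
  · filter_upwards [eventually_gt_atTop 0] with x hx using (hf.1 x hx).le
  · filter_upwards [eventually_ge_atTop R₀] with x hx
    have h := hb R₀ le_rfl (x / R₀) ((one_le_div hR₀').2 hx)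
    rwa [div_mul_cancel₀ _ hR₀'.ne'] at h

theorem smoothTail_sub (hν : IsLevyMeasure ν) (hH : RegularlyVarying (tail ν) (-α)) (hα : 0 < α)
    {R S : ℝ} (hR : 0 < R) (hRS : R ≤ S) :
    smoothTail α ν R - smoothTail α ν S = α * ∫ z in R..S, tail ν z / z := by
  rw [smoothTail, smoothTail, ← mul_sub,
    intervalIntegral.integral_Ioi_sub_Ioi (hH.integrableOn_div hν.antitoneOn_tail hα hR) hRS]

theorem intervalIntegrable_tail_div (hν : IsLevyMeasure ν) (hH : RegularlyVarying (tail ν) (-α))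
    (hα : 0 < α) {R S : ℝ} (hR : 0 < R) (hRS : R ≤ S) :
    IntervalIntegrable (fun z => tail ν z / z) volume R S := by
  rw [intervalIntegrable_iff_integrableOn_Ioc_of_le hRS]
  exact (hH.integrableOn_div hν.antitoneOn_tail hα hR).mono_set Set.Ioc_subset_Ioi_self

theorem strictAntiOn_smoothTail (hν : IsLevyMeasure ν) (hH : RegularlyVarying (tail ν) (-α))
    (hα : 0 < α) : StrictAntiOn (smoothTail α ν) (Set.Ioi 0) := by
  intro R hR S hS hRS
  rw [← sub_pos, smoothTail_sub hν hH hα hR hRS.le]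
  refine mul_pos hα (intervalIntegral.intervalIntegral_pos_of_pos_on
    (intervalIntegrable_tail_div hν hH hα hR hRS.le) (fun z hz => ?_) hRS)
  have hz0 : 0 < z := lt_trans hR hz.1
  exact div_pos (hH.1 z hz0) hz0

theorem continuousOn_smoothTail (hν : IsLevyMeasure ν) (hH : RegularlyVarying (tail ν) (-α))
    (hα : 0 < α) {R : ℝ} (hR : 0 < R) : ContinuousOn (smoothTail α ν) (Set.Ici R) :=
  (IntegrableOn.continuousOn_Ici_primitive_Ioi
    (hH.integrableOn_div hν.antitoneOn_tail hα hR)).const_mul α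

theorem smoothTail_pos (hν : IsLevyMeasure ν) (hH : RegularlyVarying (tail ν) (-α))
    (hα : 0 < α) {R : ℝ} (hR : 0 < R) : 0 < smoothTail α ν R := by
  have h1 : 0 ≤ smoothTail α ν (R + 1) :=
    mul_nonneg hα.le (setIntegral_nonneg measurableSet_Ioi fun z hz =>
      div_nonneg measureReal_nonneg (by have : R + 1 < z := hz; linarith))
  exact h1.trans_lt
    (strictAntiOn_smoothTail hν hH hα hR (Set.mem_Ioi.2 (by linarith)) (by linarith))

theorem tendsto_smoothTail_div_tail (hν : IsLevyMeasure ν) (hH : RegularlyVarying (tail ν) (-α))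
    (hα : 0 < α) : Tendsto (fun R => smoothTail α ν R / tail ν R) atTop (𝓝 1) :=
  hH.tendsto_integral_div_self hν.antitoneOn_tail hα

/-- Intermediate values: the smoothed tail vanishes at infinity because it is equivalent to the
tail, and it is unbounded near zero because `H ≥ H(1)` on `(0,1]` forces logarithmic growth there.
-/
theorem exists_smoothTail_eq (hν : IsLevyMeasure ν) (hH : RegularlyVarying (tail ν) (-α))
    (hα : 0 < α) {y : ℝ} (hy : 0 < y) : ∃ u, 0 < u ∧ smoothTail α ν u = y := by
  have hanti := hν.antitoneOn_tail
  have hlim : Tendsto (smoothTail α ν) atTop (𝓝 0) := by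
    have h := (tendsto_smoothTail_div_tail hν hH hα).mul (hH.tendsto_atTop_zero hanti hα)
    rw [mul_zero] at h
    refine h.congr' ?_
    filter_upwards [eventually_gt_atTop 0] with R hR
    rw [div_mul_cancel₀ _ (hH.1 R hR).ne']
  obtain ⟨S, hS1, hS⟩ := ((eventually_ge_atTop 1).and (hlim.eventually_lt_const hy)).exists
  have hc := hH.1 1 one_pos
  -- Chosen so that `α * H(1) * log (1 / R) = y`.
  set R := Real.exp (-(y / (α * tail ν 1))) with hRdef
  have hR : 0 < R := Real.exp_pos _
  have hR1 : R ≤ 1 := Real.exp_le_one_iff.2 (by have : 0 < y / (α * tail ν 1) := by positivity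
                                                linarith)
  have hRy : y ≤ smoothTail α ν R := by
    have hii := intervalIntegrable_tail_div hν hH hα hR hR1
    have h0 : (0 : ℝ) ∉ Set.uIcc R 1 := by
      rw [Set.uIcc_of_le hR1]
      exact fun h => absurd h.1 (by linarith)
    have hmono : ∫ z in R..1, tail ν 1 * z⁻¹ ≤ ∫ z in R..1, tail ν z / z := by
      refine intervalIntegral.integral_mono_on hR1 ?_ hii fun z hz => ?_
      · exact (intervalIntegral.intervalIntegrable_inv (fun z hz => fun hz0 => h0 (hz0 ▸ hz))
          continuousOn_id).const_mul _
      · have hz0 : 0 < z := hR.trans_le hz.1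
        rw [div_eq_mul_inv]
        gcongr
        exact hanti hz0 (Set.mem_Ioi.2 one_pos) hz.2
    rw [intervalIntegral.integral_const_mul, integral_inv h0, Real.log_div one_ne_zero hR.ne',
      Real.log_one, hRdef, Real.log_exp] at hmono
    have h1 := smoothTail_sub hν hH hα hR hR1
    have h2 := smoothTail_pos hν hH hα one_pos
    have h3 : α * (tail ν 1 * (0 - -(y / (α * tail ν 1)))) = y := by field_simp; ring
    nlinarith [mul_le_mul_of_nonneg_left hmono hα.le]
  obtain ⟨u, hu, huy⟩ := intermediate_value_Icc' (hR1.trans hS1)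
    ((continuousOn_smoothTail hν hH hα hR).mono Set.Icc_subset_Ici_self) ⟨hS.le, hRy⟩
  exact ⟨u, hR.trans_le hu.1, huy⟩

/-- Strict monotonicity makes the set under the infimum a singleton, so neither an empty set nor an
unattained infimum can occur. -/
theorem scaling_spec (hν : IsLevyMeasure ν) (hH : RegularlyVarying (tail ν) (-α)) (hα : 0 < α)
    {T : ℝ} (hT : 0 < T) :
    0 < scaling α ν T ∧ smoothTail α ν (scaling α ν T)⁻¹ = 1 / T := by
  obtain ⟨u, hu, huT⟩ := exists_smoothTail_eq hν hH hα (one_div_pos.2 hT)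
  have hset : {v : ℝ | 0 < v ∧ smoothTail α ν v = 1 / T} = {u} := by
    ext v
    refine ⟨fun hv => ?_, fun hv => by rw [Set.mem_singleton_iff.1 hv]; exact ⟨hu, huT⟩⟩
    exact (strictAntiOn_smoothTail hν hH hα).injOn hv.1 hu (hv.2.trans huT.symm)
  rw [scaling, hset, csInf_singleton, inv_inv]
  exact ⟨inv_pos.2 hu, huT⟩

theorem tendsto_inv_scaling (hν : IsLevyMeasure ν) (hH : RegularlyVarying (tail ν) (-α))
    (hα : 0 < α) : Tendsto (fun T => (scaling α ν T)⁻¹) atTop atTop := by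
  refine tendsto_atTop.2 fun M => ?_
  have hM : 0 < max M 1 := lt_max_of_lt_right one_pos
  have hpos := smoothTail_pos hν hH hα hM
  have h0 : Tendsto (fun T : ℝ => 1 / T) atTop (𝓝 0) := by
    simpa using tendsto_inv_atTop_zero (𝕜 := ℝ)
  filter_upwards [eventually_gt_atTop 0, h0.eventually_lt_const hpos] with T hT hlt
  obtain ⟨h1, h2⟩ := scaling_spec hν hH hα hT
  rw [← h2, (strictAntiOn_smoothTail hν hH hα).lt_iff_gt (Set.mem_Ioi.2 (inv_pos.2 h1)) hM] at hlt
  exact (le_max_left _ _).trans hlt.le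

/-- Karamata's theorem allows the smoothed tail, equal to `1 / T` at `1 / φ_T`, to be exchanged for
the tail itself. -/
theorem tendsto_mul_tail_inv_scaling (hν : IsLevyMeasure ν)
    (hH : RegularlyVarying (tail ν) (-α)) (hα : 0 < α) :
    Tendsto (fun T => T * tail ν (scaling α ν T)⁻¹) atTop (𝓝 1) := by
  have h := ((tendsto_smoothTail_div_tail hν hH hα).comp
    (tendsto_inv_scaling hν hH hα)).inv₀ one_ne_zero
  rw [inv_one] at h
  refine h.congr' ?_
  filter_upwards [eventually_gt_atTop 0] with T hT
  rw [Function.comp_apply, (scaling_spec hν hH hα hT).2, inv_div, one_div, div_inv_eq_mul, mul_comm]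

theorem tendsto_scaling (hν : IsLevyMeasure ν) (hH : RegularlyVarying (tail ν) (-α))
    (hα : 0 < α) : Tendsto (scaling α ν) atTop (𝓝 0) := by
  simpa [Function.comp_def] using tendsto_inv_atTop_zero.comp (tendsto_inv_scaling hν hH hα)

/-- With `u = 1/φ_T` and `α < γ < 2`, Potter's lower bound gives `1 ≤ C u^γ H(u)`. Hence `T u⁻² ≤ C
(T H(u)) u^(γ-2)`, where `T H(u)` stays bounded. This is what makes the Gaussian part, the small
jumps and the drift negligible. -/
theorem tendsto_mul_scaling_sq (hν : IsLevyMeasure ν) (hH : RegularlyVarying (tail ν) (-α))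
    (hα : α ∈ Set.Ioo (0 : ℝ) 2) :
    Tendsto (fun T => T * scaling α ν T ^ 2) atTop (𝓝 0) := by
  obtain ⟨γ, hγ1, hγ2⟩ := exists_between hα.2
  have hγ0 : 0 < γ := hα.1.trans hγ1
  obtain ⟨R₀, hR₀, hb⟩ := hH.exists_forall_le_mul hν.antitoneOn_tail hγ0 hγ1
  have hR₀' : 0 < R₀ := by linarith
  have hu := tendsto_inv_scaling hν hH hα.1
  have hlim : Tendsto (fun T => (T * tail ν (scaling α ν T)⁻¹) *
      ((2 ^ γ / R₀ ^ γ / tail ν R₀) * ((scaling α ν T)⁻¹) ^ (-(2 - γ)))) atTop (𝓝 0) := by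
    have h1 := ((tendsto_rpow_neg_atTop (by linarith : 0 < 2 - γ)).comp hu).const_mul
      (2 ^ γ / R₀ ^ γ / tail ν R₀)
    have h2 := (tendsto_mul_tail_inv_scaling hν hH hα.1).mul h1
    simpa using h2
  refine squeeze_zero' ?_ ?_ hlim
  · filter_upwards [eventually_gt_atTop 0] with T hT
    positivity
  · filter_upwards [eventually_gt_atTop 0, hu.eventually_ge_atTop R₀] with T hT huT
    set u := (scaling α ν T)⁻¹ with hudef
    have hu0 : 0 < u := by linarith
    have hs : scaling α ν T ^ 2 = u ^ (-2 : ℝ) := by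
      rw [Real.rpow_neg hu0.le, Real.rpow_two, hudef, inv_pow, inv_inv]
    have h := hb R₀ le_rfl (u / R₀) ((one_le_div hR₀').2 huT)
    rw [div_mul_cancel₀ _ hR₀'.ne', Real.div_rpow hu0.le hR₀'.le] at h
    have hHR := hH.1 R₀ hR₀'
    have hsplit : u ^ (-(2 - γ)) = u ^ γ * u ^ (-2 : ℝ) := by
      rw [← Real.rpow_add hu0]
      ring_nf
    rw [hs, hsplit]
    have h1 : 1 ≤ tail ν u * (2 ^ γ / R₀ ^ γ / tail ν R₀ * u ^ γ) := by
      rw [show tail ν u * (2 ^ γ / R₀ ^ γ / tail ν R₀ * u ^ γ) =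
        (2 ^ γ * (u ^ γ / R₀ ^ γ) * tail ν u) / tail ν R₀ by ring]
      exact (one_le_div hHR).2 h
    have h2 : 0 ≤ T * u ^ (-2 : ℝ) := by positivity
    calc T * u ^ (-2 : ℝ) ≤ T * u ^ (-2 : ℝ) * (tail ν u * (2 ^ γ / R₀ ^ γ / tail ν R₀ * u ^ γ)) :=
          le_mul_of_one_le_right h2 h1
      _ = _ := by ring

end Scaling

/-! ### Integrals of the Lévy measure over the large jumps -/

section TailIntegral

variable {ν : Measure ℝ} {α : ℝ}

theorem integral_mul_exp_neg_mul_sq (κ x : ℝ) :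
    ∫ t in (0 : ℝ)..x, 2 * κ * t * Real.exp (-κ * t ^ 2) = 1 - Real.exp (-κ * x ^ 2) := by
  have hd : ∀ t ∈ Set.uIcc 0 x, HasDerivAt (fun t : ℝ => -Real.exp (-κ * t ^ 2))
      (2 * κ * t * Real.exp (-κ * t ^ 2)) t := by
    intro t _
    have h := ((hasDerivAt_pow 2 t).const_mul (-κ)).exp.neg
    refine h.congr_deriv ?_
    push_cast
    ring
  rw [intervalIntegral.integral_eq_sub_of_hasDerivAt hd
    (Continuous.intervalIntegrable (by fun_prop) _ _)]
  simp
  ring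

/-- Layer-cake formula for `φ |z|` under `ν` restricted to `|z| > 1`; the restriction produces the
maximum with `1`. -/
theorem setIntegral_one_sub_exp_eq (hν : IsLevyMeasure ν) {κ φ : ℝ} (hκ : 0 < κ) (hφ : 0 < φ) :
    ∫ z in {z | 1 < |z|}, (1 - Real.exp (-κ * (φ * z) ^ 2)) ∂ν =
      ∫ x in Set.Ioi (0 : ℝ), tail ν (max (x * φ⁻¹) 1) * (2 * κ * x * Real.exp (-κ * x ^ 2)) := by
  have hnn : ∀ x : ℝ, 0 ≤ 1 - Real.exp (-κ * x ^ 2) := fun x => by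
    rw [sub_nonneg, Real.exp_le_one_iff, neg_mul, neg_nonpos]
    positivity
  have hnn2 : ∀ x ∈ Set.Ioi (0 : ℝ), 0 ≤ 2 * κ * x * Real.exp (-κ * x ^ 2) := fun x hx => by
    have : 0 < x := hx
    positivity
  have hmeas : Measurable fun x => tail ν (max (x * φ⁻¹) 1) :=
    (measurable_max_of_antitoneOn hν.antitoneOn_tail one_pos).comp (measurable_mul_const _)
  rw [integral_eq_lintegral_of_nonneg_ae (ae_of_all _ fun z => hnn _) (by fun_prop),
    integral_eq_lintegral_of_nonneg_ae]
  rotate_left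
  · filter_upwards [ae_restrict_mem measurableSet_Ioi] with x hx
    exact mul_nonneg measureReal_nonneg (hnn2 x hx)
  · exact (hmeas.mul (by fun_prop)).aestronglyMeasurable
  congr 1
  have hlc := lintegral_comp_eq_lintegral_meas_lt_mul (ν.restrict {z | 1 < |z|})
    (f := fun z => φ * |z|) (g := fun t => 2 * κ * t * Real.exp (-κ * t ^ 2))
    (ae_of_all _ fun z => by positivity) (by fun_prop)
    (fun t _ => Continuous.intervalIntegrable (by fun_prop) _ _)
    (by filter_upwards [ae_restrict_mem measurableSet_Ioi] with x hx using hnn2 x hx)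
  simp_rw [integral_mul_exp_neg_mul_sq, mul_pow, sq_abs] at hlc
  simp_rw [mul_pow]
  rw [hlc]
  refine setLIntegral_congr_fun measurableSet_Ioi fun x hx => ?_
  have hset : {z : ℝ | x < φ * |z|} ∩ {z | 1 < |z|} = {z | max (x * φ⁻¹) 1 < |z|} := by
    ext z
    simp only [Set.mem_inter_iff, Set.mem_ofPred_eq, max_lt_iff, ← div_eq_mul_inv,
      div_lt_iff₀' hφ]
  rw [Measure.restrict_apply (measurableSet_lt measurable_const (by fun_prop)), hset,
    tail, ENNReal.ofReal_mul measureReal_nonneg, ofReal_measureReal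
      (hν.measure_lt_abs_lt_top (lt_max_of_lt_right one_pos)).ne]

theorem integral_rpow_neg_mul_exp {κ : ℝ} (hκ : 0 < κ) (hα : α < 2) :
    ∫ x in Set.Ioi (0 : ℝ), x ^ (-α) * (2 * κ * x * Real.exp (-κ * x ^ 2)) =
      Real.Gamma (1 - α / 2) * κ ^ (α / 2) := by
  have h1 : ∀ x ∈ Set.Ioi (0 : ℝ), x ^ (-α) * (2 * κ * x * Real.exp (-κ * x ^ 2)) =
      2 * κ * (x ^ (1 - α) * Real.exp (-κ * x ^ (2 : ℝ))) := fun x hx => by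
    have hx0 : (0 : ℝ) < x := hx
    rw [Real.rpow_two, sub_eq_add_neg, Real.rpow_add hx0, Real.rpow_one]
    ring
  rw [setIntegral_congr_fun measurableSet_Ioi h1, integral_const_mul,
    integral_rpow_mul_exp_neg_mul_rpow two_pos (by linarith) hκ]
  rw [show (1 - α + 1) / 2 = 1 - α / 2 by ring, show -(1 - α + 1) / 2 = α / 2 - 1 by ring,
    Real.rpow_sub_one hκ.ne']
  field_simp

theorem tendsto_mul_tail_mul_inv_scaling (hν : IsLevyMeasure ν)
    (hH : RegularlyVarying (tail ν) (-α)) (hα : 0 < α) {x : ℝ} (hx : 0 < x) :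
    Tendsto (fun T => T * tail ν (max (x * (scaling α ν T)⁻¹) 1)) atTop (𝓝 (x ^ (-α))) := by
  have hu := tendsto_inv_scaling hν hH hα
  have h := (tendsto_mul_tail_inv_scaling hν hH hα).mul ((hH.2 x hx).comp hu)
  rw [one_mul] at h
  refine h.congr' ?_
  filter_upwards [hu.eventually_gt_atTop 0, (hu.const_mul_atTop hx).eventually_ge_atTop 1]
    with T hT hT1
  rw [Function.comp_apply, max_eq_left hT1, mul_assoc, mul_div_cancel₀ _ (hH.1 _ hT).ne']

/-- This is the majorant for dominated convergence, with `u = 1/φ_T` in three regimes. For `x ≥ 1`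
monotonicity suffices. For `x < 1` and `x u ≥ R₀`, Potter's bound compares `x u` with `u`. For `x u
< R₀` regular variation says nothing, so the tail is bounded by `H(1)`, a multiple of `H(R₀)`, and
Potter's bound from `R₀` to `u` applies since `u / R₀ ≤ 1 / x`. -/
theorem exists_mul_tail_le (hν : IsLevyMeasure ν) (hH : RegularlyVarying (tail ν) (-α))
    (hα : 0 < α) {γ : ℝ} (hγ : α < γ) :
    ∃ C, ∀ᶠ T in atTop, ∀ x, 0 < x →
      T * tail ν (max (x * (scaling α ν T)⁻¹) 1) ≤ C * (1 + x ^ (-γ)) := by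
  have hγ0 : 0 < γ := hα.trans hγ
  have hanti := hν.antitoneOn_tail
  obtain ⟨R₀, hR₀, hb⟩ := hH.exists_forall_le_mul hanti hγ0 hγ
  have hR₀' : 0 < R₀ := by linarith
  have hHR := hH.1 R₀ hR₀'
  have hH1 := hH.1 1 one_pos
  have hratio : 1 ≤ tail ν 1 / tail ν R₀ :=
    (one_le_div hHR).2 (hanti (Set.mem_Ioi.2 one_pos) hR₀' hR₀)
  set c := tail ν 1 / tail ν R₀
  have hc0 : 0 < c := one_pos.trans_le hratio
  have h2γ : (1 : ℝ) ≤ 2 ^ γ := Real.one_le_rpow one_le_two hγ0.le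
  refine ⟨2 * (2 ^ γ * c), ?_⟩
  filter_upwards [eventually_gt_atTop 0, (tendsto_inv_scaling hν hH hα).eventually_ge_atTop R₀,
    (tendsto_mul_tail_inv_scaling hν hH hα).eventually_le_const one_lt_two] with T hT hu hTu x hx
  set u := (scaling α ν T)⁻¹
  have hu0 : 0 < u := by linarith
  have hHu := hH.1 u hu0
  have hxγ : 0 < x ^ (-γ) := by positivity
  suffices tail ν (max (x * u) 1) ≤ 2 ^ γ * c * (1 + x ^ (-γ)) * tail ν u by
    calc T * tail ν (max (x * u) 1) ≤ T * (2 ^ γ * c * (1 + x ^ (-γ)) * tail ν u) := by gcongr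
      _ = 2 ^ γ * c * (1 + x ^ (-γ)) * (T * tail ν u) := by ring
      _ ≤ 2 ^ γ * c * (1 + x ^ (-γ)) * 2 := by gcongr
      _ = _ := by ring
  rcases le_or_gt 1 x with hx1 | hx1
  · calc tail ν (max (x * u) 1) ≤ tail ν u := hanti hu0
          (Set.mem_Ioi.2 (lt_max_of_lt_right one_pos))
          (le_max_of_le_left (le_mul_of_one_le_left hu0.le hx1))
      _ ≤ 2 ^ γ * c * (1 + x ^ (-γ)) * tail ν u := by
          refine le_mul_of_one_le_left hHu.le ?_
          exact one_le_mul_of_one_le_of_one_le (one_le_mul_of_one_le_of_one_le h2γ hratio)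
            (by linarith)
  have hfin : 2 ^ γ * c * x ^ (-γ) * tail ν u ≤ 2 ^ γ * c * (1 + x ^ (-γ)) * tail ν u := by
    gcongr
    linarith
  refine le_trans ?_ hfin
  rcases le_or_gt R₀ (x * u) with hxu | hxu
  · have h := hb (x * u) hxu x⁻¹ ((one_le_inv₀ hx).2 hx1.le)
    rw [inv_mul_cancel_left₀ hx.ne', Real.inv_rpow hx.le, ← Real.rpow_neg hx.le] at h
    rw [max_eq_left (hR₀.trans hxu)]
    calc tail ν (x * u) ≤ 2 ^ γ * x ^ (-γ) * tail ν u := h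
      _ ≤ c * (2 ^ γ * x ^ (-γ) * tail ν u) := le_mul_of_one_le_left (by positivity) hratio
      _ = _ := by ring
  · have h := hb R₀ le_rfl (u / R₀) ((one_le_div hR₀').2 hu)
    rw [div_mul_cancel₀ _ hR₀'.ne'] at h
    have hux : (u / R₀) ^ γ ≤ x ^ (-γ) := by
      rw [Real.rpow_neg hx.le, ← Real.inv_rpow hx.le]
      refine Real.rpow_le_rpow (by positivity) ?_ hγ0.le
      rw [div_le_iff₀ hR₀', inv_mul_eq_div, le_div_iff₀ hx, mul_comm]
      exact hxu.le
    calc tail ν (max (x * u) 1) ≤ tail ν 1 :=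
          hanti (Set.mem_Ioi.2 one_pos) (Set.mem_Ioi.2 (lt_max_of_lt_right one_pos))
            (le_max_right _ _)
      _ = c * tail ν R₀ := (div_mul_cancel₀ _ hHR.ne').symm
      _ ≤ c * (2 ^ γ * (u / R₀) ^ γ * tail ν u) := by gcongr
      _ ≤ c * (2 ^ γ * x ^ (-γ) * tail ν u) := by gcongr
      _ = _ := by ring

/-- The Laplace exponent of the rescaled squared large jumps converges to the stable one. -/
theorem tendsto_mul_setIntegral_one_sub_exp (hν : IsLevyMeasure ν)
    (hH : RegularlyVarying (tail ν) (-α)) (hα : α ∈ Set.Ioo (0 : ℝ) 2) {κ : ℝ} (hκ : 0 < κ) :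
    Tendsto (fun T => T * ∫ z in {z | 1 < |z|},
        (1 - Real.exp (-κ * (scaling α ν T * z) ^ 2)) ∂ν) atTop
      (𝓝 (Real.Gamma (1 - α / 2) * κ ^ (α / 2))) := by
  -- The majorant behaves like `x ^ (1 - γ)` at the origin, which is integrable exactly because `γ <
  -- 2`.
  obtain ⟨γ, hγ1, hγ2⟩ := exists_between hα.2
  obtain ⟨C, hC⟩ := exists_mul_tail_le hν hH hα.1 hγ1
  have hlim : Tendsto (fun T => ∫ x in Set.Ioi (0 : ℝ),
      (T * tail ν (max (x * (scaling α ν T)⁻¹) 1)) * (2 * κ * x * Real.exp (-κ * x ^ 2))) atTop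
      (𝓝 (∫ x in Set.Ioi (0 : ℝ), x ^ (-α) * (2 * κ * x * Real.exp (-κ * x ^ 2)))) := by
    refine tendsto_integral_filter_of_dominated_convergence
      (fun x => C * (1 + x ^ (-γ)) * (2 * κ * x * Real.exp (-κ * x ^ 2))) ?_ ?_ ?_ ?_
    · refine Eventually.of_forall fun T => Measurable.aestronglyMeasurable ?_
      exact (((measurable_max_of_antitoneOn hν.antitoneOn_tail one_pos).comp
        (measurable_mul_const _)).const_mul T).mul (by fun_prop)
    · filter_upwards [hC, eventually_gt_atTop 0] with T hT hT0
      filter_upwards [ae_restrict_mem measurableSet_Ioi] with x hx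
      have hx0 : 0 < x := hx
      have ht : 0 ≤ tail ν (max (x * (scaling α ν T)⁻¹) 1) := measureReal_nonneg
      rw [Real.norm_of_nonneg (by positivity)]
      exact mul_le_mul_of_nonneg_right (hT x hx0) (by positivity)
    · have h1 := (integrableOn_rpow_mul_exp_neg_mul_sq hκ (s := 1) (by norm_num)).const_mul
        (C * (2 * κ))
      have h2 := (integrableOn_rpow_mul_exp_neg_mul_sq hκ (s := 1 - γ) (by linarith)).const_mul
        (C * (2 * κ))
      refine (h1.add h2).congr ?_
      filter_upwards [ae_restrict_mem measurableSet_Ioi] with x hx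
      have hx0 : (0 : ℝ) < x := hx
      simp only [Pi.add_apply]
      rw [sub_eq_add_neg 1 γ, Real.rpow_add hx0, Real.rpow_one]
      ring
    · filter_upwards [ae_restrict_mem measurableSet_Ioi] with x hx
      exact (tendsto_mul_tail_mul_inv_scaling hν hH hα.1 hx).mul_const _
  rw [integral_rpow_neg_mul_exp hκ hα.2] at hlim
  refine hlim.congr' ?_
  filter_upwards [eventually_gt_atTop 0] with T hT
  rw [setIntegral_one_sub_exp_eq hν hκ (scaling_spec hν hH hα.1 hT).1, ← integral_const_mul]
  simp_rw [mul_assoc]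

theorem min_one_le_two_mul_one_sub_exp {y : ℝ} (hy : 0 ≤ y) :
    min 1 y ≤ 2 * (1 - Real.exp (-y)) := by
  have h1 : Real.exp (-y) ≤ (1 + y)⁻¹ := by
    rw [Real.exp_neg]
    exact inv_anti₀ (by linarith) (by linarith [Real.add_one_le_exp y])
  have h2 : 2 * (1 - (1 + y)⁻¹) = 2 * y / (1 + y) := by field_simp; ring
  have h3 : min 1 y ≤ 2 * y / (1 + y) := by
    rw [le_div_iff₀ (by linarith)]
    rcases le_total 1 y with h | h
    · rw [min_eq_left h]
      linarith
    · rw [min_eq_right h]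
      nlinarith
  linarith

theorem setIntegral_le_sqrt_mul_sqrt {μ : Measure ℝ} [IsFiniteMeasure μ] {g : ℝ → ℝ}
    (hg : Measurable g) (h0 : ∀ z, 0 ≤ g z) (h1 : ∀ z, g z ≤ 1) :
    ∫ z, g z ∂μ ≤ √(μ.real Set.univ) * √(∫ z, g z ^ 2 ∂μ) := by
  have hb : ∀ (p : ENNReal), MemLp g p μ := fun p =>
    MemLp.of_bound hg.aestronglyMeasurable 1
      (ae_of_all _ fun z => by rw [Real.norm_of_nonneg (h0 z)]; exact h1 z)
  have h := integral_mul_le_Lp_mul_Lq_of_nonneg (p := 2) (q := 2) (μ := μ) (f := fun _ => 1) (g := g)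
    ⟨by norm_num, by norm_num, by norm_num⟩ (ae_of_all _ fun _ => zero_le_one) (ae_of_all _ h0)
    (memLp_const 1) (hb _)
  simpa [Real.sqrt_eq_rpow] using h

theorem integrableOn_min_one_mul_abs (hν : IsLevyMeasure ν) (c : ℝ) (hc : 0 ≤ c) {M : ℝ}
    (hM : 0 < M) : IntegrableOn (fun z => min 1 (c * |z|)) {z | M < |z|} ν := by
  have := hν.isFiniteMeasure_restrict hM
  refine Integrable.of_bound (by fun_prop) 1 (ae_of_all _ fun z => ?_)
  rw [Real.norm_of_nonneg (le_min zero_le_one (by positivity))]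
  exact min_le_left _ _

/-- Below the cut `M` the integrand is at most `c M`. Above it Cauchy–Schwarz leaves the factor
`√H(M)`, small for large `M`, and an `L²` norm controlled by `min(1, y)² = min(1, y²) ≤ 2 (1 -
exp(-y²))`. -/
theorem setIntegral_min_one_le (hν : IsLevyMeasure ν) {c M : ℝ} (hc : 0 ≤ c) (hM : 1 ≤ M) :
    ∫ z in {z | 1 < |z|}, min 1 (c * |z|) ∂ν ≤ c * M * tail ν 1 +
      √(tail ν M) * √(2 * ∫ z in {z | 1 < |z|}, (1 - Real.exp (-1 * (c * z) ^ 2)) ∂ν) := by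
  have hfin1 := hν.isFiniteMeasure_restrict one_pos
  have hfinM := hν.isFiniteMeasure_restrict (one_pos.trans_le hM)
  have hsub : {z : ℝ | M < |z|} ⊆ {z | 1 < |z|} := fun z hz => lt_of_le_of_lt hM hz
  have hg0 : ∀ z : ℝ, 0 ≤ min 1 (c * |z|) := fun z => le_min zero_le_one (by positivity)
  have hnn : ∀ x : ℝ, 0 ≤ 1 - Real.exp (-1 * x ^ 2) := fun x => by
    rw [sub_nonneg, Real.exp_le_one_iff, neg_one_mul, neg_nonpos]
    positivity
  have hpt : ∀ z ∈ {z : ℝ | 1 < |z|}, min 1 (c * |z|) ≤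
      c * M + Set.indicator {z | M < |z|} (fun z => min 1 (c * |z|)) z := by
    intro z _
    by_cases hz : M < |z|
    · rw [Set.indicator_of_mem (show z ∈ {z : ℝ | M < |z|} from hz)]
      have : 0 ≤ c * M := by positivity
      linarith
    · rw [Set.indicator_of_notMem (show z ∉ {z : ℝ | M < |z|} from hz), add_zero]
      exact (min_le_right _ _).trans (mul_le_mul_of_nonneg_left (not_lt.1 hz) hc)
  have hind : IntegrableOn (Set.indicator {z | M < |z|} fun z => min 1 (c * |z|))
      {z | 1 < |z|} ν :=
    (integrableOn_min_one_mul_abs hν c hc one_pos).indicator (measurableSet_lt_abs M)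
  calc ∫ z in {z | 1 < |z|}, min 1 (c * |z|) ∂ν
      ≤ ∫ z in {z | 1 < |z|}, (c * M + Set.indicator {z | M < |z|} (fun z => min 1 (c * |z|)) z) ∂ν :=
        setIntegral_mono_on (integrableOn_min_one_mul_abs hν c hc one_pos)
          ((integrable_const _).add hind) (measurableSet_lt_abs 1) hpt
    _ = c * M * tail ν 1 + ∫ z in {z | M < |z|}, min 1 (c * |z|) ∂ν := by
        rw [integral_add (integrable_const _) hind, integral_const,
          setIntegral_indicator (measurableSet_lt_abs M), Set.inter_eq_right.2 hsub,
          measureReal_restrict_apply_univ, smul_eq_mul, mul_comm (c * M), tail]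
    _ ≤ c * M * tail ν 1 + √(tail ν M) * √(∫ z in {z | M < |z|}, min 1 (c * |z|) ^ 2 ∂ν) := by
        gcongr
        have h := setIntegral_le_sqrt_mul_sqrt (μ := ν.restrict {z | M < |z|})
          (g := fun z => min 1 (c * |z|)) (by fun_prop) hg0 fun z => min_le_left _ _
        rwa [measureReal_restrict_apply_univ] at h
    _ ≤ _ := by
        gcongr
        rw [← integral_const_mul]
        have hInt : IntegrableOn (fun z => 2 * (1 - Real.exp (-1 * (c * z) ^ 2))) {z | 1 < |z|} ν :=
          Integrable.of_bound (by fun_prop) 2 (ae_of_all _ fun z => by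
            rw [Real.norm_of_nonneg (mul_nonneg two_pos.le (hnn _))]
            linarith [Real.exp_pos (-1 * (c * z) ^ 2)])
        refine (integral_mono_of_nonneg (ae_of_all _ fun z => sq_nonneg _)
          (hInt.mono_set hsub) (ae_of_all _ fun z => ?_)).trans
          (setIntegral_mono_set hInt (ae_of_all _ fun z => mul_nonneg two_pos.le (hnn _))
            hsub.eventuallyLE)
        have h := min_one_le_two_mul_one_sub_exp (sq_nonneg (c * z))
        rw [← neg_one_mul] at h
        refine le_trans (le_of_eq ?_) h
        rcases le_total 1 (c * |z|) with h1 | h1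
        · rw [min_eq_left h1, min_eq_left, one_pow]
          rw [mul_pow, ← sq_abs z, ← mul_pow]
          exact one_le_pow₀ h1
        · rw [min_eq_right h1, min_eq_right, mul_pow, mul_pow, sq_abs]
          rw [mul_pow, ← sq_abs z, ← mul_pow]
          exact pow_le_one₀ (by positivity) h1

theorem tendsto_sqrt_mul_setIntegral_min_one (hν : IsLevyMeasure ν)
    (hH : RegularlyVarying (tail ν) (-α)) (hα : α ∈ Set.Ioo (0 : ℝ) 2) {c : ℝ} (hc : 0 < c) :
    Tendsto (fun T => √T * ∫ z in {z | 1 < |z|}, min 1 (c * scaling α ν T * |z|) ∂ν) atTop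
      (𝓝 0) := by
  have hM := tendsto_mul_setIntegral_one_sub_exp hν hH hα (pow_pos hc 2)
  set K := Real.Gamma (1 - α / 2) * (c ^ 2) ^ (α / 2)
  rw [Metric.tendsto_atTop']
  intro ε hε
  have htail0 : Tendsto (fun M => √(tail ν M) * √(2 * (K + 1))) atTop (𝓝 0) := by
    simpa using ((hH.tendsto_atTop_zero hν.antitoneOn_tail hα.1).sqrt).mul_const (√(2 * (K + 1)))
  -- The cut is fixed before `T`: the part above it is small uniformly in large `T`, and the part
  -- below it is then killed by `T φ_T² → 0`.
  obtain ⟨M, hM1, hMε⟩ :=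
    ((eventually_ge_atTop 1).and (htail0.eventually_lt_const (half_pos hε))).exists
  have hfirst : Tendsto (fun T => √(T * scaling α ν T ^ 2) * (c * M * tail ν 1)) atTop (𝓝 0) := by
    simpa using ((tendsto_mul_scaling_sq hν hH hα).sqrt).mul_const (c * M * tail ν 1)
  refine eventually_atTop.1 ?_ |>.imp fun T₀ hT₀ T hT => hT₀ T hT.le
  filter_upwards [eventually_gt_atTop 0, hfirst.eventually_lt_const (half_pos hε),
    hM.eventually_le_const (lt_add_one K)] with T hT h1 h2
  have hφ := (scaling_spec hν hH hα.1 hT).1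
  set φ := scaling α ν T
  have hnn : 0 ≤ ∫ z in {z | 1 < |z|}, min 1 (c * φ * |z|) ∂ν :=
    integral_nonneg fun z => le_min zero_le_one (by positivity)
  rw [dist_zero_right, Real.norm_of_nonneg (by positivity)]
  have h3 := setIntegral_min_one_le hν (mul_pos hc hφ).le hM1
  have hexp : ∀ z : ℝ, -1 * (c * φ * z) ^ 2 = -c ^ 2 * (φ * z) ^ 2 := fun z => by ring
  simp_rw [hexp] at h3
  set I := ∫ z in {z | 1 < |z|}, (1 - Real.exp (-c ^ 2 * (φ * z) ^ 2)) ∂ν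
  calc √T * ∫ z in {z | 1 < |z|}, min 1 (c * φ * |z|) ∂ν
      ≤ √T * (c * φ * M * tail ν 1 + √(tail ν M) * √(2 * I)) := by gcongr
    _ = √(T * φ ^ 2) * (c * M * tail ν 1) + √(tail ν M) * √(2 * (T * I)) := by
        rw [Real.sqrt_mul hT.le, Real.sqrt_sq hφ.le, show 2 * (T * I) = T * (2 * I) by ring,
          Real.sqrt_mul hT.le]
        ring
    _ ≤ √(T * φ ^ 2) * (c * M * tail ν 1) + √(tail ν M) * √(2 * (K + 1)) := by gcongr
    _ < ε := by linarith

end TailIntegral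

/-! ### Càdlàg paths, Riemann sums and the implicit Euler scheme -/

section Cadlag

theorem IsCadlag.exists_abs_le {f : ℝ≥0 → ℝ} (hf : IsCadlag f) (T : ℝ≥0) :
    ∃ B, ∀ t ≤ T, |f t| ≤ B := by
  suffices ∃ B, ∀ t ∈ Set.Icc 0 T, |f t| ≤ B from
    this.imp fun B hB t ht => hB t ⟨zero_le, ht⟩
  refine isCompact_Icc.induction_on (p := fun s => ∃ B, ∀ t ∈ s, |f t| ≤ B) ⟨0, by simp⟩
    (fun s t hst ⟨B, hB⟩ => ⟨B, fun x hx => hB x (hst hx)⟩) ?_ ?_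
  · rintro s t ⟨B, hB⟩ ⟨C, hC⟩
    refine ⟨max B C, fun x hx => hx.elim (fun h => ?_) fun h => ?_⟩
    · exact (hB x h).trans (le_max_left _ _)
    · exact (hC x h).trans (le_max_right _ _)
  · intro t _
    obtain ⟨hr, l, hl⟩ := hf t
    have h1 : ∀ᶠ x in 𝓝[≥] t, |f x| ≤ max (|f t| + 1) (|l| + 1) :=
      (hr.abs.eventually_le_const (lt_add_one _)).mono fun x hx => hx.trans (le_max_left _ _)
    have h2 : ∀ᶠ x in 𝓝[<] t, |f x| ≤ max (|f t| + 1) (|l| + 1) :=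
      (hl.abs.eventually_le_const (lt_add_one _)).mono fun x hx => hx.trans (le_max_right _ _)
    have h3 : ∀ᶠ x in 𝓝 t, |f x| ≤ max (|f t| + 1) (|l| + 1) := by
      rw [← nhdsLT_sup_nhdsGE t]
      exact eventually_sup.2 ⟨h2, h1⟩
    exact ⟨_, mem_nhdsWithin_of_mem_nhds h3, _, fun x hx => hx⟩

theorem IsCadlag.continuousWithinAt_toNNReal {f : ℝ≥0 → ℝ} (hf : IsCadlag f) (s : ℝ) :
    ContinuousWithinAt (fun r : ℝ => f r.toNNReal) (Set.Ici s) s := by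
  have h : ContinuousWithinAt f (Set.Ici s.toNNReal) s.toNNReal := (hf s.toNNReal).1
  exact h.comp continuous_real_toNNReal.continuousWithinAt
    fun r hr => Real.toNNReal_le_toNNReal hr

/-- The first point to the right of `s` in the grid of mesh `δ`. -/
def nextGridPoint (δ s : ℝ) : ℝ := (⌊s / δ⌋₊ + 1 : ℕ) * δ

theorem lt_nextGridPoint {δ : ℝ} (hδ : 0 < δ) (s : ℝ) : s < nextGridPoint δ s := by
  rw [nextGridPoint, ← div_lt_iff₀ hδ]
  push_cast
  exact Nat.lt_floor_add_one _

theorem nextGridPoint_le {δ s : ℝ} (hδ : 0 < δ) (hs : 0 ≤ s) : nextGridPoint δ s ≤ s + δ := by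
  have h := Nat.floor_le (div_nonneg hs hδ.le)
  rw [le_div_iff₀ hδ] at h
  rw [nextGridPoint]
  push_cast
  linarith

theorem measurable_step (a : ℕ → ℝ) (δ : ℝ) : Measurable fun s : ℝ => a ⌊s / δ⌋₊ :=
  measurable_from_nat.comp (Nat.measurable_floor.comp (measurable_id.div_const δ))

theorem tendsto_nextGridPoint {T s : ℝ} (hT : 0 < T) (hs : 0 ≤ s) :
    Tendsto (fun n : ℕ => nextGridPoint (T / n) s) atTop (𝓝[≥] s) := by
  have hδ : Tendsto (fun n : ℕ => T / n) atTop (𝓝 0) := tendsto_const_div_atTop_nhds_zero_nat T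
  refine tendsto_nhdsWithin_iff.2 ⟨?_, ?_⟩
  · have h2 : Tendsto (fun n : ℕ => s + T / n) atTop (𝓝 s) := by simpa using hδ.const_add s
    refine tendsto_of_tendsto_of_tendsto_of_le_of_le' tendsto_const_nhds h2 ?_ ?_
    · filter_upwards [eventually_gt_atTop 0] with n hn
      exact (lt_nextGridPoint (div_pos hT (Nat.cast_pos.2 hn)) s).le
    · filter_upwards [eventually_gt_atTop 0] with n hn
      exact nextGridPoint_le (div_pos hT (Nat.cast_pos.2 hn)) hs
  · filter_upwards [eventually_gt_atTop 0] with n hn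
    exact (lt_nextGridPoint (div_pos hT (Nat.cast_pos.2 hn)) s).le

/-- A right-continuous function on the line is measurable. -/
theorem measurable_of_continuousWithinAt_Ici {x : ℝ → ℝ}
    (hx : ∀ s, ContinuousWithinAt x (Set.Ici s) s) (h0 : ∀ s ≤ 0, x s = x 0) : Measurable x := by
  have h : Measurable fun s => x (max s 0) := by
    refine measurable_of_tendsto_metrizable
      (f := fun (n : ℕ) (s : ℝ) => x (nextGridPoint (1 / n) (max s 0))) (fun n => ?_) ?_
    · exact (measurable_step (fun k => x ((k + 1 : ℕ) * (1 / n))) (1 / n)).comp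
        (measurable_id.max measurable_const)
    · rw [tendsto_pi_nhds]
      intro s
      exact (hx _).tendsto.comp (tendsto_nextGridPoint one_pos (le_max_right s 0))
  convert h using 2 with s
  rcases le_total s 0 with hs | hs
  · rw [max_eq_right hs, h0 s hs]
  · rw [max_eq_left hs]

theorem floor_div_of_mem_Ioo {δ s : ℝ} {k : ℕ} (hδ : 0 < δ)
    (hs : s ∈ Set.Ioo (k * δ) ((k + 1 : ℕ) * δ)) : ⌊s / δ⌋₊ = k := by
  have h1 : (k : ℝ) ≤ s / δ := (le_div_iff₀ hδ).2 hs.1.le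
  rw [Nat.floor_eq_iff ((Nat.cast_nonneg k).trans h1)]
  refine ⟨h1, ?_⟩
  rw [div_lt_iff₀ hδ]
  simpa using hs.2

theorem integral_step (a : ℕ → ℝ) {δ : ℝ} (hδ : 0 < δ) (n : ℕ) :
    IntervalIntegrable (fun s => a ⌊s / δ⌋₊) volume 0 (n * δ) ∧
      ∫ s in (0 : ℝ)..n * δ, a ⌊s / δ⌋₊ = δ * ∑ k ∈ Finset.range n, a k := by
  induction n with
  | zero => simp
  | succ n ih =>
    have hle : (n : ℝ) * δ ≤ (n + 1 : ℕ) * δ := by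
      push_cast
      linarith
    have hcongr : ∀ s ∈ Set.uIoo ((n : ℝ) * δ) ((n + 1 : ℕ) * δ), a n = a ⌊s / δ⌋₊ := fun s hs => by
      rw [Set.uIoo_of_le hle] at hs
      rw [floor_div_of_mem_Ioo hδ hs]
    have hInt : IntervalIntegrable (fun s => a ⌊s / δ⌋₊) volume (n * δ) ((n + 1 : ℕ) * δ) :=
      (intervalIntegrable_const (c := a n)).congr_uIoo hcongr
    refine ⟨ih.1.trans hInt, ?_⟩
    rw [← intervalIntegral.integral_add_adjacent_intervals ih.1 hInt, ih.2,
      ← intervalIntegral.integral_congr_uIoo hcongr, intervalIntegral.integral_const,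
      Finset.sum_range_succ, smul_eq_mul]
    push_cast
    ring

/-- The inequality `s < T` must be strict, since the grid point following `T` lies beyond `T`. The
integral arguments therefore discard the null set `{T}`. -/
theorem nextGridPoint_mem {T s : ℝ} {n : ℕ} (hT : 0 < T) (hn : 0 < n) (hs0 : 0 ≤ s) (hsT : s < T) :
    ⌊s / (T / n)⌋₊ + 1 ≤ n ∧ nextGridPoint (T / n) s ∈ Set.Icc 0 T := by
  have hn' : (0 : ℝ) < n := Nat.cast_pos.2 hn
  have hδ : 0 < T / n := div_pos hT hn'
  have h1 : ⌊s / (T / n)⌋₊ + 1 ≤ n := by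
    rw [Nat.add_one_le_iff, Nat.floor_lt (by positivity), div_lt_iff₀ hδ]
    rwa [mul_div_cancel₀ _ hn'.ne']
  refine ⟨h1, hs0.trans (lt_nextGridPoint hδ s).le, ?_⟩
  calc nextGridPoint (T / n) s ≤ n * (T / n) := by
        rw [nextGridPoint]
        gcongr
    _ = T := mul_div_cancel₀ _ hn'.ne'

theorem tendsto_integral_abs_sub_nextGridPoint {x : ℝ → ℝ} {T B : ℝ} (hT : 0 < T)
    (hxm : Measurable x) (hx : ∀ s, ContinuousWithinAt x (Set.Ici s) s)
    (hB : ∀ s ∈ Set.Icc 0 T, |x s| ≤ B) :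
    Tendsto (fun n : ℕ => ∫ s in (0 : ℝ)..T, |x s - x (nextGridPoint (T / n) s)|) atTop (𝓝 0) := by
  suffices Tendsto (fun n : ℕ => ∫ s in (0 : ℝ)..T, |x s - x (nextGridPoint (T / n) s)|) atTop
      (𝓝 (∫ _ in (0 : ℝ)..T, (0 : ℝ))) by simpa using this
  refine intervalIntegral.tendsto_integral_filter_of_dominated_convergence (fun _ => 2 * B) ?_ ?_
    (intervalIntegrable_const (μ := volume)) ?_
  · refine Eventually.of_forall fun n => Measurable.aestronglyMeasurable ?_
    exact (hxm.sub (measurable_step (fun k => x ((k + 1 : ℕ) * (T / n))) (T / n))).norm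
  · filter_upwards [eventually_gt_atTop 0] with n hn
    filter_upwards [Measure.ae_ne volume T] with s hsT hs
    rw [Set.uIoc_of_le hT.le] at hs
    have hlt : s < T := lt_of_le_of_ne hs.2 hsT
    rw [Real.norm_eq_abs, abs_abs]
    have h1 := hB s ⟨hs.1.le, hs.2⟩
    have h2 := hB _ (nextGridPoint_mem hT hn hs.1.le hlt).2
    exact (abs_sub _ _).trans (by linarith)
  · refine ae_of_all _ fun s hs => ?_
    rw [Set.uIoc_of_le hT.le] at hs
    have h := (hx s).tendsto.comp (tendsto_nextGridPoint hT hs.1.le)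
    have h2 := (h.const_sub (x s)).abs
    simpa using h2

/-- Sums of squares over a grid that follow a right-continuous function converge to the integral of
its square. -/
theorem tendsto_sum_sq_of_abs_sub_le {x : ℝ → ℝ} {T B : ℝ} (hT : 0 < T)
    (hx : ∀ s, ContinuousWithinAt x (Set.Ici s) s)
    (hB : ∀ s ∈ Set.Icc 0 T, |x s| ≤ B) {y : ℕ → ℕ → ℝ} {η : ℕ → ℝ} (hη : Tendsto η atTop (𝓝 0))
    (hy : ∀ n : ℕ, 0 < n → ∀ k ≤ n, |x (k * (T / n)) - y n k| ≤ η n) :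
    Tendsto (fun n : ℕ => T / n * ∑ k ∈ Finset.range n, y n (k + 1) ^ 2) atTop
      (𝓝 (∫ s in (0 : ℝ)..T, x s ^ 2)) := by
  -- The sum is the integral of a step function taking the value at the next grid point, so
  -- right-continuity suffices for pointwise convergence. It is dominated by `(B + 1) ^ 2` once `η n
  -- ≤ 1`.
  have hlim : Tendsto (fun n : ℕ => ∫ s in (0 : ℝ)..T, y n (⌊s / (T / n)⌋₊ + 1) ^ 2) atTop
      (𝓝 (∫ s in (0 : ℝ)..T, x s ^ 2)) := by
    refine intervalIntegral.tendsto_integral_filter_of_dominated_convergence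
      (fun _ => (B + 1) ^ 2) ?_ ?_ intervalIntegrable_const ?_
    · exact Eventually.of_forall fun n =>
        (measurable_step (fun k => y n (k + 1) ^ 2) (T / n)).aestronglyMeasurable
    · filter_upwards [eventually_gt_atTop 0, hη.eventually_le_const one_pos] with n hn hη1
      filter_upwards [Measure.ae_ne volume T] with s hsT hs
      rw [Set.uIoc_of_le hT.le] at hs
      obtain ⟨h1, h2⟩ := nextGridPoint_mem hT hn hs.1.le (lt_of_le_of_ne hs.2 hsT)
      have h3 := hy n hn _ h1
      have h4 := hB _ h2
      rw [nextGridPoint] at h4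
      rw [Real.norm_eq_abs, abs_pow]
      gcongr
      have h5 := abs_sub_abs_le_abs_sub (y n (⌊s / (T / n)⌋₊ + 1))
        (x ((⌊s / (T / n)⌋₊ + 1 : ℕ) * (T / n)))
      rw [abs_sub_comm] at h5
      linarith
    · filter_upwards [Measure.ae_ne volume T] with s hsT hs
      rw [Set.uIoc_of_le hT.le] at hs
      have h1 := (hx s).tendsto.comp (tendsto_nextGridPoint hT hs.1.le)
      have h2 : Tendsto (fun n : ℕ => x (nextGridPoint (T / n) s) - y n (⌊s / (T / n)⌋₊ + 1))
          atTop (𝓝 0) := by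
        refine squeeze_zero_norm' ?_ hη
        filter_upwards [eventually_gt_atTop 0] with n hn
        exact hy n hn _ (nextGridPoint_mem hT hn hs.1.le (lt_of_le_of_ne hs.2 hsT)).1
      have h3 := (h1.sub h2).pow 2
      simpa using h3
  refine hlim.congr' ?_
  filter_upwards [eventually_gt_atTop 0] with n hn
  have hn' : (0 : ℝ) < n := Nat.cast_pos.2 hn
  have h := (integral_step (fun k => y n (k + 1) ^ 2) (div_pos hT hn') n).2
  rwa [mul_div_cancel₀ _ hn'.ne'] at h

/-- The implicit Euler scheme `y_{k+1} = y_k - θ δ y_{k+1} + d_k`. -/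
def eulerScheme (ρ y₀ : ℝ) (d : ℕ → ℝ) : ℕ → ℝ
  | 0 => y₀
  | k + 1 => ρ * (eulerScheme ρ y₀ d k + d k)

/-- Subtracting the equation at two consecutive grid points gives `(1 + θδ) e_{k+1} = e_k - θ ∫ (x s
- x q) ds` for the error `e`, with `q` the right endpoint. Because the scheme is implicit, the
factor `1 + θδ ≥ 1` stands on the favourable side: errors only add up and no Grönwall argument is
needed. -/
theorem abs_sub_eulerScheme_le {x z : ℝ → ℝ} {θ δ : ℝ} (hθ : 0 < θ) (hδ : 0 < δ)
    (hxi : ∀ s t, IntervalIntegrable x volume s t)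
    (heq : ∀ t, 0 ≤ t → x t = x 0 - θ * (∫ s in (0 : ℝ)..t, x s) + z t) (k : ℕ) :
    IntervalIntegrable (fun s => |x s - x (nextGridPoint δ s)|) volume 0 (k * δ) ∧
    |x (k * δ) - eulerScheme (1 + θ * δ)⁻¹ (x 0)
        (fun j => z ((j + 1 : ℕ) * δ) - z (j * δ)) k| ≤
      θ * ∫ s in (0 : ℝ)..k * δ, |x s - x (nextGridPoint δ s)| := by
  induction k with
  | zero => simp [eulerScheme]
  | succ k ih =>
    obtain ⟨ihi, ih⟩ := ih
    set Y := eulerScheme (1 + θ * δ)⁻¹ (x 0) (fun j => z ((j + 1 : ℕ) * δ) - z (j * δ)) with hY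
    set p := (k : ℝ) * δ with hp
    set q := ((k + 1 : ℕ) : ℝ) * δ with hq
    have hp0 : 0 ≤ p := by positivity
    have hpq : q - p = δ := by
      rw [hp, hq]
      push_cast
      ring
    have hle : p ≤ q := by linarith
    have hcongr : ∀ s ∈ Set.uIoo p q, |x s - x q| = |x s - x (nextGridPoint δ s)| := fun s hs => by
      rw [Set.uIoo_of_le hle] at hs
      rw [nextGridPoint, floor_div_of_mem_Ioo hδ hs]
    have hxq : IntervalIntegrable (fun s => x s - x q) volume p q :=
      (hxi p q).sub intervalIntegrable_const
    have hInt : IntervalIntegrable (fun s => |x s - x (nextGridPoint δ s)|) volume p q :=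
      hxq.abs.congr_uIoo hcongr
    refine ⟨ihi.trans hInt, ?_⟩
    rw [← intervalIntegral.integral_add_adjacent_intervals ihi hInt,
      ← intervalIntegral.integral_congr_uIoo hcongr]
    have habs : |∫ s in p..q, (x s - x q)| ≤ ∫ s in p..q, |x s - x q| :=
      intervalIntegral.abs_integral_le_integral_abs hle
    have hval : ∫ s in p..q, (x s - x q) = (∫ s in p..q, x s) - δ * x q := by
      rw [intervalIntegral.integral_sub (hxi p q) intervalIntegrable_const,
        intervalIntegral.integral_const, hpq, smul_eq_mul]
    have hrec : (1 + θ * δ) * Y (k + 1) = Y k + (z q - z p) := by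
      have hne : 1 + θ * δ ≠ 0 := by positivity
      rw [hY, eulerScheme, mul_inv_cancel_left₀ hne]
    have hadd := intervalIntegral.integral_add_adjacent_intervals (hxi 0 p) (hxi p q)
    have e1 := heq p hp0
    have e2 := heq q (hp0.trans hle)
    rw [← hadd] at e2
    have hkey : (1 + θ * δ) * (x q - Y (k + 1)) =
        (x p - Y k) - θ * ∫ s in p..q, (x s - x q) := by
      rw [hval, mul_sub (1 + θ * δ), hrec]
      linarith
    have h1 : |x q - Y (k + 1)| ≤ (1 + θ * δ) * |x q - Y (k + 1)| :=
      le_mul_of_one_le_left (abs_nonneg _) (by have := mul_pos hθ hδ; linarith)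
    have h2 : (1 + θ * δ) * |x q - Y (k + 1)| = |(1 + θ * δ) * (x q - Y (k + 1))| := by
      rw [abs_mul, abs_of_pos (by positivity : 0 < 1 + θ * δ)]
    rw [hkey] at h2
    have h3 := abs_sub (x p - Y k) (θ * ∫ s in p..q, (x s - x q))
    rw [abs_mul, abs_of_pos hθ] at h3
    have h4 := mul_le_mul_of_nonneg_left habs hθ.le
    linarith

/-- The implicit Euler scheme for an Ornstein–Uhlenbeck path recovers the integral of its
square. -/
theorem tendsto_sum_sq_eulerScheme {x z : ℝ → ℝ} {θ T B : ℝ} (hθ : 0 < θ) (hT : 0 < T)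
    (hxm : Measurable x) (hx : ∀ s, ContinuousWithinAt x (Set.Ici s) s)
    (hxi : ∀ s t, IntervalIntegrable x volume s t)
    (hB : ∀ s ∈ Set.Icc 0 T, |x s| ≤ B)
    (heq : ∀ t, 0 ≤ t → x t = x 0 - θ * (∫ s in (0 : ℝ)..t, x s) + z t) :
    Tendsto (fun n : ℕ => T / n * ∑ k ∈ Finset.range n,
      eulerScheme (1 + θ * (T / n))⁻¹ (x 0)
        (fun j => z ((j + 1 : ℕ) * (T / n)) - z (j * (T / n))) (k + 1) ^ 2) atTop
      (𝓝 (∫ s in (0 : ℝ)..T, x s ^ 2)) := by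
  have hη := (tendsto_integral_abs_sub_nextGridPoint hT hxm hx hB).const_mul θ
  rw [mul_zero] at hη
  refine tendsto_sum_sq_of_abs_sub_le hT hx hB hη fun n hn k hk => ?_
  have hn' : (0 : ℝ) < n := Nat.cast_pos.2 hn
  have hδ := div_pos hT hn'
  refine (abs_sub_eulerScheme_le hθ hδ hxi heq k).2.trans ?_
  have hTn := (abs_sub_eulerScheme_le hθ hδ hxi heq n).1
  rw [mul_div_cancel₀ _ hn'.ne'] at hTn
  gcongr
  refine intervalIntegral.integral_mono_interval le_rfl (by positivity) ?_
    (ae_of_all _ fun s => abs_nonneg _) hTn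
  calc (k : ℝ) * (T / n) ≤ n * (T / n) := by gcongr
    _ = T := mul_div_cancel₀ _ hn'.ne'

end Cadlag

/-! ### Gaussian characters along the response vectors -/

section Gaussian

open scoped RealInnerProductSpace

section General

variable {E : Type*} [NormedAddCommGroup E] [InnerProductSpace ℝ E] [FiniteDimensional ℝ E]
  [MeasurableSpace E] [BorelSpace E]

theorem integral_exp_inner_stdGaussian (s : ℝ) (w : E) :
    ∫ ξ, Complex.exp (Complex.I * (s * ⟪w, ξ⟫ : ℝ)) ∂(stdGaussian E) =
      (Real.exp (-(s ^ 2 * ‖w‖ ^ 2 / 2)) : ℝ) := by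
  have h := charFun_stdGaussian (E := E) (s • w)
  rw [charFun_apply] at h
  have h1 : ∀ ξ : E, Complex.exp (Complex.I * (s * ⟪w, ξ⟫ : ℝ)) =
      Complex.exp (⟪ξ, s • w⟫ * Complex.I) := fun ξ => by
    rw [mul_comm, real_inner_smul_right, real_inner_comm]
  simp_rw [h1]
  rw [h, ← Complex.ofReal_pow, norm_smul, Real.norm_eq_abs, mul_pow, sq_abs]
  push_cast
  ring_nf

theorem memLp_inner_stdGaussian (w : E) : MemLp (fun ξ => ⟪w, ξ⟫) 2 (stdGaussian E) :=
  IsGaussian.memLp_dual (stdGaussian E) (innerSL ℝ w) 2 (by simp)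

theorem integrable_inner_sq_stdGaussian (w : E) :
    Integrable (fun ξ => ⟪w, ξ⟫ ^ 2) (stdGaussian E) :=
  (memLp_inner_stdGaussian w).integrable_sq

theorem integral_inner_sq_stdGaussian (w : E) :
    ∫ ξ, ⟪w, ξ⟫ ^ 2 ∂(stdGaussian E) = ‖w‖ ^ 2 := by
  have h := variance_dual_stdGaussian (innerSL ℝ w)
  rw [innerSL_apply_norm, variance_of_integral_eq_zero (by fun_prop)
    (integral_strongDual_stdGaussian _)] at h
  simpa using h

theorem integral_abs_le_sqrt {Ω : Type*} {mΩ : MeasurableSpace Ω} {μ : Measure Ω}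
    [IsProbabilityMeasure μ] {f : Ω → ℝ} (hf : MemLp f 2 μ) :
    ∫ ω, |f ω| ∂μ ≤ √(∫ ω, f ω ^ 2 ∂μ) := by
  have h := variance_nonneg |f| μ
  rw [variance_eq_sub hf.abs] at h
  refine Real.le_sqrt_of_sq_le ?_
  simpa using h

theorem norm_cexp_I_mul_ofReal (x : ℝ) : ‖Complex.exp (Complex.I * (x : ℝ))‖ = 1 := by
  rw [mul_comm, Complex.norm_exp_ofReal_mul_I]

/-- The second moment of a centred sum of Gaussian characters. -/
theorem integral_norm_sq_sum_exp_sub (s δ : ℝ) (n : ℕ) (w : ℕ → E) :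
    ∫ ξ, ‖∑ j ∈ Finset.range n, (δ : ℂ) * (Complex.exp (Complex.I * (s * ⟪w j, ξ⟫ : ℝ)) -
        (Real.exp (-(s ^ 2 * ‖w j‖ ^ 2 / 2)) : ℝ))‖ ^ 2 ∂(stdGaussian E) =
      ∑ j ∈ Finset.range n, ∑ l ∈ Finset.range n, δ ^ 2 *
        (Real.exp (-(s ^ 2 * ‖w j - w l‖ ^ 2 / 2)) -
          Real.exp (-(s ^ 2 * ‖w j‖ ^ 2 / 2)) * Real.exp (-(s ^ 2 * ‖w l‖ ^ 2 / 2))) := by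
  set m : ℕ → ℝ := fun j => Real.exp (-(s ^ 2 * ‖w j‖ ^ 2 / 2))
  set e : ℕ → E → ℂ := fun j ξ => Complex.exp (Complex.I * (s * ⟪w j, ξ⟫ : ℝ)) with he
  have hei : ∀ j, Integrable (e j) (stdGaussian E) := fun j =>
    Integrable.of_bound (by fun_prop) 1 (ae_of_all _ fun ξ => (norm_cexp_I_mul_ofReal _).le)
  have hee : ∀ j l ξ, e j ξ * (starRingEnd ℂ) (e l ξ) =
      Complex.exp (Complex.I * (s * ⟪w j - w l, ξ⟫ : ℝ)) := by
    intro j l ξ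
    rw [he, ← Complex.exp_conj, ← Complex.exp_add, map_mul, Complex.conj_I, Complex.conj_ofReal,
      inner_sub_left]
    push_cast
    ring_nf
  have heei : ∀ j l, Integrable (fun ξ => e j ξ * (starRingEnd ℂ) (e l ξ)) (stdGaussian E) := by
    intro j l
    simp_rw [hee]
    exact Integrable.of_bound (by fun_prop) 1 (ae_of_all _ fun ξ => (norm_cexp_I_mul_ofReal _).le)
  have hci : ∀ l, Integrable (fun ξ => (starRingEnd ℂ) (e l ξ)) (stdGaussian E) := fun l =>
    (hei l).congr' (by fun_prop) (ae_of_all _ fun ξ => by simp)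
  have hme : ∀ j, ∫ ξ, e j ξ ∂(stdGaussian E) = m j := fun j =>
    integral_exp_inner_stdGaussian s (w j)
  have hce : ∀ l, ∫ ξ, (starRingEnd ℂ) (e l ξ) ∂(stdGaussian E) = m l := fun l => by
    rw [integral_conj, hme, Complex.conj_ofReal]
  have hprod : ∀ j l ξ, (δ : ℂ) * (e j ξ - m j) * (starRingEnd ℂ) ((δ : ℂ) * (e l ξ - m l)) =
      (δ : ℂ) ^ 2 * (e j ξ * (starRingEnd ℂ) (e l ξ) - m l * e j ξ -
        m j * (starRingEnd ℂ) (e l ξ) + m j * m l) := by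
    intro j l ξ
    simp only [map_mul, map_sub, Complex.conj_ofReal]
    ring
  have hpi : ∀ j l, Integrable (fun ξ => (δ : ℂ) ^ 2 * (e j ξ * (starRingEnd ℂ) (e l ξ) - m l * e j ξ
      - m j * (starRingEnd ℂ) (e l ξ) + m j * m l)) (stdGaussian E) := fun j l =>
    ((((heei j l).sub ((hei j).const_mul _)).sub ((hci l).const_mul _)).add
      (integrable_const _)).const_mul _
  have hInt : ∀ j l, ∫ ξ, (δ : ℂ) ^ 2 * (e j ξ * (starRingEnd ℂ) (e l ξ) - m l * e j ξ
      - m j * (starRingEnd ℂ) (e l ξ) + m j * m l) ∂(stdGaussian E) =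
      (δ ^ 2 * (Real.exp (-(s ^ 2 * ‖w j - w l‖ ^ 2 / 2)) - m j * m l) : ℝ) := by
    intro j l
    have i1 : Integrable (fun ξ => e j ξ * (starRingEnd ℂ) (e l ξ) - m l * e j ξ) (stdGaussian E) :=
      (heei j l).sub ((hei j).const_mul _)
    have i2 : Integrable (fun ξ => e j ξ * (starRingEnd ℂ) (e l ξ) - m l * e j ξ -
        m j * (starRingEnd ℂ) (e l ξ)) (stdGaussian E) := i1.sub ((hci l).const_mul _)
    rw [integral_const_mul, integral_add i2 (integrable_const _),
      integral_sub i1 ((hci l).const_mul _),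
      integral_sub (heei j l) ((hei j).const_mul _), integral_const_mul, integral_const_mul, hce, hme]
    simp_rw [hee]
    rw [integral_exp_inner_stdGaussian]
    simp only [integral_const, probReal_univ, one_smul]
    push_cast
    ring
  apply Complex.ofReal_injective
  rw [← integral_complex_ofReal]
  have hsq : ∀ ξ, ((‖∑ j ∈ Finset.range n, (δ : ℂ) * (e j ξ - m j)‖ ^ 2 : ℝ) : ℂ) =
      ∑ j ∈ Finset.range n, ∑ l ∈ Finset.range n, (δ : ℂ) ^ 2 *
        (e j ξ * (starRingEnd ℂ) (e l ξ) - m l * e j ξ - m j * (starRingEnd ℂ) (e l ξ)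
          + m j * m l) := by
    intro ξ
    rw [Complex.ofReal_pow, ← Complex.mul_conj', map_sum, Finset.sum_mul_sum]
    exact Finset.sum_congr rfl fun j _ => Finset.sum_congr rfl fun l _ => hprod j l ξ
  refine (integral_congr_ae (ae_of_all _ hsq)).trans ?_
  rw [integral_finsetSum _ fun j _ => integrable_finsetSum _ fun l _ => hpi j l]
  rw [Complex.ofReal_sum]
  refine Finset.sum_congr rfl fun j _ => ?_
  rw [integral_finsetSum _ fun l _ => hpi j l, Complex.ofReal_sum]
  exact Finset.sum_congr rfl fun l _ => hInt j l

end General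

/-- Convexity of the exponential between `0` and `t`. -/
theorem exp_mul_sub_one_le {r t : ℝ} (hr0 : 0 ≤ r) (hr1 : r ≤ 1) :
    Real.exp (r * t) - 1 ≤ r * (Real.exp t - 1) := by
  have h := convexOn_exp.2 (Set.mem_univ t) (Set.mem_univ 0) hr0 (sub_nonneg.2 hr1) (by ring)
  simp only [smul_eq_mul, mul_zero, add_zero, Real.exp_zero, mul_one] at h
  linarith

/-- The left side is the covariance of two Gaussian characters with variances `v ≤ v'` and
covariance `r v`. It equals `exp(-y(v+v')/2) (exp(r y v) - 1)`, and convexity extracts `r`, leaving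
`r (1 - exp(-y v))`. Linearity in `r` makes the covariances summable along the grid, while the
minimum with `1` keeps the bound usable for very large jumps. -/
theorem exp_covariance_le {r v v' y V : ℝ} (hr0 : 0 ≤ r) (hr1 : r ≤ 1) (hy : 0 ≤ y) (hv : 0 ≤ v)
    (hvv' : v ≤ v') (hvV : v ≤ V) :
    Real.exp (-(y * (v' + v - 2 * (r * v)) / 2)) - Real.exp (-(y * v' / 2)) * Real.exp (-(y * v / 2))
      ≤ r * min 1 (y * V) := by
  have h1 : Real.exp (-(y * (v' + v - 2 * (r * v)) / 2)) -
      Real.exp (-(y * v' / 2)) * Real.exp (-(y * v / 2)) =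
      Real.exp (-(y * (v' + v) / 2)) * (Real.exp (r * (y * v)) - 1) := by
    rw [mul_sub (Real.exp _), ← Real.exp_add, ← Real.exp_add, mul_one]
    ring_nf
  have hyv : 0 ≤ y * v := mul_nonneg hy hv
  have h2 : 0 ≤ Real.exp (r * (y * v)) - 1 := by
    have := Real.one_le_exp (mul_nonneg hr0 hyv)
    linarith
  have h3 : Real.exp (-(y * (v' + v) / 2)) ≤ Real.exp (-(y * v)) := by
    rw [Real.exp_le_exp]
    nlinarith
  have h4 : Real.exp (-(y * v)) * (Real.exp (y * v) - 1) = 1 - Real.exp (-(y * v)) := by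
    rw [mul_sub, ← Real.exp_add]
    simp
  have h5 : 1 - Real.exp (-(y * v)) ≤ min 1 (y * V) := by
    refine le_min (by linarith [Real.exp_pos (-(y * v))]) ?_
    have := Real.add_one_le_exp (-(y * v))
    have := mul_le_mul_of_nonneg_left hvV hy
    linarith
  rw [h1]
  calc Real.exp (-(y * (v' + v) / 2)) * (Real.exp (r * (y * v)) - 1)
      ≤ Real.exp (-(y * v)) * (r * (Real.exp (y * v) - 1)) :=
        mul_le_mul h3 (exp_mul_sub_one_le hr0 hr1) h2 (Real.exp_pos _).le
    _ = r * (1 - Real.exp (-(y * v))) := by rw [← h4]; ring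
    _ ≤ _ := mul_le_mul_of_nonneg_left h5 hr0

/-- With truncated subtraction `(j - l) + (l - j)` is `|j - l|`; each side of `j` is bounded by a
geometric series. -/
theorem sum_pow_dist_le {ρ : ℝ} (h0 : 0 ≤ ρ) (h1 : ρ < 1) (n j : ℕ) :
    ∑ l ∈ Finset.range n, ρ ^ ((j - l) + (l - j)) ≤ 2 / (1 - ρ) := by
  have hgeo : ∀ m, ∑ i ∈ Finset.range m, ρ ^ i ≤ 1 / (1 - ρ) := fun m => by
    have h := geom_sum_mul_neg ρ m
    rw [le_div_iff₀ (by linarith), h]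
    linarith [pow_nonneg h0 m]
  have hsub : ∑ l ∈ Finset.range n, ρ ^ ((j - l) + (l - j)) ≤
      ∑ l ∈ Finset.range (j + 1 + n), ρ ^ ((j - l) + (l - j)) :=
    Finset.sum_le_sum_of_subset_of_nonneg (Finset.range_mono (by omega))
      fun _ _ _ => pow_nonneg h0 _
  refine hsub.trans ?_
  rw [Finset.sum_range_add, ← Finset.sum_range_reflect]
  have e1 : ∑ i ∈ Finset.range (j + 1), ρ ^ ((j - (j + 1 - 1 - i)) + (j + 1 - 1 - i - j)) =
      ∑ i ∈ Finset.range (j + 1), ρ ^ i := by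
    refine Finset.sum_congr rfl fun i hi => ?_
    have := Finset.mem_range.1 hi
    congr 1
    omega
  have e2 : ∑ i ∈ Finset.range n, ρ ^ ((j - (j + 1 + i)) + (j + 1 + i - j)) ≤
      ∑ i ∈ Finset.range n, ρ ^ i := by
    refine Finset.sum_le_sum fun i _ => pow_le_pow_of_le_one h0 h1.le (by omega)
  rw [e1]
  have := hgeo (j + 1)
  have := hgeo n
  rw [show 2 / (1 - ρ) = 1 / (1 - ρ) + 1 / (1 - ρ) by ring]
  linarith

/-- The response of the discretised Ornstein–Uhlenbeck process to its `j`-th increment. -/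
def responseVector (n : ℕ) (δ ρ : ℝ) (j : ℕ) : EuclideanSpace ℝ (Fin n) :=
  WithLp.toLp 2 fun k => if j ≤ (k : ℕ) then √δ * ρ ^ ((k : ℕ) + 1 - j) else 0

theorem norm_sq_responseVector_eq_sum {n : ℕ} {δ ρ : ℝ} (hδ : 0 ≤ δ) (j : ℕ) :
    ‖responseVector n δ ρ j‖ ^ 2 =
      ∑ k : Fin n, if j ≤ (k : ℕ) then δ * (ρ ^ 2) ^ ((k : ℕ) + 1 - j) else 0 := by
  rw [EuclideanSpace.real_norm_sq_eq]
  refine Finset.sum_congr rfl fun k _ => ?_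
  simp only [responseVector]
  split_ifs
  · rw [mul_pow, Real.sq_sqrt hδ, ← pow_mul, ← pow_mul, mul_comm 2]
  · simp

/-- On the coordinates `k ≥ l` that support the later vector, the earlier one is its multiple by `ρ
^ (l - j)`: the Markov property of the scheme. -/
theorem inner_responseVector {n : ℕ} {δ ρ : ℝ} (hδ : 0 ≤ δ) {j l : ℕ} (hjl : j ≤ l) :
    ⟪responseVector n δ ρ j, responseVector n δ ρ l⟫ =
      ρ ^ (l - j) * ‖responseVector n δ ρ l‖ ^ 2 := by
  rw [norm_sq_responseVector_eq_sum hδ, Finset.mul_sum, PiLp.inner_apply]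
  refine Finset.sum_congr rfl fun k _ => ?_
  simp only [responseVector, RCLike.inner_apply, conj_trivial]
  by_cases hk : l ≤ (k : ℕ)
  · rw [if_pos hk, if_pos hk, if_pos (hjl.trans hk),
      show (k : ℕ) + 1 - j = (l - j) + ((k : ℕ) + 1 - l) by omega, pow_add]
    rw [show √δ * ρ ^ ((k : ℕ) + 1 - l) * (√δ * (ρ ^ (l - j) * ρ ^ ((k : ℕ) + 1 - l))) =
      √δ * √δ * (ρ ^ (l - j) * (ρ ^ ((k : ℕ) + 1 - l) * ρ ^ ((k : ℕ) + 1 - l))) by ring,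
      Real.mul_self_sqrt hδ, ← mul_pow, ← sq]
    ring
  · simp [hk]

/-- A geometric sum of ratio `ρ²`, where `2θ + θ²δ = (ρ⁻² - 1) / δ`. The norm is thus near `1/(2θ)`
except for `l` close to `n`. -/
theorem norm_sq_responseVector {θ δ : ℝ} (hθ : 0 < θ) (hδ : 0 < δ) {n l : ℕ} (hl : l ≤ n) :
    (2 * θ + θ ^ 2 * δ) * ‖responseVector n δ (1 + θ * δ)⁻¹ l‖ ^ 2 =
      1 - ((1 + θ * δ)⁻¹ ^ 2) ^ (n - l) := by
  rw [norm_sq_responseVector_eq_sum hδ.le,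
    Fin.sum_univ_eq_sum_range
      (fun k => if l ≤ k then δ * ((1 + θ * δ)⁻¹ ^ 2) ^ (k + 1 - l) else 0) n,
    ← Finset.sum_range_add_sum_Ico _ hl, Finset.sum_eq_zero (s := Finset.range l), zero_add,
    Finset.sum_Ico_eq_sum_range]
  · have hpos : 0 < 1 + θ * δ := by positivity
    have hkey : (2 * θ + θ ^ 2 * δ) * (δ * (1 + θ * δ)⁻¹ ^ 2) = 1 - (1 + θ * δ)⁻¹ ^ 2 := by
      field_simp
      ring
    set r := (1 + θ * δ)⁻¹ ^ 2
    have hind : ∀ m : ℕ, (2 * θ + θ ^ 2 * δ) * ∑ i ∈ Finset.range m, δ * r ^ (i + 1) =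
        1 - r ^ m := by
      intro m
      induction m with
      | zero => simp
      | succ m ih =>
        rw [Finset.sum_range_succ, mul_add, ih, pow_succ r,
          show (2 * θ + θ ^ 2 * δ) * (δ * (r ^ m * r)) =
            (2 * θ + θ ^ 2 * δ) * (δ * r) * r ^ m by ring, hkey]
        ring
    rw [← hind (n - l)]
    congr 1
    refine Finset.sum_congr rfl fun i _ => ?_
    rw [if_pos (by omega), show l + i + 1 - l = i + 1 by omega]
  · intro k hk
    rw [if_neg (by have := Finset.mem_range.1 hk; omega)]

section Bounds

variable {θ δ : ℝ}

theorem inv_one_add_mul_mem (hθ : 0 < θ) (hδ : 0 < δ) :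
    0 < (1 + θ * δ)⁻¹ ∧ (1 + θ * δ)⁻¹ < 1 :=
  ⟨by positivity, inv_lt_one_of_one_lt₀ (by have := mul_pos hθ hδ; linarith)⟩

theorem norm_sq_responseVector_le (hθ : 0 < θ) (hδ : 0 < δ) {n l : ℕ} (hl : l ≤ n) :
    ‖responseVector n δ (1 + θ * δ)⁻¹ l‖ ^ 2 ≤ 1 / (2 * θ) := by
  have h := norm_sq_responseVector hθ hδ hl
  have hr : 0 ≤ ((1 + θ * δ)⁻¹ ^ 2) ^ (n - l) := by positivity
  have h1 : 0 ≤ θ ^ 2 * δ * ‖responseVector n δ (1 + θ * δ)⁻¹ l‖ ^ 2 := by positivity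
  rw [le_div_iff₀ (by positivity)]
  linarith

theorem norm_sq_responseVector_anti (hθ : 0 < θ) (hδ : 0 < δ) {n j l : ℕ} (hjl : j ≤ l)
    (hl : l ≤ n) : ‖responseVector n δ (1 + θ * δ)⁻¹ l‖ ^ 2 ≤
      ‖responseVector n δ (1 + θ * δ)⁻¹ j‖ ^ 2 := by
  obtain ⟨h0, h1⟩ := inv_one_add_mul_mem hθ hδ
  have hc : 0 < 2 * θ + θ ^ 2 * δ := by positivity
  refine le_of_mul_le_mul_left ?_ hc
  rw [norm_sq_responseVector hθ hδ hl, norm_sq_responseVector hθ hδ (hjl.trans hl)]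
  gcongr 1 - ?_
  exact pow_le_pow_of_le_one (by positivity) (pow_le_one₀ h0.le h1.le) (by omega)

/-- Since `1 - ρ` is of order `δ`, each row sums to order `1 / δ` and the double sum is of order `n
δ` instead of `(n δ)²`. -/
theorem sum_sum_pow_dist_le (hθ : 0 < θ) (hδ : 0 < δ) (hδ1 : δ ≤ 1) (n : ℕ) :
    ∑ j ∈ Finset.range n, ∑ l ∈ Finset.range n, δ ^ 2 * (1 + θ * δ)⁻¹ ^ ((j - l) + (l - j)) ≤
      n * δ * (2 * (1 + θ) / θ) := by
  obtain ⟨h0, h1⟩ := inv_one_add_mul_mem hθ hδ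
  have hval : δ * (2 / (1 - (1 + θ * δ)⁻¹)) = 2 * (1 + θ * δ) / θ := by
    have : 0 < 1 + θ * δ := by positivity
    have h3 : 1 - (1 + θ * δ)⁻¹ = θ * δ / (1 + θ * δ) := by field_simp; ring
    rw [h3]
    field_simp
  calc ∑ j ∈ Finset.range n, ∑ l ∈ Finset.range n, δ ^ 2 * (1 + θ * δ)⁻¹ ^ ((j - l) + (l - j))
      ≤ ∑ j ∈ Finset.range n, δ ^ 2 * (2 / (1 - (1 + θ * δ)⁻¹)) := by
        refine Finset.sum_le_sum fun j _ => ?_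
        rw [← Finset.mul_sum]
        exact mul_le_mul_of_nonneg_left (sum_pow_dist_le h0.le h1 n j) (by positivity)
    _ = n * δ * (2 * (1 + θ * δ) / θ) := by
        rw [Finset.sum_const, Finset.card_range, nsmul_eq_mul, ← hval]
        ring
    _ ≤ n * δ * (2 * (1 + θ) / θ) := by
        gcongr
        exact mul_le_of_le_one_right hθ.le hδ1

theorem exp_covariance_responseVector_le (hθ : 0 < θ) (hδ : 0 < δ) {n j l : ℕ} (hj : j ≤ n)
    (hl : l ≤ n) (s : ℝ) :
    Real.exp (-(s ^ 2 * ‖responseVector n δ (1 + θ * δ)⁻¹ j -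
        responseVector n δ (1 + θ * δ)⁻¹ l‖ ^ 2 / 2)) -
      Real.exp (-(s ^ 2 * ‖responseVector n δ (1 + θ * δ)⁻¹ j‖ ^ 2 / 2)) *
        Real.exp (-(s ^ 2 * ‖responseVector n δ (1 + θ * δ)⁻¹ l‖ ^ 2 / 2)) ≤
      (1 + θ * δ)⁻¹ ^ ((j - l) + (l - j)) * min 1 (s ^ 2 * (1 / (2 * θ))) := by
  obtain ⟨h0, h1⟩ := inv_one_add_mul_mem hθ hδ
  wlog hjl : j ≤ l generalizing j l
  · have h := this hl hj (le_of_not_ge hjl)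
    rw [norm_sub_rev, mul_comm (Real.exp _), add_comm (j - l)]
    exact h
  have hsq : ‖responseVector n δ (1 + θ * δ)⁻¹ j - responseVector n δ (1 + θ * δ)⁻¹ l‖ ^ 2 =
      ‖responseVector n δ (1 + θ * δ)⁻¹ j‖ ^ 2 + ‖responseVector n δ (1 + θ * δ)⁻¹ l‖ ^ 2 -
        2 * ((1 + θ * δ)⁻¹ ^ (l - j) * ‖responseVector n δ (1 + θ * δ)⁻¹ l‖ ^ 2) := by
    rw [@norm_sub_sq_real, inner_responseVector hδ.le hjl]
    ring
  rw [hsq, Nat.sub_eq_zero_of_le hjl, zero_add]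
  exact exp_covariance_le (by positivity) (pow_le_one₀ h0.le h1.le) (sq_nonneg s) (sq_nonneg _)
    (norm_sq_responseVector_anti hθ hδ hjl hl) (norm_sq_responseVector_le hθ hδ hl)

/-- Concentration of the Gaussian characters along the discretised Ornstein–Uhlenbeck process. -/
theorem integral_norm_sum_exp_responseVector_le (hθ : 0 < θ) (hδ : 0 < δ) (hδ1 : δ ≤ 1) (n : ℕ)
    (s : ℝ) :
    ∫ ξ, ‖∑ j ∈ Finset.range n, (δ : ℂ) *
        (Complex.exp (Complex.I * (s * ⟪responseVector n δ (1 + θ * δ)⁻¹ j, ξ⟫ : ℝ)) -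
        (Real.exp (-(s ^ 2 * ‖responseVector n δ (1 + θ * δ)⁻¹ j‖ ^ 2 / 2)) : ℝ))‖
        ∂(stdGaussian (EuclideanSpace ℝ (Fin n))) ≤
      √(n * δ * (2 * (1 + θ) / θ)) * min 1 (√(1 / (2 * θ)) * |s|) := by
  have hL : MemLp (fun ξ => ‖∑ j ∈ Finset.range n, (δ : ℂ) *
        (Complex.exp (Complex.I * (s * ⟪responseVector n δ (1 + θ * δ)⁻¹ j, ξ⟫ : ℝ)) -
        (Real.exp (-(s ^ 2 * ‖responseVector n δ (1 + θ * δ)⁻¹ j‖ ^ 2 / 2)) : ℝ))‖) 2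
        (stdGaussian (EuclideanSpace ℝ (Fin n))) := by
    refine MemLp.of_bound (Continuous.aestronglyMeasurable (by fun_prop))
      (∑ j ∈ Finset.range n, δ * 2) (ae_of_all _ fun ξ => ?_)
    rw [norm_norm]
    refine norm_sum_le_of_le _ fun j _ => ?_
    rw [norm_mul, Complex.norm_of_nonneg hδ.le]
    gcongr
    refine (norm_sub_le _ _).trans ?_
    rw [norm_cexp_I_mul_ofReal, Complex.norm_of_nonneg (Real.exp_pos _).le]
    have : Real.exp (-(s ^ 2 * ‖responseVector n δ (1 + θ * δ)⁻¹ j‖ ^ 2 / 2)) ≤ 1 :=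
      Real.exp_le_one_iff.2 (neg_nonpos.2 (by positivity))
    linarith
  -- The first moment is bounded through the second, a sum of covariances of order `n δ`; this
  -- yields the square root.
  have h := integral_abs_le_sqrt hL
  simp only [abs_norm] at h
  refine h.trans ?_
  rw [integral_norm_sq_sum_exp_sub]
  have hmin : 0 ≤ min 1 (√(1 / (2 * θ)) * |s|) := le_min zero_le_one (by positivity)
  have hminsq : min 1 (s ^ 2 * (1 / (2 * θ))) = min 1 (√(1 / (2 * θ)) * |s|) ^ 2 := by
    have hsq : (√(1 / (2 * θ)) * |s|) ^ 2 = s ^ 2 * (1 / (2 * θ)) := by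
      rw [mul_pow, Real.sq_sqrt (by positivity), sq_abs, mul_comm]
    rw [← hsq]
    rcases le_total 1 (√(1 / (2 * θ)) * |s|) with h1 | h1
    · rw [min_eq_left h1, min_eq_left (one_le_pow₀ h1), one_pow]
    · rw [min_eq_right h1, min_eq_right (pow_le_one₀ (by positivity) h1)]
  rw [← Real.sqrt_sq hmin, ← Real.sqrt_mul (by positivity), ← hminsq]
  refine Real.sqrt_le_sqrt ?_
  calc _ ≤ ∑ j ∈ Finset.range n, ∑ l ∈ Finset.range n,
        δ ^ 2 * (1 + θ * δ)⁻¹ ^ ((j - l) + (l - j)) * min 1 (s ^ 2 * (1 / (2 * θ))) := by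
        refine Finset.sum_le_sum fun j hj => Finset.sum_le_sum fun l hl => ?_
        rw [mul_assoc]
        exact mul_le_mul_of_nonneg_left (exp_covariance_responseVector_le hθ hδ
          (Finset.mem_range.1 hj).le (Finset.mem_range.1 hl).le s) (sq_nonneg _)
    _ ≤ _ := by
        simp_rw [← Finset.sum_mul]
        exact mul_le_mul_of_nonneg_right (sum_sum_pow_dist_le hθ hδ hδ1 n)
          (le_min zero_le_one (by positivity))

/-- Controls the drift. Cancellation in the sum gives order `√T`, which is essential: `φ_T √T → 0`,
whereas `φ_T T` does not tend to zero when `α > 1`. -/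
theorem integral_abs_sum_inner_responseVector_le (hθ : 0 < θ) (hδ : 0 < δ) (hδ1 : δ ≤ 1) (n : ℕ) :
    ∫ ξ, |∑ j ∈ Finset.range n, δ * ⟪responseVector n δ (1 + θ * δ)⁻¹ j, ξ⟫|
        ∂(stdGaussian (EuclideanSpace ℝ (Fin n))) ≤
      √(n * δ * (2 * (1 + θ) / θ) * (1 / (2 * θ))) := by
  set w := responseVector n δ (1 + θ * δ)⁻¹ with hw
  have hsum : ∀ ξ, ∑ j ∈ Finset.range n, δ * ⟪w j, ξ⟫ = ⟪∑ j ∈ Finset.range n, δ • w j, ξ⟫ := by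
    intro ξ
    rw [sum_inner]
    exact Finset.sum_congr rfl fun j _ => by rw [real_inner_smul_left]
  simp_rw [hsum]
  refine (integral_abs_le_sqrt (memLp_inner_stdGaussian _)).trans (Real.sqrt_le_sqrt ?_)
  rw [integral_inner_sq_stdGaussian, ← real_inner_self_eq_norm_sq, sum_inner]
  simp_rw [inner_sum, real_inner_smul_left, real_inner_smul_right, ← mul_assoc, ← sq]
  obtain ⟨h0, h1⟩ := inv_one_add_mul_mem hθ hδ
  have hinner : ∀ j ∈ Finset.range n, ∀ l ∈ Finset.range n, ⟪w j, w l⟫ ≤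
      (1 + θ * δ)⁻¹ ^ ((j - l) + (l - j)) * (1 / (2 * θ)) := by
    intro j hj l hl
    rcases le_total j l with hjl | hjl
    · rw [hw, inner_responseVector hδ.le hjl, Nat.sub_eq_zero_of_le hjl, zero_add]
      exact mul_le_mul_of_nonneg_left
        (norm_sq_responseVector_le hθ hδ (Finset.mem_range.1 hl).le) (by positivity)
    · rw [hw, real_inner_comm, inner_responseVector hδ.le hjl, Nat.sub_eq_zero_of_le hjl, add_zero]
      exact mul_le_mul_of_nonneg_left
        (norm_sq_responseVector_le hθ hδ (Finset.mem_range.1 hj).le) (by positivity)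
  calc _ ≤ ∑ j ∈ Finset.range n, ∑ l ∈ Finset.range n,
        δ ^ 2 * (1 + θ * δ)⁻¹ ^ ((j - l) + (l - j)) * (1 / (2 * θ)) := by
        refine Finset.sum_le_sum fun j hj => Finset.sum_le_sum fun l hl => ?_
        rw [mul_assoc]
        exact mul_le_mul_of_nonneg_left (hinner j hj l hl) (sq_nonneg _)
    _ ≤ _ := by
        simp_rw [← Finset.sum_mul]
        exact mul_le_mul_of_nonneg_right (sum_sum_pow_dist_le hθ hδ hδ1 n) (by positivity)

/-- The variances along the discretised process are, on average, close to the stationary one. -/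
theorem le_sum_norm_sq_responseVector (hθ : 0 < θ) (hδ : 0 < δ) (n : ℕ) :
    n * δ * (1 - θ * δ / 2) - 1 / θ ≤
      ∑ j ∈ Finset.range n, δ * (2 * θ * ‖responseVector n δ (1 + θ * δ)⁻¹ j‖ ^ 2) := by
  obtain ⟨h0, h1⟩ := inv_one_add_mul_mem hθ hδ
  set ρ := (1 + θ * δ)⁻¹ with hρ
  -- The loss `θδ/2` comes from the excess of `2θ + θ²δ` over `2θ`. The power of `ρ` is the boundary
  -- effect near the terminal time, of total weight at most `1 / θ`.
  have hterm : ∀ j ∈ Finset.range n, δ * ((1 - θ * δ / 2) - ρ ^ (n - 1 - j) * ρ) ≤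
      δ * (2 * θ * ‖responseVector n δ ρ j‖ ^ 2) := by
    intro j hj
    have hjn := Finset.mem_range.1 hj
    have h := norm_sq_responseVector hθ hδ hjn.le
    rw [← hρ] at h
    set v := ‖responseVector n δ ρ j‖ ^ 2
    have hv : v ≤ 1 / (2 * θ) := norm_sq_responseVector_le hθ hδ hjn.le
    have hp : (ρ ^ 2) ^ (n - j) ≤ ρ ^ (n - 1 - j) * ρ := by
      rw [← pow_succ, ← pow_mul]
      exact pow_le_pow_of_le_one h0.le h1.le (by omega)
    have h3 : θ ^ 2 * δ * v ≤ θ * δ / 2 := by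
      calc θ ^ 2 * δ * v ≤ θ ^ 2 * δ * (1 / (2 * θ)) := by gcongr
        _ = θ * δ / 2 := by field_simp
    gcongr
    linarith
  refine le_trans ?_ (Finset.sum_le_sum hterm)
  rw [← Finset.mul_sum, Finset.sum_sub_distrib, Finset.sum_const, Finset.card_range, nsmul_eq_mul,
    ← Finset.sum_mul, Finset.sum_range_reflect (fun i => ρ ^ i) n]
  have hgeo : (∑ i ∈ Finset.range n, ρ ^ i) * ρ ≤ 1 / (θ * δ) := by
    have h := geom_sum_mul_neg ρ n
    have h3 : 1 - ρ = θ * δ * ρ := by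
      have : 0 < 1 + θ * δ := by positivity
      rw [hρ]
      field_simp
      ring
    rw [h3] at h
    rw [le_div_iff₀ (by positivity)]
    have : 0 ≤ ρ ^ n := by positivity
    linarith
  have h5 : δ * ((∑ i ∈ Finset.range n, ρ ^ i) * ρ) ≤ 1 / θ := by
    calc δ * ((∑ i ∈ Finset.range n, ρ ^ i) * ρ) ≤ δ * (1 / (θ * δ)) := by gcongr
      _ = 1 / θ := by field_simp
  linarith

end Bounds

end Gaussian

/-! ### Drift, quadratic part and large jumps of the exponent -/

section LevyExponent

variable {σ b : ℝ} {ν : Measure ℝ}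

theorem norm_cexp_sub_one_sub_le (y : ℝ) :
    ‖Complex.exp (Complex.I * (y : ℝ)) - 1 - Complex.I * (y : ℝ)‖ ≤ 2 * y ^ 2 := by
  have hn : ‖Complex.I * (y : ℂ)‖ = |y| := by simp
  rcases le_total |y| 1 with h | h
  · have h1 := Complex.norm_exp_sub_one_sub_id_le (x := Complex.I * (y : ℂ)) (by rwa [hn])
    rw [hn, sq_abs] at h1
    linarith [sq_nonneg y]
  · refine (norm_sub_le _ _).trans ?_
    have h1 : ‖Complex.exp (Complex.I * (y : ℂ)) - 1‖ ≤ ‖y‖ :=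
      Real.norm_exp_I_mul_ofReal_sub_one_le
    rw [Real.norm_eq_abs] at h1
    rw [hn]
    have h2 : |y| ≤ y ^ 2 := by
      rw [← sq_abs, sq]
      exact le_mul_of_one_le_left (abs_nonneg y) h
    linarith

theorem norm_cexp_sub_one_le_two (y : ℝ) : ‖Complex.exp (Complex.I * (y : ℝ)) - 1‖ ≤ 2 := by
  refine (norm_sub_le _ _).trans ?_
  rw [norm_cexp_I_mul_ofReal, norm_one]
  norm_num

/-- Apart from the drift and the large jumps, the Lévy–Khintchine exponent is quadratic. -/
theorem norm_levyExponent_sub_le (hν : IsLevyMeasure ν) (u : ℝ) :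
    ‖levyExponent σ b ν u - Complex.I * (u * b : ℝ) -
        ∫ z in {z | 1 < |z|}, (Complex.exp (Complex.I * (u * z : ℝ)) - 1) ∂ν‖ ≤
      u ^ 2 * (σ ^ 2 / 2 + 2 * ∫ z, min (z ^ 2) 1 ∂ν) := by
  set f : ℝ → ℂ := fun z => Complex.exp (Complex.I * (u * z : ℝ)) - 1 -
      Complex.I * (if |z| ≤ 1 then ((u * z : ℝ) : ℂ) else 0) with hf
  have hS := measurableSet_lt_abs 1
  have hsmall : ∀ z : ℝ, z ∈ {z : ℝ | 1 < |z|}ᶜ → ‖f z‖ ≤ 2 * u ^ 2 * min (z ^ 2) 1 := by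
    intro z hz
    have hz1 : |z| ≤ 1 := not_lt.1 hz
    have hz2 : z ^ 2 ≤ 1 := by
      rw [← sq_abs]
      exact pow_le_one₀ (abs_nonneg z) hz1
    have h := norm_cexp_sub_one_sub_le (u * z)
    rw [hf, min_eq_left hz2]
    simp only [if_pos hz1]
    calc _ ≤ 2 * (u * z) ^ 2 := h
      _ = _ := by ring
  have hlarge : ∀ z : ℝ, z ∈ {z : ℝ | 1 < |z|} →
      f z = Complex.exp (Complex.I * (u * z : ℝ)) - 1 := by
    intro z hz
    have hz1 : ¬ |z| ≤ 1 := not_le.2 hz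
    rw [hf]
    simp only [if_neg hz1, mul_zero, sub_zero]
  have hmeas : Measurable f := by
    refine Measurable.sub (by fun_prop) (Measurable.const_mul ?_ _)
    exact Measurable.ite (measurableSet_le measurable_norm measurable_const) (by fun_prop)
      measurable_const
  have hInt : Integrable f ν := by
    refine Integrable.mono' (hν.integrable_min_sq.const_mul (2 * u ^ 2 + 2))
      hmeas.aestronglyMeasurable (ae_of_all _ fun z => ?_)
    by_cases hz : z ∈ {z : ℝ | 1 < |z|}
    · have hz2 : 1 ≤ z ^ 2 := by
        rw [← sq_abs]
        exact one_le_pow₀ (le_of_lt hz)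
      rw [hlarge z hz, min_eq_right hz2, mul_one]
      exact (norm_cexp_sub_one_le_two _).trans (by linarith [sq_nonneg u])
    · refine (hsmall z hz).trans ?_
      have : 0 ≤ min (z ^ 2) 1 := le_min (sq_nonneg z) zero_le_one
      gcongr
      linarith
  have hsplit : ∫ z, f z ∂ν = (∫ z in {z | 1 < |z|}, (Complex.exp (Complex.I * (u * z : ℝ)) - 1) ∂ν) +
      ∫ z in {z | 1 < |z|}ᶜ, f z ∂ν := by
    rw [← integral_add_compl hS hInt, setIntegral_congr_fun hS hlarge]
  have hsm : ‖∫ z in {z | 1 < |z|}ᶜ, f z ∂ν‖ ≤ 2 * u ^ 2 * ∫ z, min (z ^ 2) 1 ∂ν := by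
    rw [← integral_const_mul]
    refine (norm_integral_le_integral_norm _).trans ?_
    refine (setIntegral_mono_on hInt.norm.integrableOn
      (hν.integrable_min_sq.const_mul _).integrableOn hS.compl hsmall).trans ?_
    exact setIntegral_le_integral (hν.integrable_min_sq.const_mul _)
      (ae_of_all _ fun z => mul_nonneg (by positivity) (le_min (sq_nonneg z) zero_le_one))
  have heq : levyExponent σ b ν u - Complex.I * (u * b : ℝ) -
      ∫ z in {z | 1 < |z|}, (Complex.exp (Complex.I * (u * z : ℝ)) - 1) ∂ν =
      -((σ ^ 2 * u ^ 2 / 2 : ℝ) : ℂ) + ∫ z in {z | 1 < |z|}ᶜ, f z ∂ν := by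
    rw [levyExponent, hsplit]
    ring
  rw [heq]
  refine (norm_add_le _ _).trans ?_
  rw [norm_neg, Complex.norm_of_nonneg (by positivity)]
  linarith

end LevyExponent

/-! ### Characteristic functions of the Euler scheme -/

section EulerCharFun

open scoped RealInnerProductSpace

theorem eulerScheme_eq_sum (ρ y₀ : ℝ) (d : ℕ → ℝ) (m : ℕ) :
    eulerScheme ρ y₀ d m = ρ ^ m * y₀ + ∑ j ∈ Finset.range m, ρ ^ (m - j) * d j := by
  induction m with
  | zero => simp [eulerScheme]
  | succ m ih =>
    rw [eulerScheme, ih, Finset.sum_range_succ, mul_add, mul_add, Finset.mul_sum,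
      Nat.add_sub_cancel_left, pow_one, pow_succ, ← add_assoc]
    congr 2
    · ring
    · refine Finset.sum_congr rfl fun j hj => ?_
      have := Finset.mem_range.1 hj
      rw [show m + 1 - j = (m - j) + 1 by omega, pow_succ]
      ring

/-- The scheme is linear in its data, and the factor `√δ` turns the Riemann sum of squares into a
Euclidean norm. Coordinate `k` stores step `k + 1`, matching the exponent `k + 1 - j` of the
response. -/
theorem toLp_eulerScheme (n : ℕ) (δ ρ y₀ : ℝ) (d : ℕ → ℝ) :
    (WithLp.toLp 2 fun k : Fin n => √δ * eulerScheme ρ y₀ d (k + 1)) =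
      y₀ • responseVector n δ ρ 0 + ∑ j ∈ Finset.range n, d j • responseVector n δ ρ j := by
  ext k
  have hk : (k : ℕ) + 1 ≤ n := k.2
  simp only [eulerScheme_eq_sum, responseVector, PiLp.add_apply, PiLp.smul_apply, smul_eq_mul,
    WithLp.ofLp_sum, Finset.sum_apply, Nat.zero_le, if_true, Nat.sub_zero, WithLp.ofLp_smul,
    Pi.smul_apply]
  rw [mul_add, ← Finset.sum_range_add_sum_Ico _ hk, Finset.sum_eq_zero (s := Finset.Ico _ _),
    add_zero, Finset.mul_sum]
  · congr 1
    · ring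
    · refine Finset.sum_congr rfl fun j hj => ?_
      rw [if_pos (by have := Finset.mem_range.1 hj; omega)]
      ring
  · intro j hj
    rw [if_neg (by have := Finset.mem_Ico.1 hj; omega), mul_zero]

theorem mul_sum_sq_eulerScheme (n : ℕ) {δ : ℝ} (hδ : 0 ≤ δ) (ρ y₀ : ℝ) (d : ℕ → ℝ) :
    δ * ∑ k ∈ Finset.range n, eulerScheme ρ y₀ d (k + 1) ^ 2 =
      ‖y₀ • responseVector n δ ρ 0 + ∑ j ∈ Finset.range n, d j • responseVector n δ ρ j‖ ^ 2 := by
  rw [← toLp_eulerScheme, EuclideanSpace.real_norm_sq_eq]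
  simp_rw [mul_pow, Real.sq_sqrt hδ]
  rw [← Finset.mul_sum, Fin.sum_univ_eq_sum_range (fun k => eulerScheme ρ y₀ d (k + 1) ^ 2) n]

variable {Ω : Type*} {mΩ : MeasurableSpace Ω} {P : Measure Ω}
  {F : Filtration ℝ≥0 mΩ} {σ b : ℝ} {ν : Measure ℝ} {Z : ℝ≥0 → Ω → ℝ}

/-- The increments of a process along the grid of mesh `δ`. -/
def gridIncrement (Z : ℝ≥0 → Ω → ℝ) (δ : ℝ) (j : ℕ) (ω : Ω) : ℝ :=
  Z (((j + 1 : ℕ) : ℝ) * δ).toNNReal ω - Z ((j : ℝ) * δ).toNNReal ω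

theorem IsLevyProcess.measurable_gridIncrement (hZ : IsLevyProcess F P σ b ν Z) (δ : ℝ) (j : ℕ) :
    Measurable (gridIncrement Z δ j) :=
  ((hZ.adapted _).mono (F.le _) le_rfl).sub ((hZ.adapted _).mono (F.le _) le_rfl)

theorem IsLevyProcess.norm_exp_levyExponent_le_one [IsProbabilityMeasure P]
    (hZ : IsLevyProcess F P σ b ν Z) {δ : ℝ}
    (hδ : 0 ≤ δ) (u : ℝ) : ‖Complex.exp (δ * levyExponent σ b ν u)‖ ≤ 1 := by
  have h := hZ.charFun_incr 0 δ.toNNReal zero_le u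
  rw [NNReal.coe_zero, sub_zero, Real.coe_toNNReal _ hδ] at h
  rw [← h]
  have : IsProbabilityMeasure (P.map fun ω => Z δ.toNNReal ω - Z 0 ω) :=
    Measure.isProbabilityMeasure_map
      (((hZ.adapted _).mono (F.le _) le_rfl).sub
        ((hZ.adapted _).mono (F.le _) le_rfl)).aemeasurable
  exact norm_charFun_le_one _

theorem IsLevyProcess.charFun_gridIncrement (hZ : IsLevyProcess F P σ b ν Z) {δ : ℝ} (hδ : 0 ≤ δ)
    (j : ℕ) (u : ℝ) : charFun (P.map (gridIncrement Z δ j)) u =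
      Complex.exp (δ * levyExponent σ b ν u) := by
  have h := hZ.charFun_incr ((j : ℝ) * δ).toNNReal (((j + 1 : ℕ) : ℝ) * δ).toNNReal
    (Real.toNNReal_le_toNNReal (by push_cast; linarith)) u
  rw [Real.coe_toNNReal _ (by positivity), Real.coe_toNNReal _ (by positivity),
    show ((j + 1 : ℕ) : ℝ) * δ - j * δ = δ by push_cast; ring] at h
  exact h

theorem charFun_map_const_mul {Y : Ω → ℝ} (hY : Measurable Y) (c u : ℝ) :
    charFun (P.map fun ω => c * Y ω) u = charFun (P.map Y) (c * u) := by
  have h := charFun_map_smul (μ := P.map Y) c u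
  rw [Measure.map_map (by fun_prop) hY] at h
  exact h

/-- The joint characteristic function of the initial value and the increments along a grid. -/
theorem IsLevyProcess.charFun_initial_add_sum [IsProbabilityMeasure P]
    (hZ : IsLevyProcess F P σ b ν Z) {δ : ℝ}
    (hδ : 0 ≤ δ) {X₀ : Ω → ℝ} (hX₀ : Measurable[F 0] X₀) (x : ℝ) (c : ℕ → ℝ) (m : ℕ) :
    charFun (P.map fun ω => x * X₀ ω + ∑ j ∈ Finset.range m, c j * gridIncrement Z δ j ω) 1 =
      charFun (P.map X₀) x *
        Complex.exp (∑ j ∈ Finset.range m, δ * levyExponent σ b ν (c j)) := by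
  have hX₀' : Measurable X₀ := hX₀.mono (F.le 0) le_rfl
  induction m with
  | zero =>
    simp only [Finset.range_zero, Finset.sum_empty, add_zero, Complex.exp_zero, mul_one]
    rw [charFun_map_const_mul hX₀', mul_one]
  | succ m ih =>
    set A : Ω → ℝ := fun ω => x * X₀ ω + ∑ j ∈ Finset.range m, c j * gridIncrement Z δ j ω with hA
    have hmono : ∀ {j k : ℕ}, j ≤ k → ((j : ℝ) * δ).toNNReal ≤ ((k : ℝ) * δ).toNNReal := fun h =>
      Real.toNNReal_le_toNNReal (by gcongr)
    have hAm : Measurable[F ((m : ℝ) * δ).toNNReal] A := by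
      refine Measurable.add ((hX₀.mono (F.mono zero_le) le_rfl).const_mul x) ?_
      refine Finset.measurable_sum _ fun j hj => Measurable.const_mul (Measurable.sub ?_ ?_) _
      · exact (hZ.adapted _).mono (F.mono (hmono (Finset.mem_range.1 hj))) le_rfl
      · exact (hZ.adapted _).mono (F.mono (hmono (Finset.mem_range.1 hj).le)) le_rfl
    -- The initial value and the first `m` increments are known at time `m δ`, and the next
    -- increment is independent of that past.
    have hind : IndepFun A (gridIncrement Z δ m) P := by
      have h := hZ.indep _ _ (hmono (Nat.le_succ m))
      exact (indep_of_indep_of_le_right h hAm.comap_le).symm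
    have hAm' : Measurable A := hAm.mono (F.le _) le_rfl
    have hD := hZ.measurable_gridIncrement δ m
    have hind' : IndepFun A (fun ω => c m * gridIncrement Z δ m ω) P :=
      hind.comp measurable_id (measurable_const_mul (c m))
    have hsum : (fun ω => x * X₀ ω + ∑ j ∈ Finset.range (m + 1), c j * gridIncrement Z δ j ω) =
        fun ω => A ω + c m * gridIncrement Z δ m ω := by
      funext ω
      rw [Finset.sum_range_succ, ← add_assoc]
    rw [hsum, hind'.charFun_map_fun_add_eq_mul hAm'.aemeasurable (hD.const_mul _).aemeasurable,
      Pi.mul_apply, ih, charFun_map_const_mul hD, mul_one, hZ.charFun_gridIncrement hδ,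
      Finset.sum_range_succ, Complex.exp_add, mul_assoc]

/-- Gaussian randomisation of the Laplace transform of the quadratic functional. -/
theorem IsLevyProcess.integral_exp_neg_sum_sq [IsProbabilityMeasure P]
    (hZ : IsLevyProcess F P σ b ν Z) {δ : ℝ}
    (hδ : 0 ≤ δ) {X₀ : Ω → ℝ} (hX₀ : Measurable[F 0] X₀) (ρ a : ℝ) (n : ℕ) :
    ((∫ ω, Real.exp (-(a ^ 2 * (δ * ∑ k ∈ Finset.range n,
        eulerScheme ρ (X₀ ω) (fun j => gridIncrement Z δ j ω) (k + 1) ^ 2) / 2)) ∂P : ℝ) : ℂ) =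
      ∫ ξ, charFun (P.map X₀) (a * ⟪responseVector n δ ρ 0, ξ⟫) *
        Complex.exp (∑ j ∈ Finset.range n,
          δ * levyExponent σ b ν (a * ⟪responseVector n δ ρ j, ξ⟫))
        ∂(stdGaussian (EuclideanSpace ℝ (Fin n))) := by
  have hX₀' : Measurable X₀ := hX₀.mono (F.le 0) le_rfl
  have hD := hZ.measurable_gridIncrement δ
  set w := responseVector n δ ρ
  set A : Ω → EuclideanSpace ℝ (Fin n) → ℝ := fun ω ξ => (a * ⟪w 0, ξ⟫) * X₀ ω +
    ∑ j ∈ Finset.range n, (a * ⟪w j, ξ⟫) * gridIncrement Z δ j ω with hA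
  have hAeq : ∀ ω ξ, A ω ξ =
      a * ⟪X₀ ω • w 0 + ∑ j ∈ Finset.range n, gridIncrement Z δ j ω • w j, ξ⟫ := by
    intro ω ξ
    rw [inner_add_left, sum_inner, real_inner_smul_left, mul_add, Finset.mul_sum, hA]
    simp only
    congr 1
    · ring
    · refine Finset.sum_congr rfl fun j _ => ?_
      rw [real_inner_smul_left]
      ring
  -- The phase `A` is read in two ways. Integrated over `ξ` it gives the Gaussian characteristic
  -- function, hence the quadratic functional; integrated over `ω` it gives the product of the
  -- characteristic functions of the data. Fubini equates the two.
  have hξ : ∀ ω, ∫ ξ, Complex.exp (Complex.I * (A ω ξ : ℝ))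
      ∂(stdGaussian (EuclideanSpace ℝ (Fin n))) =
      (Real.exp (-(a ^ 2 * (δ * ∑ k ∈ Finset.range n,
        eulerScheme ρ (X₀ ω) (fun j => gridIncrement Z δ j ω) (k + 1) ^ 2) / 2)) : ℝ) := by
    intro ω
    simp_rw [hAeq]
    rw [integral_exp_inner_stdGaussian, mul_sum_sq_eulerScheme n hδ]
  have hω : ∀ ξ, ∫ ω, Complex.exp (Complex.I * (A ω ξ : ℝ)) ∂P =
      charFun (P.map X₀) (a * ⟪w 0, ξ⟫) *
        Complex.exp (∑ j ∈ Finset.range n, δ * levyExponent σ b ν (a * ⟪w j, ξ⟫)) := by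
    intro ξ
    rw [← hZ.charFun_initial_add_sum hδ hX₀, charFun_apply_real, integral_map
      (Measurable.aemeasurable (by fun_prop)) (by fun_prop)]
    simp only [Complex.ofReal_one, one_mul, hA]
    simp_rw [mul_comm Complex.I]
  have hAmeas : Measurable (Function.uncurry A) := by
    simp only [hA]
    fun_prop
  rw [← integral_complex_ofReal]
  simp_rw [← hξ, ← hω]
  refine integral_integral_swap ?_
  refine Integrable.of_bound ?_ 1 (ae_of_all _ fun p => (norm_cexp_I_mul_ofReal _).le)
  exact (Complex.measurable_exp.comp
    ((Complex.measurable_ofReal.comp hAmeas).const_mul Complex.I)).aestronglyMeasurable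

end EulerCharFun

/-! ### Error bound for the Laplace transform at fixed mesh -/

section LaplaceBound

open scoped RealInnerProductSpace

/-- Mean value inequality: the derivative of `exp` has norm at most `1` on the convex left
half-plane. -/
theorem norm_cexp_sub_cexp_le {x y : ℂ} (hx : x.re ≤ 0) (hy : y.re ≤ 0) :
    ‖Complex.exp x - Complex.exp y‖ ≤ ‖x - y‖ := by
  have h := Convex.norm_image_sub_le_of_norm_deriv_le (𝕜 := ℂ) (f := Complex.exp)
    (s := {z : ℂ | z.re ≤ 0}) (C := 1) (x := y) (y := x)
    (fun z _ => Complex.differentiableAt_exp)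
    (fun z hz => by
      rw [Complex.deriv_exp, Complex.norm_exp]
      exact Real.exp_le_one_iff.2 hz)
    (convex_halfSpace_re_le 0) hy hx
  rwa [one_mul] at h

theorem mul_one_sub_exp_le {t x : ℝ} (ht0 : 0 ≤ t) (ht1 : t ≤ 1) :
    t * (1 - Real.exp (-x)) ≤ 1 - Real.exp (-(t * x)) := by
  have h := exp_mul_sub_one_le (t := -x) ht0 ht1
  rw [mul_neg] at h
  linarith

variable {σ b θ δ a : ℝ} {ν : Measure ℝ}

/-- Frozen-`ξ` decomposition into drift, quadratic remainder and large jumps. The free functions `m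
j` are inserted to split the jump part into a fluctuation and a mean; later `m j z` is the Gaussian
mean of `exp(i a z g_j)`. -/
theorem norm_sum_levyExponent_add_le (hν : IsLevyMeasure ν) (hδ : 0 ≤ δ) (ha : 0 ≤ a) (n : ℕ)
    (g : ℕ → ℝ) {m : ℕ → ℝ → ℝ} (hm : ∀ j, Measurable (m j)) (hm1 : ∀ j z, |m j z| ≤ 1) (K : ℝ) :
    ‖(∑ j ∈ Finset.range n, δ * levyExponent σ b ν (a * g j)) + K‖ ≤
      a * |b| * |∑ j ∈ Finset.range n, δ * g j| +
        a ^ 2 * (σ ^ 2 / 2 + 2 * ∫ z, min (z ^ 2) 1 ∂ν) * ∑ j ∈ Finset.range n, δ * g j ^ 2 +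
        ‖∫ z in {z | 1 < |z|}, ∑ j ∈ Finset.range n,
          (δ : ℂ) * (Complex.exp (Complex.I * (a * z * g j : ℝ)) - (m j z : ℝ)) ∂ν‖ +
        |(∫ z in {z | 1 < |z|}, ∑ j ∈ Finset.range n, δ * (1 - m j z) ∂ν) - K| := by
  have hfin := hν.isFiniteMeasure_restrict one_pos
  set C := σ ^ 2 / 2 + 2 * ∫ z, min (z ^ 2) 1 ∂ν with hC
  set r : ℕ → ℂ := fun j => levyExponent σ b ν (a * g j) - Complex.I * (a * g j * b : ℝ) -
    ∫ z in {z | 1 < |z|}, (Complex.exp (Complex.I * (a * g j * z : ℝ)) - 1) ∂ν with hr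
  have hrle : ∀ j, ‖r j‖ ≤ (a * g j) ^ 2 * C := fun j => norm_levyExponent_sub_le hν _
  have he : ∀ j (z : ℝ), (a * g j * z : ℝ) = a * z * g j := fun j z => by ring
  have hint1 : ∀ j, IntegrableOn (fun z : ℝ => (δ : ℂ) *
      (Complex.exp (Complex.I * (a * z * g j : ℝ)) - (m j z : ℝ))) {z | 1 < |z|} ν := fun j => by
    refine Integrable.const_mul (Integrable.of_bound (C := 2) ?_ (ae_of_all _ fun z => ?_)) _
    · exact (Measurable.sub (by fun_prop)
        (Complex.measurable_ofReal.comp (hm j))).aestronglyMeasurable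
    · refine (norm_sub_le _ _).trans ?_
      rw [norm_cexp_I_mul_ofReal, Complex.norm_real, Real.norm_eq_abs]
      linarith [hm1 j z]
  have hint2 : ∀ j, IntegrableOn (fun z : ℝ => δ * (1 - m j z)) {z | 1 < |z|} ν := fun j => by
    refine Integrable.const_mul (Integrable.of_bound (C := 2) ?_ (ae_of_all _ fun z => ?_)) _
    · exact ((hm j).const_sub 1).aestronglyMeasurable
    · rw [Real.norm_eq_abs]
      refine (abs_sub _ _).trans ?_
      rw [abs_one]
      linarith [hm1 j z]
  have hjump : ∀ j, (δ : ℂ) * ∫ z in {z | 1 < |z|},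
      (Complex.exp (Complex.I * (a * g j * z : ℝ)) - 1) ∂ν =
      (∫ z in {z | 1 < |z|}, (δ : ℂ) *
        (Complex.exp (Complex.I * (a * z * g j : ℝ)) - (m j z : ℝ)) ∂ν) -
      ((∫ z in {z | 1 < |z|}, δ * (1 - m j z) ∂ν : ℝ) : ℂ) := by
    intro j
    have hint2c : IntegrableOn (fun z : ℝ => ((δ * (1 - m j z) : ℝ) : ℂ)) {z | 1 < |z|} ν :=
      (hint2 j).ofReal
    rw [← integral_complex_ofReal, ← integral_sub (hint1 j) hint2c, ← integral_const_mul]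
    refine integral_congr_ae (ae_of_all _ fun z => ?_)
    simp only [he]
    push_cast
    ring
  have hdecomp : (∑ j ∈ Finset.range n, δ * levyExponent σ b ν (a * g j)) + K =
      Complex.I * (a * b * ∑ j ∈ Finset.range n, δ * g j : ℝ) +
      ∑ j ∈ Finset.range n, δ * r j +
      (∫ z in {z | 1 < |z|}, ∑ j ∈ Finset.range n,
          (δ : ℂ) * (Complex.exp (Complex.I * (a * z * g j : ℝ)) - (m j z : ℝ)) ∂ν) -
      (((∫ z in {z | 1 < |z|}, ∑ j ∈ Finset.range n, δ * (1 - m j z) ∂ν) - K : ℝ) : ℂ) := by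
    have h1 : ∀ j, (δ : ℂ) * levyExponent σ b ν (a * g j) =
        Complex.I * (a * b * (δ * g j) : ℝ) + δ * r j +
        ((∫ z in {z | 1 < |z|}, (δ : ℂ) *
          (Complex.exp (Complex.I * (a * z * g j : ℝ)) - (m j z : ℝ)) ∂ν) -
        ((∫ z in {z | 1 < |z|}, δ * (1 - m j z) ∂ν : ℝ) : ℂ)) := by
      intro j
      rw [← hjump j, hr]
      push_cast
      ring
    rw [Finset.sum_congr rfl fun j _ => h1 j, Finset.sum_add_distrib, Finset.sum_add_distrib,
      Finset.sum_sub_distrib, integral_finsetSum _ fun j _ => hint1 j,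
      integral_finsetSum _ fun j _ => hint2 j, ← Finset.mul_sum, ← Complex.ofReal_sum,
      ← Finset.mul_sum, ← Complex.ofReal_sum, Complex.ofReal_sub]
    ring
  rw [hdecomp]
  refine (norm_sub_le _ _).trans (add_le_add ((norm_add_le _ _).trans
    (add_le_add ((norm_add_le _ _).trans (add_le_add ?_ ?_)) le_rfl)) ?_)
  · rw [norm_mul, Complex.norm_I, one_mul, Complex.norm_real, Real.norm_eq_abs, abs_mul, abs_mul,
      abs_of_nonneg ha]
  · refine (norm_sum_le _ _).trans ?_
    rw [Finset.mul_sum]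
    refine Finset.sum_le_sum fun j _ => ?_
    rw [norm_mul, Complex.norm_of_nonneg hδ]
    calc δ * ‖r j‖ ≤ δ * ((a * g j) ^ 2 * C) := mul_le_mul_of_nonneg_left (hrle j) hδ
      _ = _ := by ring
  · rw [Complex.norm_real, Real.norm_eq_abs]

/-- With `t_j = 2θ ‖w_j‖² ∈ [0,1]` and `x = (a z)²/(4θ)`, concavity gives `t_j (1 - e^{-x}) ≤ 1 -
e^{-t_j x} ≤ 1 - e^{-x}`. The weights `δ t_j` add up to `n δ` minus at most `n δ (θδ/2) + 1/θ`. -/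
theorem abs_setIntegral_sum_one_sub_exp_sub_le (hν : IsLevyMeasure ν) (hθ : 0 < θ) (hδ : 0 < δ)
    (n : ℕ) (a K : ℝ) :
    |(∫ z in {z | 1 < |z|}, ∑ j ∈ Finset.range n, δ *
        (1 - Real.exp (-((a * z) ^ 2 * ‖responseVector n δ (1 + θ * δ)⁻¹ j‖ ^ 2 / 2))) ∂ν) - K| ≤
      |n * δ * (∫ z in {z | 1 < |z|}, (1 - Real.exp (-((a * z) ^ 2 / (4 * θ)))) ∂ν) - K| +
        (n * δ * (θ * δ / 2) + 1 / θ) *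
          ∫ z in {z | 1 < |z|}, (1 - Real.exp (-((a * z) ^ 2 / (4 * θ)))) ∂ν := by
  have hfin := hν.isFiniteMeasure_restrict one_pos
  set v : ℕ → ℝ := fun j => ‖responseVector n δ (1 + θ * δ)⁻¹ j‖ ^ 2
  set h : ℝ → ℝ := fun z => 1 - Real.exp (-((a * z) ^ 2 / (4 * θ))) with hh
  set g : ℝ → ℝ := fun z => ∑ j ∈ Finset.range n, δ * (1 - Real.exp (-((a * z) ^ 2 * v j / 2)))
    with hg
  set τ := ∑ j ∈ Finset.range n, δ * (2 * θ * v j) with hτ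
  have hexp : ∀ j z, -((a * z) ^ 2 * v j / 2) = -((2 * θ * v j) * ((a * z) ^ 2 / (4 * θ))) :=
    fun j z => by field_simp; ring
  have ht : ∀ j ∈ Finset.range n, 0 ≤ 2 * θ * v j ∧ 2 * θ * v j ≤ 1 := fun j hj => by
    have h1 := norm_sq_responseVector_le hθ hδ (Finset.mem_range.1 hj).le
    rw [le_div_iff₀ (by positivity)] at h1
    exact ⟨by positivity, by linarith⟩
  have h0 : ∀ z, 0 ≤ h z := fun z => by
    rw [hh, sub_nonneg, Real.exp_le_one_iff, neg_nonpos]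
    positivity
  have hge : ∀ z, τ * h z ≤ g z := fun z => by
    rw [hτ, hg, Finset.sum_mul]
    refine Finset.sum_le_sum fun j hj => ?_
    rw [hexp, mul_assoc]
    exact mul_le_mul_of_nonneg_left (mul_one_sub_exp_le (ht j hj).1 (ht j hj).2) hδ.le
  have hle : ∀ z, g z ≤ n * δ * h z := fun z => by
    have : ∀ j ∈ Finset.range n, δ * (1 - Real.exp (-((a * z) ^ 2 * v j / 2))) ≤ δ * h z := by
      intro j hj
      rw [hexp]
      simp only [hh]
      gcongr δ * (1 - Real.exp (-?_))
      exact mul_le_of_le_one_left (by positivity) (ht j hj).2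
    calc g z ≤ ∑ j ∈ Finset.range n, δ * h z := Finset.sum_le_sum this
      _ = _ := by rw [Finset.sum_const, Finset.card_range, nsmul_eq_mul, mul_assoc]
  have hhi : IntegrableOn h {z | 1 < |z|} ν :=
    Integrable.of_bound (by fun_prop) 1 (ae_of_all _ fun z => by
      rw [Real.norm_of_nonneg (h0 z)]
      exact sub_le_self _ (Real.exp_pos _).le)
  have hgi : IntegrableOn g {z | 1 < |z|} ν := by
    refine Integrable.mono' (hhi.const_mul (n * δ)) (by fun_prop) (ae_of_all _ fun z => ?_)
    rw [Real.norm_of_nonneg]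
    · exact hle z
    · refine le_trans (mul_nonneg ?_ (h0 z)) (hge z)
      exact Finset.sum_nonneg fun j hj => mul_nonneg hδ.le (ht j hj).1
  set M := ∫ z in {z | 1 < |z|}, h z ∂ν with hM
  have hM0 : 0 ≤ M := integral_nonneg h0
  have i1 : τ * M ≤ ∫ z in {z | 1 < |z|}, g z ∂ν := by
    rw [hM, ← integral_const_mul]
    exact integral_mono (hhi.const_mul _) hgi hge
  have i2 : ∫ z in {z | 1 < |z|}, g z ∂ν ≤ n * δ * M := by
    rw [hM, ← integral_const_mul]
    exact integral_mono hgi (hhi.const_mul _) hle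
  have i3 := mul_le_mul_of_nonneg_right (le_sum_norm_sq_responseVector hθ hδ n) hM0
  have i4 : |(∫ z in {z | 1 < |z|}, g z ∂ν) - n * δ * M| ≤
      (n * δ * (θ * δ / 2) + 1 / θ) * M := by
    rw [abs_sub_comm, abs_of_nonneg (by linarith)]
    linarith
  calc |(∫ z in {z | 1 < |z|}, g z ∂ν) - K|
      = |(n * δ * M - K) + ((∫ z in {z | 1 < |z|}, g z ∂ν) - n * δ * M)| := by ring_nf
    _ ≤ |n * δ * M - K| + |(∫ z in {z | 1 < |z|}, g z ∂ν) - n * δ * M| := abs_add_le _ _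
    _ ≤ _ := by linarith

/-- Fubini moves the Gaussian mean inside the integral over jumps, where the concentration bound
applies for each fixed `z` with `s = a z`. -/
theorem integrable_norm_setIntegral_sum_exp (hν : IsLevyMeasure ν) (hθ : 0 < θ) (hδ : 0 < δ)
    (hδ1 : δ ≤ 1) (ha : 0 ≤ a) (n : ℕ) :
    Integrable (fun ξ => ‖∫ z in {z | 1 < |z|}, ∑ j ∈ Finset.range n, (δ : ℂ) *
      (Complex.exp (Complex.I * (a * z * ⟪responseVector n δ (1 + θ * δ)⁻¹ j, ξ⟫ : ℝ)) -
      (Real.exp (-((a * z) ^ 2 * ‖responseVector n δ (1 + θ * δ)⁻¹ j‖ ^ 2 / 2)) : ℝ)) ∂ν‖)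
      (stdGaussian (EuclideanSpace ℝ (Fin n))) ∧
    ∫ ξ, ‖∫ z in {z | 1 < |z|}, ∑ j ∈ Finset.range n, (δ : ℂ) *
      (Complex.exp (Complex.I * (a * z * ⟪responseVector n δ (1 + θ * δ)⁻¹ j, ξ⟫ : ℝ)) -
      (Real.exp (-((a * z) ^ 2 * ‖responseVector n δ (1 + θ * δ)⁻¹ j‖ ^ 2 / 2)) : ℝ)) ∂ν‖
      ∂(stdGaussian (EuclideanSpace ℝ (Fin n))) ≤
    √(n * δ * (2 * (1 + θ) / θ)) *
      ∫ z in {z | 1 < |z|}, min 1 (√(1 / (2 * θ)) * a * |z|) ∂ν := by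
  have hfin := hν.isFiniteMeasure_restrict one_pos
  set γ := stdGaussian (EuclideanSpace ℝ (Fin n))
  set μ := ν.restrict {z : ℝ | 1 < |z|} with hμ
  set w := responseVector n δ (1 + θ * δ)⁻¹
  set A : EuclideanSpace ℝ (Fin n) → ℝ → ℂ := fun ξ z => ∑ j ∈ Finset.range n, (δ : ℂ) *
      (Complex.exp (Complex.I * (a * z * ⟪w j, ξ⟫ : ℝ)) -
      (Real.exp (-((a * z) ^ 2 * ‖w j‖ ^ 2 / 2)) : ℝ)) with hA
  have hAc : Continuous (Function.uncurry A) := by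
    rw [hA]
    unfold Function.uncurry
    fun_prop
  have hAi : Integrable (Function.uncurry A) (γ.prod μ) := by
    refine Integrable.of_bound hAc.aestronglyMeasurable (∑ j ∈ Finset.range n, δ * 2)
      (ae_of_all _ fun p => ?_)
    refine norm_sum_le_of_le _ fun j _ => ?_
    rw [norm_mul, Complex.norm_of_nonneg hδ.le]
    gcongr
    refine (norm_sub_le _ _).trans ?_
    rw [norm_cexp_I_mul_ofReal, Complex.norm_of_nonneg (Real.exp_pos _).le]
    have : Real.exp (-((a * p.2) ^ 2 * ‖w j‖ ^ 2 / 2)) ≤ 1 :=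
      Real.exp_le_one_iff.2 (neg_nonpos.2 (by positivity))
    linarith
  refine ⟨hAi.integral_prod_left.norm, ?_⟩
  calc ∫ ξ, ‖∫ z, A ξ z ∂μ‖ ∂γ ≤ ∫ ξ, ∫ z, ‖A ξ z‖ ∂μ ∂γ :=
        integral_mono hAi.integral_prod_left.norm hAi.norm.integral_prod_left
          fun ξ => norm_integral_le_integral_norm _
    _ = ∫ z, ∫ ξ, ‖A ξ z‖ ∂γ ∂μ := integral_integral_swap hAi.norm
    _ ≤ ∫ z, √(n * δ * (2 * (1 + θ) / θ)) * min 1 (√(1 / (2 * θ)) * a * |z|) ∂μ := by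
        refine integral_mono hAi.norm.integral_prod_right
          ((integrableOn_min_one_mul_abs hν _ (by positivity) one_pos).const_mul _) fun z => ?_
        have h := integral_norm_sum_exp_responseVector_le hθ hδ hδ1 n (a * z)
        rw [abs_mul, abs_of_nonneg ha, ← mul_assoc] at h
        exact h
    _ = _ := integral_const_mul _ _

variable {Ω : Type*} {mΩ : MeasurableSpace Ω} {P : Measure Ω} [IsProbabilityMeasure P]
  {F : Filtration ℝ≥0 mΩ} {Z : ℝ≥0 → Ω → ℝ}

/-- The Laplace transform of the quadratic functional of the Euler scheme is close to `exp (-K)`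
as soon as the rescaled large jumps have nearly the Laplace exponent `K`. -/
theorem IsLevyProcess.abs_integral_exp_neg_sum_sq_sub_le (hZ : IsLevyProcess F P σ b ν Z)
    (hν : IsLevyMeasure ν) (hθ : 0 < θ) (hδ : 0 < δ) (hδ1 : δ ≤ 1) (ha : 0 ≤ a)
    {X₀ : Ω → ℝ} (hX₀ : Measurable[F 0] X₀) {ε C K : ℝ} (hK : 0 ≤ K) (hC : 0 ≤ C)
    (hχ : ∀ u, ‖charFun (P.map X₀) u - 1‖ ≤ ε + C * u ^ 2) (n : ℕ) :
    |(∫ ω, Real.exp (-(a ^ 2 * (δ * ∑ k ∈ Finset.range n,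
        eulerScheme (1 + θ * δ)⁻¹ (X₀ ω) (fun j => gridIncrement Z δ j ω) (k + 1) ^ 2) / 2)) ∂P) -
        Real.exp (-K)| ≤
      (ε + C * a ^ 2 * (1 / (2 * θ))) +
      (a * |b| * √(n * δ * (2 * (1 + θ) / θ) * (1 / (2 * θ))) +
        a ^ 2 * (σ ^ 2 / 2 + 2 * ∫ z, min (z ^ 2) 1 ∂ν) * (n * δ * (1 / (2 * θ))) +
        √(n * δ * (2 * (1 + θ) / θ)) *
          (∫ z in {z | 1 < |z|}, min 1 (√(1 / (2 * θ)) * a * |z|) ∂ν) +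
        (|n * δ * (∫ z in {z | 1 < |z|}, (1 - Real.exp (-((a * z) ^ 2 / (4 * θ)))) ∂ν) - K| +
          (n * δ * (θ * δ / 2) + 1 / θ) *
            ∫ z in {z | 1 < |z|}, (1 - Real.exp (-((a * z) ^ 2 / (4 * θ)))) ∂ν)) := by
  have hX₀' : Measurable X₀ := hX₀.mono (F.le 0) le_rfl
  have hprob : IsProbabilityMeasure (P.map X₀) :=
    Measure.isProbabilityMeasure_map hX₀'.aemeasurable
  rw [← Real.norm_eq_abs, ← Complex.norm_real, Complex.ofReal_sub,
    hZ.integral_exp_neg_sum_sq hδ.le hX₀]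
  set γ := stdGaussian (EuclideanSpace ℝ (Fin n))
  set w := responseVector n δ (1 + θ * δ)⁻¹ with hw
  set G : ℕ → EuclideanSpace ℝ (Fin n) → ℝ := fun j ξ => ⟪w j, ξ⟫ with hG
  set D : EuclideanSpace ℝ (Fin n) → ℂ := fun ξ =>
    ∑ j ∈ Finset.range n, δ * levyExponent σ b ν (a * G j ξ) with hD
  set s := σ ^ 2 / 2 + 2 * ∫ z, min (z ^ 2) 1 ∂ν with hs
  set m : ℕ → ℝ → ℝ := fun j z => Real.exp (-((a * z) ^ 2 * ‖w j‖ ^ 2 / 2)) with hm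
  set J : EuclideanSpace ℝ (Fin n) → ℝ := fun ξ => ‖∫ z in {z | 1 < |z|}, ∑ j ∈ Finset.range n,
    (δ : ℂ) * (Complex.exp (Complex.I * (a * z * G j ξ : ℝ)) - (m j z : ℝ)) ∂ν‖ with hJ
  set κ := |(∫ z in {z | 1 < |z|}, ∑ j ∈ Finset.range n, δ * (1 - m j z) ∂ν) - K| with hκ
  have hs0 : 0 ≤ s := by
    have : 0 ≤ ∫ z, min (z ^ 2) 1 ∂ν :=
      integral_nonneg fun z => le_min (sq_nonneg z) zero_le_one
    positivity
  -- `exp (D ξ)` is a product of characteristic functions of increments, hence of norm at most `1`.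
  have hDre : ∀ ξ, (D ξ).re ≤ 0 := by
    intro ξ
    have h1 : ‖Complex.exp (D ξ)‖ ≤ 1 := by
      rw [hD, Complex.exp_sum, norm_prod]
      exact Finset.prod_le_one (fun j _ => norm_nonneg _)
        fun j _ => hZ.norm_exp_levyExponent_le_one hδ.le _
    rwa [Complex.norm_exp, Real.exp_le_one_iff] at h1
  have hpt : ∀ ξ, ‖charFun (P.map X₀) (a * G 0 ξ) * Complex.exp (D ξ) - Complex.exp (-K : ℝ)‖ ≤
      (ε + C * a ^ 2 * G 0 ξ ^ 2) + (a * |b| * |∑ j ∈ Finset.range n, δ * G j ξ| +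
        a ^ 2 * s * ∑ j ∈ Finset.range n, δ * G j ξ ^ 2 + J ξ + κ) := by
    intro ξ
    -- The initial value is split off first; the rest compares two exponentials in the left
    -- half-plane, so only `D ξ + K` matters.
    have e : charFun (P.map X₀) (a * G 0 ξ) * Complex.exp (D ξ) - Complex.exp (-K : ℝ) =
        (charFun (P.map X₀) (a * G 0 ξ) - 1) * Complex.exp (D ξ) +
          (Complex.exp (D ξ) - Complex.exp (-K : ℝ)) := by ring
    rw [e]
    refine (norm_add_le _ _).trans (add_le_add ?_ ?_)
    · rw [norm_mul, Complex.norm_exp]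
      refine (mul_le_of_le_one_right (norm_nonneg _)
        (Real.exp_le_one_iff.2 (hDre ξ))).trans ?_
      refine (hχ _).trans (le_of_eq ?_)
      ring
    · refine (norm_cexp_sub_cexp_le (hDre ξ) (by simpa using hK)).trans ?_
      rw [Complex.ofReal_neg, sub_neg_eq_add]
      exact norm_sum_levyExponent_add_le hν hδ.le ha n (fun j => G j ξ) (m := m)
        (fun j => by fun_prop)
        (fun j z => by
          rw [hm, abs_of_pos (Real.exp_pos _), Real.exp_le_one_iff, neg_nonpos]
          positivity) K
  have hGsq : ∀ j, Integrable (fun ξ => G j ξ ^ 2) γ := fun j => integrable_inner_sq_stdGaussian _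
  have hGi : ∀ j, Integrable (G j) γ := fun j =>
    (memLp_inner_stdGaussian (w j)).integrable one_le_two
  obtain ⟨hJi, hJle⟩ := integrable_norm_setIntegral_sum_exp hν hθ hδ hδ1 ha n
  have t1 : Integrable (fun ξ => ε + C * a ^ 2 * G 0 ξ ^ 2) γ :=
    (integrable_const _).add ((hGsq 0).const_mul _)
  have t2 : Integrable (fun ξ => a * |b| * |∑ j ∈ Finset.range n, δ * G j ξ|) γ :=
    (integrable_finsetSum _ fun j _ => (hGi j).const_mul δ).abs.const_mul _
  have t3 : Integrable (fun ξ => a ^ 2 * s * ∑ j ∈ Finset.range n, δ * G j ξ ^ 2) γ :=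
    (integrable_finsetSum _ fun j _ => (hGsq j).const_mul δ).const_mul _
  have t23 : Integrable (fun ξ => a * |b| * |∑ j ∈ Finset.range n, δ * G j ξ| +
      a ^ 2 * s * ∑ j ∈ Finset.range n, δ * G j ξ ^ 2) γ := t2.add t3
  have t234 : Integrable (fun ξ => a * |b| * |∑ j ∈ Finset.range n, δ * G j ξ| +
      a ^ 2 * s * ∑ j ∈ Finset.range n, δ * G j ξ ^ 2 + J ξ) γ := t23.add hJi
  have t2345 : Integrable (fun ξ => a * |b| * |∑ j ∈ Finset.range n, δ * G j ξ| +
      a ^ 2 * s * ∑ j ∈ Finset.range n, δ * G j ξ ^ 2 + J ξ + κ) γ :=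
    t234.add (integrable_const _)
  have hconst : (Real.exp (-K) : ℂ) = ∫ _, Complex.exp (-K : ℝ) ∂γ := by simp
  have hmain : ‖(∫ ξ, charFun (P.map X₀) (a * G 0 ξ) * Complex.exp (D ξ) ∂γ) -
      (Real.exp (-K) : ℂ)‖ ≤ ∫ ξ, ((ε + C * a ^ 2 * G 0 ξ ^ 2) +
        (a * |b| * |∑ j ∈ Finset.range n, δ * G j ξ| +
        a ^ 2 * s * ∑ j ∈ Finset.range n, δ * G j ξ ^ 2 + J ξ + κ)) ∂γ := by
    -- Rewriting through characteristic functions of increments gives measurability in `ξ` without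
    -- studying the exponent itself.
    have hprod : ∀ ξ, Complex.exp (D ξ) = ∏ j ∈ Finset.range n,
        charFun (P.map (gridIncrement Z δ j)) (a * G j ξ) := fun ξ => by
      rw [hD, Complex.exp_sum]
      exact Finset.prod_congr rfl fun j _ => (hZ.charFun_gridIncrement hδ.le j _).symm
    have hmeas : AEStronglyMeasurable
        (fun ξ => charFun (P.map X₀) (a * G 0 ξ) * Complex.exp (D ξ)) γ := by
      simp_rw [hprod]
      refine Measurable.aestronglyMeasurable (Measurable.mul ?_ ?_)
      · exact measurable_charFun.comp (by fun_prop)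
      · exact Finset.measurable_prod _ fun j _ => by
          have : IsProbabilityMeasure (P.map (gridIncrement Z δ j)) :=
            Measure.isProbabilityMeasure_map (hZ.measurable_gridIncrement δ j).aemeasurable
          exact measurable_charFun.comp (by fun_prop)
    have hi : Integrable (fun ξ => charFun (P.map X₀) (a * G 0 ξ) * Complex.exp (D ξ)) γ := by
      refine Integrable.of_bound hmeas 1 (ae_of_all _ fun ξ => ?_)
      rw [norm_mul, Complex.norm_exp]
      exact mul_le_one₀ (norm_charFun_le_one _) (Real.exp_pos _).le
        (Real.exp_le_one_iff.2 (hDre ξ))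
    rw [hconst, ← integral_sub hi (integrable_const _)]
    exact norm_integral_le_of_norm_le (t1.add t2345) (ae_of_all _ hpt)
  refine hmain.trans ?_
  rw [integral_add t1 t2345, integral_add t234 (integrable_const _), integral_add t23 hJi,
    integral_add t2 t3, integral_add (integrable_const _) ((hGsq 0).const_mul _),
    integral_const_mul, integral_const_mul, integral_const_mul]
  simp only [integral_const, probReal_univ, smul_eq_mul, one_mul]
  have b1 : ∫ ξ, G 0 ξ ^ 2 ∂γ ≤ 1 / (2 * θ) := by
    rw [hG, integral_inner_sq_stdGaussian]
    exact norm_sq_responseVector_le hθ hδ (Nat.zero_le n)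
  have b2 : ∫ ξ, |∑ j ∈ Finset.range n, δ * G j ξ| ∂γ ≤
      √(n * δ * (2 * (1 + θ) / θ) * (1 / (2 * θ))) :=
    integral_abs_sum_inner_responseVector_le hθ hδ hδ1 n
  have b3 : ∫ ξ, ∑ j ∈ Finset.range n, δ * G j ξ ^ 2 ∂γ ≤ n * δ * (1 / (2 * θ)) := by
    rw [integral_finsetSum _ fun j _ => (hGsq j).const_mul δ]
    calc ∑ j ∈ Finset.range n, ∫ ξ, δ * G j ξ ^ 2 ∂γ
        ≤ ∑ j ∈ Finset.range n, δ * (1 / (2 * θ)) := by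
          refine Finset.sum_le_sum fun j hj => ?_
          rw [integral_const_mul, hG, integral_inner_sq_stdGaussian]
          exact mul_le_mul_of_nonneg_left
            (norm_sq_responseVector_le hθ hδ (Finset.mem_range.1 hj).le) hδ.le
      _ = _ := by rw [Finset.sum_const, Finset.card_range, nsmul_eq_mul, mul_assoc]
  have b4 : κ ≤ _ := abs_setIntegral_sum_one_sub_exp_sub_le hν hθ hδ n a K
  gcongr

end LaplaceBound

/-! ### Passage to the limit in the mesh and in time -/

section LaplaceLimit

/-- Allows an initial law without moments: continuity at zero handles small `u`, and elsewhere the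
trivial bound `2` is at most `2 u² / η²`. A quadratic bound integrates easily against the Gaussian.
-/
theorem exists_norm_charFun_sub_one_le (μ : Measure ℝ) [IsProbabilityMeasure μ] {ε : ℝ}
    (hε : 0 < ε) : ∃ C, 0 ≤ C ∧ ∀ u, ‖charFun μ u - 1‖ ≤ ε + C * u ^ 2 := by
  have hc : Continuous (charFun μ) := by fun_prop
  obtain ⟨η, hη, h⟩ := Metric.continuous_iff.1 hc 0 ε hε
  refine ⟨2 / η ^ 2, by positivity, fun u => ?_⟩
  rcases lt_or_ge |u| η with hu | hu
  · have h1 := h u (by simpa using hu)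
    rw [charFun_zero, probReal_univ, Complex.ofReal_one, dist_eq_norm] at h1
    have : 0 ≤ 2 / η ^ 2 * u ^ 2 := by positivity
    linarith
  · have h1 : ‖charFun μ u - 1‖ ≤ 2 := by
      rw [norm_sub_rev]
      exact norm_one_sub_charFun_le_two
    have h2 : 2 ≤ 2 / η ^ 2 * u ^ 2 := by
      rw [div_mul_eq_mul_div, le_div_iff₀ (by positivity), ← sq_abs u]
      gcongr
    linarith

variable {Ω : Type*} {mΩ : MeasurableSpace Ω} {P : Measure Ω}
  {F : Filtration ℝ≥0 mΩ} {σ b θ α : ℝ} {ν : Measure ℝ} {Z : ℝ≥0 → Ω → ℝ} {X : Ω → PathSpace}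

theorem IsCadlag.measurable_toNNReal {f : ℝ≥0 → ℝ} (hf : IsCadlag f) :
    Measurable fun s : ℝ => f s.toNNReal :=
  measurable_of_continuousWithinAt_Ici hf.continuousWithinAt_toNNReal fun s hs => by
    simp only [Real.toNNReal_of_nonpos hs, Real.toNNReal_zero]

theorem IsCadlag.exists_abs_toNNReal_le {f : ℝ≥0 → ℝ} (hf : IsCadlag f) (T : ℝ) :
    ∃ B, ∀ s ≤ T, |f s.toNNReal| ≤ B :=
  (hf.exists_abs_le T.toNNReal).imp fun _ hB _ hs => hB _ (Real.toNNReal_le_toNNReal hs)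

theorem IsCadlag.intervalIntegrable_toNNReal {f : ℝ≥0 → ℝ} (hf : IsCadlag f) (s t : ℝ) :
    IntervalIntegrable (fun r : ℝ => f r.toNNReal) volume s t := by
  obtain ⟨B, hB⟩ := hf.exists_abs_toNNReal_le (max s t)
  refine (intervalIntegrable_const (c := B)).mono_fun' hf.measurable_toNNReal.aestronglyMeasurable ?_
  filter_upwards [ae_restrict_mem measurableSet_uIoc] with r hr
  exact hB r hr.2

/-- The quadratic functional of a path is a limit of Riemann sums. -/
theorem IsCadlag.tendsto_sum_sq {f : ℝ≥0 → ℝ} (hf : IsCadlag f) {T : ℝ} (hT : 0 < T) :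
    Tendsto (fun n : ℕ => T / n * ∑ k ∈ Finset.range n, f (((k + 1 : ℕ) : ℝ) * (T / n)).toNNReal ^ 2)
      atTop (𝓝 (∫ s in (0 : ℝ)..T, f s.toNNReal ^ 2)) := by
  obtain ⟨B, hB⟩ := hf.exists_abs_toNNReal_le T
  exact tendsto_sum_sq_of_abs_sub_le (x := fun s => f s.toNNReal)
    (y := fun n k => f ((k : ℝ) * (T / n)).toNNReal) (η := fun _ => 0) hT
    hf.continuousWithinAt_toNNReal (fun s hs => hB s hs.2) tendsto_const_nhds (by simp)

theorem IsOUSolution.ae_tendsto_sum_sq_eulerScheme (hX : IsOUSolution F P θ Z X) (hθ : 0 < θ)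
    {T : ℝ} (hT : 0 < T) :
    ∀ᵐ ω ∂P, Tendsto (fun n : ℕ => T / n * ∑ k ∈ Finset.range n,
      eulerScheme (1 + θ * (T / n))⁻¹ ((X ω).1 0)
        (fun j => gridIncrement Z (T / n) j ω) (k + 1) ^ 2) atTop
      (𝓝 (∫ s in (0 : ℝ)..T, (X ω).1 s.toNNReal ^ 2)) := by
  filter_upwards [hX.eqn] with ω hω
  have hc := (X ω).2
  obtain ⟨B, hB⟩ := hc.exists_abs_toNNReal_le T
  have h := tendsto_sum_sq_eulerScheme (x := fun s => (X ω).1 s.toNNReal)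
    (z := fun s => Z s.toNNReal ω) hθ hT hc.measurable_toNNReal hc.continuousWithinAt_toNNReal
    hc.intervalIntegrable_toNNReal (fun s hs => hB s hs.2) fun t ht => by
      have h1 := hω t.toNNReal
      rw [Real.coe_toNNReal t ht] at h1
      simpa using h1
  simpa [gridIncrement] using h

theorem measurable_eulerScheme {ρ : ℝ} {y₀ : Ω → ℝ} {d : ℕ → Ω → ℝ} (hy : Measurable y₀)
    (hd : ∀ j, Measurable (d j)) (k : ℕ) :
    Measurable fun ω => eulerScheme ρ (y₀ ω) (fun j => d j ω) k := by
  induction k with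
  | zero => exact hy
  | succ k ih => exact (ih.add (hd k)).const_mul ρ

theorem IsOUSolution.measurable_initial (hX : IsOUSolution F P θ Z X) :
    Measurable fun ω => (X ω).1 0 := (hX.adapted 0).mono (F.le 0) le_rfl

variable [IsProbabilityMeasure P]

theorem IsOUSolution.tendsto_integral_exp_eulerScheme (hX : IsOUSolution F P θ Z X)
    (hZ : IsLevyProcess F P σ b ν Z) (hθ : 0 < θ) {T : ℝ} (hT : 0 < T) (c : ℝ) :
    Tendsto (fun n : ℕ => ∫ ω, Real.exp (-(c ^ 2 * (T / n * ∑ k ∈ Finset.range n,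
      eulerScheme (1 + θ * (T / n))⁻¹ ((X ω).1 0)
        (fun j => gridIncrement Z (T / n) j ω) (k + 1) ^ 2) / 2)) ∂P) atTop
      (𝓝 (∫ ω, Real.exp (-(c ^ 2 * (∫ s in (0 : ℝ)..T, (X ω).1 s.toNNReal ^ 2) / 2)) ∂P)) := by
  refine tendsto_integral_filter_of_dominated_convergence (fun _ => 1) ?_ ?_
    (integrable_const _) ?_
  · refine Eventually.of_forall fun n => Measurable.aestronglyMeasurable ?_
    have hm : ∀ k, Measurable fun ω => eulerScheme (1 + θ * (T / n))⁻¹ ((X ω).1 0)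
        (fun j => gridIncrement Z (T / n) j ω) k :=
      measurable_eulerScheme hX.measurable_initial fun j => hZ.measurable_gridIncrement _ j
    fun_prop
  · refine Eventually.of_forall fun n => ae_of_all _ fun ω => ?_
    rw [Real.norm_of_nonneg (Real.exp_pos _).le, Real.exp_le_one_iff, neg_nonpos]
    have : 0 ≤ ∑ k ∈ Finset.range n, eulerScheme (1 + θ * (T / n))⁻¹ ((X ω).1 0)
        (fun j => gridIncrement Z (T / n) j ω) (k + 1) ^ 2 :=
      Finset.sum_nonneg fun k _ => sq_nonneg _
    positivity
  · filter_upwards [hX.ae_tendsto_sum_sq_eulerScheme hθ hT] with ω hω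
    exact (Real.continuous_exp.tendsto _).comp ((hω.const_mul _).div_const 2).neg

/-- The Laplace transform of the rescaled quadratic functional converges to the stable one. -/
theorem IsOUSolution.tendsto_integral_exp (hX : IsOUSolution F P θ Z X)
    (hZ : IsLevyProcess F P σ b ν Z) (hν : IsLevyMeasure ν) (hα : α ∈ Set.Ioo (0 : ℝ) 2)
    (hH : RegularlyVarying (tail ν) (-α)) (hθ : 0 < θ) {l : ℝ} (hl : 0 < l) :
    Tendsto (fun T : ℝ => ∫ ω, Real.exp (-(l * (scaling α ν T ^ 2 *
        ∫ s in (0 : ℝ)..T, (X ω).1 s.toNNReal ^ 2))) ∂P) atTop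
      (𝓝 (Real.exp (-(Real.Gamma (1 - α / 2) * (l / (2 * θ)) ^ (α / 2))))) := by
  set K := Real.Gamma (1 - α / 2) * (l / (2 * θ)) ^ (α / 2) with hKdef
  have hK : 0 ≤ K := mul_nonneg (Real.Gamma_pos_of_pos (by linarith [hα.2])).le (by positivity)
  have hX₀ : Measurable[F 0] fun ω => (X ω).1 0 := hX.adapted 0
  have hprob : IsProbabilityMeasure (P.map fun ω => (X ω).1 0) :=
    Measure.isProbabilityMeasure_map hX.measurable_initial.aemeasurable
  set φ := scaling α ν with hφ
  -- With `a = q φ_T`, `a² Q / 2` equals `l φ_T² Q` and `a² / (4θ)` equals `(l / (2θ)) φ_T²`.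
  set q := √(2 * l) with hq
  have hq0 : 0 < q := by positivity
  have hq2 : q ^ 2 = 2 * l := Real.sq_sqrt (by positivity)
  set s := σ ^ 2 / 2 + 2 * ∫ z, min (z ^ 2) 1 ∂ν
  set c := 2 * (1 + θ) / θ
  set M : ℝ → ℝ := fun T => ∫ z in {z | 1 < |z|}, (1 - Real.exp (-(l / (2 * θ)) * (φ T * z) ^ 2)) ∂ν
    with hM
  set I : ℝ → ℝ := fun T => ∫ z in {z | 1 < |z|}, min 1 (√(1 / (2 * θ)) * q * φ T * |z|) ∂ν with hI
  have hφ0 : Tendsto φ atTop (𝓝 0) := tendsto_scaling hν hH hα.1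
  have hTφ : Tendsto (fun T => T * φ T ^ 2) atTop (𝓝 0) := tendsto_mul_scaling_sq hν hH hα
  have hTM : Tendsto (fun T => T * M T) atTop (𝓝 K) :=
    tendsto_mul_setIntegral_one_sub_exp hν hH hα (by positivity)
  have hM0 : Tendsto M atTop (𝓝 0) := by
    have h := hTM.mul tendsto_inv_atTop_zero
    rw [mul_zero] at h
    refine h.congr' ?_
    filter_upwards [eventually_gt_atTop 0] with T hT
    field_simp
  have hTI : Tendsto (fun T => √T * I T) atTop (𝓝 0) :=
    tendsto_sqrt_mul_setIntegral_min_one hν hH hα (by positivity)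
  rw [Metric.tendsto_nhds]
  intro ε hε
  obtain ⟨C, hC, hχ⟩ := exists_norm_charFun_sub_one_le (P.map fun ω => (X ω).1 0) (half_pos hε)
  -- A bound free of the mesh; every term vanishes as `T → ∞` except `ε / 2`.
  set B : ℝ → ℝ := fun T => (ε / 2 + C * (q * φ T) ^ 2 * (1 / (2 * θ))) +
    (q * |b| * (√(T * φ T ^ 2) * √(c * (1 / (2 * θ)))) +
      q ^ 2 * s * (T * φ T ^ 2 * (1 / (2 * θ))) + √c * (√T * I T) +
      (|T * M T - K| + (θ / 2 + 1 / θ) * M T)) with hB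
  have hBlim : Tendsto B atTop (𝓝 (ε / 2)) := by
    have h1 : Tendsto (fun T => ε / 2 + C * (q * φ T) ^ 2 * (1 / (2 * θ))) atTop (𝓝 (ε / 2)) := by
      simpa using ((((hφ0.const_mul q).pow 2).const_mul C).mul_const (1 / (2 * θ))).const_add (ε / 2)
    have h2 : Tendsto (fun T => q * |b| * (√(T * φ T ^ 2) * √(c * (1 / (2 * θ))))) atTop (𝓝 0) := by
      simpa using (hTφ.sqrt.mul_const (√(c * (1 / (2 * θ))))).const_mul (q * |b|)
    have h3 : Tendsto (fun T => q ^ 2 * s * (T * φ T ^ 2 * (1 / (2 * θ)))) atTop (𝓝 0) := by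
      simpa using (hTφ.mul_const (1 / (2 * θ))).const_mul (q ^ 2 * s)
    have h4 : Tendsto (fun T => √c * (√T * I T)) atTop (𝓝 0) := by
      simpa using hTI.const_mul (√c)
    have h5 : Tendsto (fun T => |T * M T - K| + (θ / 2 + 1 / θ) * M T) atTop (𝓝 0) := by
      simpa using (hTM.sub_const K).abs.add (hM0.const_mul (θ / 2 + 1 / θ))
    have h := h1.add (((h2.add h3).add h4).add h5)
    rwa [add_zero, add_zero, add_zero, add_zero] at h
  filter_upwards [hBlim.eventually_lt_const (half_lt_self hε), eventually_ge_atTop 1] with T hTB hT1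
  have hT : 0 < T := by linarith
  have hφT : 0 < φ T := (scaling_spec hν hH hα.1 hT).1
  have hMT : 0 ≤ M T := integral_nonneg fun z => by
    rw [Pi.zero_apply, sub_nonneg, Real.exp_le_one_iff, neg_mul, neg_nonpos]
    positivity
  refine lt_of_le_of_lt ?_ hTB
  rw [Real.dist_eq]
  have hlim := hX.tendsto_integral_exp_eulerScheme hZ hθ hT (q * φ T)
  have hexp : ∀ x : ℝ, (q * φ T) ^ 2 * x / 2 = l * (φ T ^ 2 * x) := fun x => by
    rw [mul_pow, hq2]
    ring
  simp only [hexp] at hlim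
  refine le_of_tendsto (hlim.sub_const _).abs ?_
  have hδlim : Tendsto (fun n : ℕ => T / n) atTop (𝓝 0) := tendsto_const_div_atTop_nhds_zero_nat T
  -- A mesh of at most `1 / T` keeps the discretisation loss `T (θδ/2)` below `θ / 2`.
  filter_upwards [eventually_gt_atTop 0, hδlim.eventually_le_const (inv_pos.2 hT)] with n hn hδT
  have hn' : (0 : ℝ) < n := Nat.cast_pos.2 hn
  have hδ : 0 < T / n := div_pos hT hn'
  have hδ1 : T / n ≤ 1 := hδT.trans (inv_le_one_of_one_le₀ hT1)
  have hmain := hZ.abs_integral_exp_neg_sum_sq_sub_le hν hθ hδ hδ1 (mul_pos hq0 hφT).le hX₀ hK hC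
    hχ n
  have hexp2 : ∀ z : ℝ, -((q * φ T * z) ^ 2 / (4 * θ)) = -(l / (2 * θ)) * (φ T * z) ^ 2 := fun z => by
    rw [mul_assoc, mul_pow, hq2]
    field_simp
    ring
  simp only [hexp, hexp2, mul_div_cancel₀ T hn'.ne', ← mul_assoc (√(1 / (2 * θ))) q] at hmain
  refine hmain.trans ?_
  have hIT : ∫ z in {z | 1 < |z|}, min 1 (√(1 / (2 * θ)) * q * φ T * |z|) ∂ν = I T := rfl
  have hMT' : ∫ z in {z | 1 < |z|}, (1 - Real.exp (-(l / (2 * θ)) * (φ T * z) ^ 2)) ∂ν = M T := rfl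
  rw [hIT, hMT']
  have e1 : q * φ T * |b| * √(T * c * (1 / (2 * θ))) =
      q * |b| * (√(T * φ T ^ 2) * √(c * (1 / (2 * θ)))) := by
    rw [Real.sqrt_mul hT.le (φ T ^ 2), Real.sqrt_sq hφT.le, mul_assoc T, Real.sqrt_mul hT.le]
    ring
  have e2 : (q * φ T) ^ 2 * s * (T * (1 / (2 * θ))) =
      q ^ 2 * s * (T * φ T ^ 2 * (1 / (2 * θ))) := by ring
  have e3 : √(T * c) * I T = √c * (√T * I T) := by
    rw [Real.sqrt_mul hT.le]
    ring
  have e4 : T * (θ * (T / n) / 2) + 1 / θ ≤ θ / 2 + 1 / θ := by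
    have : T * (T / n) ≤ 1 := by
      calc T * (T / n) ≤ T * T⁻¹ := by gcongr
        _ = 1 := mul_inv_cancel₀ hT.ne'
    nlinarith
  rw [e1, e2, e3]
  simp only [hB]
  gcongr

end LaplaceLimit

/-! ### Continuity theorem for Laplace transforms on the half-line -/

section LaplaceContinuity

open scoped BoundedContinuousFunction

/-- The bounded continuous function `x ↦ exp (-l x)` on the half-line. -/
def expNeg (l : ℝ≥0) : ℝ≥0 →ᵇ ℝ :=
  BoundedContinuousFunction.ofNormedAddCommGroup (fun x : ℝ≥0 => Real.exp (-(l * x)))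
    (by fun_prop) 1 fun x => by
      rw [Real.norm_of_nonneg (Real.exp_pos _).le, Real.exp_le_one_iff, neg_nonpos]
      positivity

theorem expNeg_apply (l x : ℝ≥0) : expNeg l x = Real.exp (-(l * x)) := rfl

theorem integrable_expNeg (μ : ProbabilityMeasure ℝ≥0) (l : ℝ≥0) :
    Integrable (expNeg l) (μ : Measure ℝ≥0) :=
  BoundedContinuousFunction.integrable _ _

/-- Markov's inequality, since `1 - exp(-l x) ≥ 1/2` for `x > 1/l`. -/
theorem measure_compl_Icc_le (μ : ProbabilityMeasure ℝ≥0) {l : ℝ≥0} (hl : 0 < l) :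
    (μ : Measure ℝ≥0).real (Set.Icc 0 l⁻¹)ᶜ ≤ 2 * (1 - ∫ x, expNeg l x ∂(μ : Measure ℝ≥0)) := by
  have hInt : Integrable (fun x => 1 - expNeg l x) (μ : Measure ℝ≥0) :=
    (integrable_const _).sub (integrable_expNeg μ l)
  have hnn : ∀ x, 0 ≤ 1 - expNeg l x := fun x => by
    rw [expNeg_apply, sub_nonneg, Real.exp_le_one_iff, neg_nonpos]
    positivity
  have hmk := mul_meas_ge_le_integral_of_nonneg (ae_of_all _ hnn) hInt (1 / 2)
  have hsub : (Set.Icc 0 l⁻¹)ᶜ ⊆ {x | 1 / 2 ≤ 1 - expNeg l x} := by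
    intro x hx
    have hx1 : l⁻¹ < x := by
      by_contra h
      exact hx ⟨zero_le, not_lt.1 h⟩
    have hlx : (1 : ℝ) ≤ l * x := by
      have h1 : (1 : ℝ≥0) ≤ l * x := by
        rw [← mul_inv_cancel₀ hl.ne']
        exact mul_le_mul_of_nonneg_left hx1.le zero_le
      exact_mod_cast h1
    have h2 : Real.exp (-(l * x)) ≤ 1 / 2 := by
      rw [Real.exp_neg, one_div]
      exact inv_anti₀ two_pos (by linarith [Real.add_one_le_exp ((l : ℝ) * x)])
    rw [Set.mem_ofPred_eq, expNeg_apply]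
    linarith
  rw [integral_sub (integrable_const _) (integrable_expNeg μ l)] at hmk
  simp only [integral_const, probReal_univ, one_smul] at hmk
  have := measureReal_mono (μ := (μ : Measure ℝ≥0)) hsub
  linarith

/-- Pointwise convergence of Laplace transforms to a limit that tends to `1` at `0` implies
tightness. -/
theorem isTightMeasureSet_of_tendsto_laplace {μ : ℕ → ProbabilityMeasure ℝ≥0} {L : ℝ≥0 → ℝ}
    (hL : Tendsto L (𝓝[>] 0) (𝓝 1))
    (h : ∀ l, 0 < l → Tendsto (fun n => ∫ x, expNeg l x ∂(μ n : Measure ℝ≥0)) atTop (𝓝 (L l))) :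
    IsTightMeasureSet {(μ n : Measure ℝ≥0) | n} := by
  rw [isTightMeasureSet_iff_exists_isCompact_measure_compl_le]
  intro ε hε
  obtain ⟨r, hr, hrε⟩ := ENNReal.lt_iff_exists_nnreal_btwn.1 hε
  have hr0 : (0 : ℝ) < r := by exact_mod_cast hr
  obtain ⟨l, hl1, hl0⟩ := ((hL.eventually_const_lt
    (show 1 - (r : ℝ) / 2 < 1 by linarith)).and self_mem_nhdsWithin).exists
  have hl0' : 0 < l := hl0
  obtain ⟨N, hN⟩ := eventually_atTop.1 ((h l hl0').eventually_const_lt hl1)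
  -- The interval `[0, 1/l]` serves all large `n`; the finitely many others are tight individually.
  have hsing : ∀ n, ∃ K : Set ℝ≥0, IsCompact K ∧ (μ n : Measure ℝ≥0) Kᶜ ≤ ε := fun n => by
    obtain ⟨K, hK, hKε⟩ := isTightMeasureSet_iff_exists_isCompact_measure_compl_le.1
      (isTightMeasureSet_singleton (μ := (μ n : Measure ℝ≥0))) ε hε
    exact ⟨K, hK, hKε _ rfl⟩
  choose K hK hKε using hsing
  refine ⟨Set.Icc 0 l⁻¹ ∪ ⋃ n ∈ Finset.range N, K n,
    isCompact_Icc.union ((Finset.range N).isCompact_biUnion fun n _ => hK n), ?_⟩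
  rintro _ ⟨n, rfl⟩
  rcases lt_or_ge n N with hn | hn
  · refine (measure_mono (Set.compl_subset_compl.2 ?_)).trans (hKε n)
    exact (Set.subset_biUnion_of_mem (u := K) (Finset.mem_coe.2 (Finset.mem_range.2 hn))).trans
      Set.subset_union_right
  · refine (measure_mono (Set.compl_subset_compl.2 Set.subset_union_left)).trans ?_
    have h1 := measure_compl_Icc_le (μ n) hl0'
    have h2 := hN n hn
    rw [← ofReal_measureReal]
    refine (ENNReal.ofReal_le_ofReal (show _ ≤ (r : ℝ) by linarith)).trans ?_
    rw [ENNReal.ofReal_coe_nnreal]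
    exact hrε.le

/-- By Prokhorov the laws converge along an ultrafilter finer than `atTop`, and `expNeg l` is a
bounded continuous test function, so the limit has the prescribed transform. -/
theorem exists_laplace_eq_of_tendsto {μ : ℕ → ProbabilityMeasure ℝ≥0} {L : ℝ≥0 → ℝ}
    (hL : Tendsto L (𝓝[>] 0) (𝓝 1))
    (h : ∀ l, 0 < l → Tendsto (fun n => ∫ x, expNeg l x ∂(μ n : Measure ℝ≥0)) atTop (𝓝 (L l))) :
    ∃ μ₀ : ProbabilityMeasure ℝ≥0, ∀ l, 0 < l → ∫ x, expNeg l x ∂(μ₀ : Measure ℝ≥0) = L l := by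
  have hcomp : IsCompact (closure {μ n | n}) :=
    isCompact_closure_of_isTightMeasureSet
      (by simpa using isTightMeasureSet_of_tendsto_laplace hL h)
  obtain ⟨μ₀, -, hμ₀⟩ := hcomp.ultrafilter_le_nhds ((hyperfilter ℕ).map μ)
    (.trans (by simp) (monotone_principal subset_closure))
  have hμ₀' : Tendsto μ (hyperfilter ℕ : Filter ℕ) (𝓝 μ₀) := hμ₀
  rw [ProbabilityMeasure.tendsto_iff_forall_integral_tendsto] at hμ₀'
  exact ⟨μ₀, fun l hl => tendsto_nhds_unique (hμ₀' (expNeg l))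
    ((h l hl).mono_left Nat.hyperfilter_le_atTop)⟩

theorem tendsto_integral_expNeg_zero (μ : ProbabilityMeasure ℝ≥0) :
    Tendsto (fun l => ∫ x, expNeg l x ∂(μ : Measure ℝ≥0)) (𝓝[>] 0) (𝓝 1) := by
  have h : Tendsto (fun l => ∫ x, expNeg l x ∂(μ : Measure ℝ≥0)) (𝓝[>] 0)
      (𝓝 (∫ _, 1 ∂(μ : Measure ℝ≥0))) := by
    refine tendsto_integral_filter_of_dominated_convergence (fun _ => 1)
      (Eventually.of_forall fun l => (integrable_expNeg μ l).aestronglyMeasurable)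
      (Eventually.of_forall fun l => ae_of_all _ fun x => ?_) (integrable_const _)
      (ae_of_all _ fun x => ?_)
    · rw [expNeg_apply, Real.norm_of_nonneg (Real.exp_pos _).le, Real.exp_le_one_iff, neg_nonpos]
      positivity
    · have hc : Continuous fun l : ℝ≥0 => Real.exp (-(l * x)) := by fun_prop
      have := (hc.tendsto 0).mono_left (nhdsWithin_le_nhds (s := Set.Ioi 0))
      simpa [expNeg_apply] using this
  simpa using h

/-- The polynomials in `x ↦ exp (-x)`. -/
def expPoly : StarSubalgebra ℝ (ℝ≥0 →ᵇ ℝ) where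
  toSubalgebra := Algebra.adjoin ℝ {expNeg 1}
  star_mem' {f} hf := by
    have : star f = f := by
      ext x
      simp
    rwa [this]

/-- A polynomial in `exp(-x)` integrates to a finite combination of Laplace transforms at natural
numbers, the constant term being total mass. -/
theorem tendsto_integral_of_mem_expPoly {μ : ℕ → ProbabilityMeasure ℝ≥0}
    {μ₀ : ProbabilityMeasure ℝ≥0}
    (h : ∀ l, 0 < l → Tendsto (fun n => ∫ x, expNeg l x ∂(μ n : Measure ℝ≥0)) atTop
      (𝓝 (∫ x, expNeg l x ∂(μ₀ : Measure ℝ≥0)))) {g : ℝ≥0 →ᵇ ℝ} (hg : g ∈ expPoly) :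
    Tendsto (fun n => ∫ x, g x ∂(μ n : Measure ℝ≥0)) atTop
      (𝓝 (∫ x, g x ∂(μ₀ : Measure ℝ≥0))) := by
  have hg' : g ∈ Algebra.adjoin ℝ {expNeg 1} := hg
  rw [Algebra.adjoin_singleton_eq_range_aeval] at hg'
  obtain ⟨p, rfl⟩ := hg'
  have hval : ∀ x, Polynomial.aeval (expNeg 1) p x =
      ∑ i ∈ Finset.range (p.natDegree + 1), p.coeff i * expNeg i x := fun x => by
    rw [Polynomial.aeval_eq_sum_range, BoundedContinuousFunction.sum_apply]
    refine Finset.sum_congr rfl fun i _ => ?_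
    rw [BoundedContinuousFunction.smul_apply, BoundedContinuousFunction.pow_apply, smul_eq_mul,
      expNeg_apply, expNeg_apply, ← Real.exp_nat_mul]
    congr 2
    push_cast
    ring
  have hInt : ∀ ρ : ProbabilityMeasure ℝ≥0,
      ∫ x, Polynomial.aeval (expNeg 1) p x ∂(ρ : Measure ℝ≥0) =
      ∑ i ∈ Finset.range (p.natDegree + 1), p.coeff i * ∫ x, expNeg i x ∂(ρ : Measure ℝ≥0) := by
    intro ρ
    simp_rw [hval]
    rw [integral_finsetSum _ fun (i : ℕ) _ =>
      (integrable_expNeg ρ (i : ℝ≥0)).const_mul _]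
    exact Finset.sum_congr rfl fun i _ => integral_const_mul _ _
  simp only [AlgHom.toRingHom_eq_coe, RingHom.coe_coe, hInt]
  refine tendsto_finsetSum _ fun i _ => Tendsto.const_mul _ ?_
  rcases Nat.eq_zero_or_pos i with rfl | hi
  · simp [expNeg_apply]
  · exact h i (by exact_mod_cast hi)

/-- **Continuity theorem** for Laplace transforms on the half-line. -/
theorem tendsto_of_tendsto_laplace {μ : ℕ → ProbabilityMeasure ℝ≥0} {μ₀ : ProbabilityMeasure ℝ≥0}
    (h : ∀ l, 0 < l → Tendsto (fun n => ∫ x, expNeg l x ∂(μ n : Measure ℝ≥0)) atTop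
      (𝓝 (∫ x, expNeg l x ∂(μ₀ : Measure ℝ≥0)))) : Tendsto μ atTop (𝓝 μ₀) := by
  refine ProbabilityMeasure.tendsto_of_tight_of_separatesPoints ℝ
    (isTightMeasureSet_of_tendsto_laplace (tendsto_integral_expNeg_zero μ₀) h) (A := expPoly) ?_
    fun g hg => tendsto_integral_of_mem_expPoly h hg
  intro x y hxy
  refine ⟨expNeg 1, ?_, ?_⟩
  · simp only [StarSubalgebra.coe_toSubalgebra, StarSubalgebra.coe_map, Set.mem_image,
      SetLike.mem_coe, exists_exists_and_eq_and]
    exact ⟨expNeg 1, Algebra.subset_adjoin rfl, rfl⟩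
  · rw [expNeg_apply, expNeg_apply]
    intro hexp
    have := Real.exp_injective hexp
    simp only [NNReal.coe_one, one_mul, neg_inj, NNReal.coe_inj] at this
    exact hxy this

end LaplaceContinuity

/-! ### The energy functional and its limit law -/

section Conclusion

/-- The rescaled quadratic functional `φ_T² ∫₀ᵀ w_s² ds` of a path. -/
def scaledEnergy (α : ℝ) (ν : Measure ℝ) (T : ℝ≥0) (w : PathSpace) : ℝ :=
  scaling α ν T ^ 2 * ∫ s in (0 : ℝ)..T, w.1 s.toNNReal ^ 2

theorem scaledEnergy_nonneg (α : ℝ) (ν : Measure ℝ) (T : ℝ≥0) (w : PathSpace) :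
    0 ≤ scaledEnergy α ν T w :=
  mul_nonneg (sq_nonneg _)
    (intervalIntegral.integral_nonneg T.coe_nonneg fun _ _ => sq_nonneg _)

theorem measurable_eval_canonicalFiltration {r T : ℝ≥0} (h : r ≤ T) :
    Measurable[canonicalFiltration T] fun w : PathSpace => w.1 r := by
  refine measurable_iff_comap_le.2 (le_iInf₂ fun s hs => ?_)
  exact le_iSup₂ (f := fun r (_ : r ≤ s) =>
    MeasurableSpace.comap (fun w : PathSpace => w.1 r) inferInstance) r (h.trans hs.le)

/-- The approximating Riemann sums evaluate the path only at times up to `T`, so the limit is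
measurable at time `T`. -/
theorem measurable_scaledEnergy (α : ℝ) (ν : Measure ℝ) (T : ℝ≥0) :
    Measurable[canonicalFiltration T] (scaledEnergy α ν T) := by
  rcases eq_zero_or_pos T with rfl | hT
  · have : scaledEnergy α ν 0 = fun _ => 0 := by
      ext w
      simp [scaledEnergy]
    rw [this]
    exact @measurable_const _ _ _ (canonicalFiltration 0) _
  refine Measurable.const_mul (m := canonicalFiltration T) ?_ _
  refine @measurable_of_tendsto_metrizable _ _ (canonicalFiltration T) _ _ _ _
    (fun n w => (T : ℝ) / n * ∑ k ∈ Finset.range n,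
      w.1 (((k + 1 : ℕ) : ℝ) * ((T : ℝ) / n)).toNNReal ^ 2) _ (fun n => ?_)
    (tendsto_pi_nhds.2 fun w => w.2.tendsto_sum_sq (NNReal.coe_pos.2 hT))
  refine Measurable.const_mul (m := canonicalFiltration T) ?_ _
  refine Finset.measurable_sum (m := canonicalFiltration T) _ fun k hk => ?_
  refine Measurable.pow_const (m := canonicalFiltration T) ?_ _
  refine measurable_eval_canonicalFiltration (Real.toNNReal_le_iff_le_coe.2 ?_)
  have hk' : ((k + 1 : ℕ) : ℝ) ≤ n := by exact_mod_cast Finset.mem_range.1 hk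
  have hn : (0 : ℝ) < n := by exact_mod_cast (Nat.zero_le k).trans_lt (Finset.mem_range.1 hk)
  rw [mul_div_left_comm]
  exact mul_le_of_le_one_right T.coe_nonneg ((div_le_one hn).2 hk')

variable {Ω : Type*} {mΩ : MeasurableSpace Ω} {P : Measure Ω} {F : Filtration ℝ≥0 mΩ}
  {σ b α θ : ℝ} {ν : Measure ℝ} {Z : ℝ≥0 → Ω → ℝ} {X : Ω → PathSpace}

theorem IsOUSolution.map_pathLawUpTo (hX : IsOUSolution F P θ Z X) {T : ℝ≥0} {f : PathSpace → ℝ}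
    (hf : Measurable[canonicalFiltration T] f) :
    @Measure.map _ _ (canonicalFiltration T) _ f (hX.pathLawUpTo T) =
      P.map fun ω => f (X ω) := by
  ext s hs
  have hf' : Measurable f := hf.mono (canonicalFiltration.le T) le_rfl
  rw [@Measure.map_apply _ _ (canonicalFiltration T) _ _ _ hf _ hs, IsOUSolution.pathLawUpTo,
    trim_measurableSet_eq _ (hf hs), IsOUSolution.pathLaw, Measure.map_apply hX.measurable (hf' hs),
    Measure.map_apply (f := fun ω => f (X ω)) (hf'.comp hX.measurable) hs]
  rfl

theorem IsOUSolution.measurable_scaledEnergy_comp (hX : IsOUSolution F P θ Z X) (α : ℝ)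
    (ν : Measure ℝ) (T : ℝ≥0) : Measurable fun ω => scaledEnergy α ν T (X ω) :=
  ((measurable_scaledEnergy α ν T).mono (canonicalFiltration.le T) le_rfl).comp hX.measurable

variable [IsProbabilityMeasure P]

/-- The law of the rescaled quadratic functional, on the half-line. -/
def IsOUSolution.energyLaw (hX : IsOUSolution F P θ Z X) (α : ℝ) (ν : Measure ℝ) (T : ℝ≥0) :
    ProbabilityMeasure ℝ≥0 :=
  ⟨P.map fun ω => (scaledEnergy α ν T (X ω)).toNNReal, Measure.isProbabilityMeasure_map
    (hX.measurable_scaledEnergy_comp α ν T).real_toNNReal.aemeasurable⟩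

theorem IsOUSolution.map_coe_energyLaw (hX : IsOUSolution F P θ Z X) (α : ℝ) (ν : Measure ℝ)
    (T : ℝ≥0) : (hX.energyLaw α ν T : Measure ℝ≥0).map ((↑) : ℝ≥0 → ℝ) =
      P.map fun ω => scaledEnergy α ν T (X ω) := by
  change (P.map _).map _ = _
  rw [Measure.map_map measurable_coe_nnreal_real
    (hX.measurable_scaledEnergy_comp α ν T).real_toNNReal]
  congr 1
  ext ω
  exact Real.coe_toNNReal _ (scaledEnergy_nonneg _ _ _ _)

theorem IsOUSolution.integral_expNeg_energyLaw (hX : IsOUSolution F P θ Z X) (α : ℝ)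
    (ν : Measure ℝ) (T l : ℝ≥0) : ∫ x, expNeg l x ∂(hX.energyLaw α ν T : Measure ℝ≥0) =
      ∫ ω, Real.exp (-(l * scaledEnergy α ν T (X ω))) ∂P := by
  change ∫ x, expNeg l x ∂(P.map _) = _
  rw [integral_map (hX.measurable_scaledEnergy_comp α ν T).real_toNNReal.aemeasurable
    (expNeg l).continuous.aestronglyMeasurable]
  simp only [expNeg_apply, Real.coe_toNNReal _ (scaledEnergy_nonneg _ _ _ _)]

theorem IsOUSolution.tendsto_laplace_energyLaw (hX : IsOUSolution F P θ Z X)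
    (hZ : IsLevyProcess F P σ b ν Z) (hν : IsLevyMeasure ν) (hα : α ∈ Set.Ioo (0 : ℝ) 2)
    (hH : RegularlyVarying (tail ν) (-α)) (hθ : 0 < θ) {l : ℝ≥0} (hl : 0 < l) :
    Tendsto (fun T => ∫ x, expNeg l x ∂(hX.energyLaw α ν T : Measure ℝ≥0)) atTop
      (𝓝 (Real.exp (-(Real.Gamma (1 - α / 2) * ((l : ℝ) / (2 * θ)) ^ (α / 2))))) := by
  simp only [hX.integral_expNeg_energyLaw]
  exact (hX.tendsto_integral_exp hZ hν hα hH hθ (NNReal.coe_pos.2 hl)).comp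
    (NNReal.tendsto_coe_atTop.2 tendsto_id)

/-- A law with the stable Laplace transform is carried by the half-line. -/
theorem HasStableLaplace.ae_nonneg {a : ℝ} {S : ProbabilityMeasure ℝ} (hS : HasStableLaplace a S)
    (ha : a < 1) : ∀ᵐ x ∂(S : Measure ℝ), 0 ≤ x := by
  -- Chernoff bound: the transform never exceeds `1`, so the mass below `-ε` is at most `exp(-l ε)`
  -- for every `l > 0`.
  have hbound : ∀ ε : ℝ, 0 < ε → (S : Measure ℝ).real (Set.Iio (-ε)) = 0 := by
    intro ε hε
    have hle : ∀ l : ℝ, 0 < l →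
        (S : Measure ℝ).real (Set.Iio (-ε)) ≤ Real.exp (-(l * ε)) := by
      intro l hl
      -- A non-integrable function would have integral `0` by convention, whereas the prescribed
      -- value is positive.
      have hInt : Integrable (fun x => Real.exp (-(l * x))) (S : Measure ℝ) := by
        by_contra h
        have := hS l hl.le
        rw [integral_undef h] at this
        exact (Real.exp_pos _).ne this
      have h1 : Real.exp (l * ε) * (S : Measure ℝ).real (Set.Iio (-ε)) ≤ 1 := by
        calc Real.exp (l * ε) * (S : Measure ℝ).real (Set.Iio (-ε))
            ≤ Real.exp (l * ε) * (S : Measure ℝ).real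
              {x | Real.exp (l * ε) ≤ Real.exp (-(l * x))} := by
              gcongr
              · exact measure_ne_top _ _
              · intro x hx
                have hx' : x < -ε := hx
                refine Real.exp_le_exp.2 ?_
                nlinarith
          _ ≤ ∫ x, Real.exp (-(l * x)) ∂(S : Measure ℝ) :=
              mul_meas_ge_le_integral_of_nonneg (ae_of_all _ fun _ => (Real.exp_pos _).le) hInt _
          _ ≤ 1 := by
              rw [hS l hl.le, Real.exp_le_one_iff, neg_nonpos]
              exact mul_nonneg (Real.Gamma_pos_of_pos (by linarith)).le (by positivity)
      rw [Real.exp_neg, ← one_div, le_div_iff₀ (Real.exp_pos _), mul_comm]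
      exact h1
    have hlim : Tendsto (fun l : ℝ => Real.exp (-(l * ε))) atTop (𝓝 0) :=
      Real.tendsto_exp_neg_atTop_nhds_zero.comp (tendsto_id.atTop_mul_const hε)
    exact le_antisymm (ge_of_tendsto hlim ((eventually_gt_atTop 0).mono hle)) measureReal_nonneg
  have hall : ∀ᵐ x ∂(S : Measure ℝ), ∀ n : ℕ, -(1 / ((n : ℝ) + 1)) ≤ x := by
    refine ae_all_iff.2 fun n => ?_
    have h := hbound (1 / ((n : ℝ) + 1)) (by positivity)
    rw [measureReal_eq_zero_iff] at h
    refine measure_mono_null (fun x hx => ?_) h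
    simpa using hx
  filter_upwards [hall] with x hx
  have hlim : Tendsto (fun n : ℕ => -(1 / ((n : ℝ) + 1))) atTop (𝓝 0) := by
    simpa using (tendsto_one_div_add_atTop_nhds_zero_nat (𝕜 := ℝ)).neg
  exact le_of_tendsto hlim (Eventually.of_forall hx)

/-- The image of a stable law on the half-line under `x ↦ x / c`. -/
def stableLimit (S : ProbabilityMeasure ℝ) (c : ℝ) : ProbabilityMeasure ℝ≥0 :=
  S.map (f := fun x => (x / c).toNNReal) (by fun_prop)

theorem HasStableLaplace.integral_expNeg_stableLimit {a c : ℝ} {S : ProbabilityMeasure ℝ}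
    (hS : HasStableLaplace a S) (ha : a < 1) (hc : 0 < c) (l : ℝ≥0) :
    ∫ x, expNeg l x ∂(stableLimit S c : Measure ℝ≥0) =
      Real.exp (-(Real.Gamma (1 - a) * ((l : ℝ) / c) ^ a)) := by
  rw [← hS _ (by positivity : 0 ≤ (l : ℝ) / c)]
  change ∫ x, expNeg l x ∂((S : Measure ℝ).map _) = _
  rw [integral_map (by fun_prop) (expNeg l).continuous.aestronglyMeasurable]
  refine integral_congr_ae ?_
  filter_upwards [hS.ae_nonneg ha] with x hx
  rw [expNeg_apply, Real.coe_toNNReal _ (by positivity)]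
  congr 2
  ring

theorem HasStableLaplace.map_coe_stableLimit {a c : ℝ} {S : ProbabilityMeasure ℝ}
    (hS : HasStableLaplace a S) (ha : a < 1) (hc : 0 < c) :
    (stableLimit S c : Measure ℝ≥0).map ((↑) : ℝ≥0 → ℝ) = (S : Measure ℝ).map fun x => x / c := by
  change ((S : Measure ℝ).map _).map _ = _
  rw [Measure.map_map measurable_coe_nnreal_real (by fun_prop)]
  refine Measure.map_congr ?_
  filter_upwards [hS.ae_nonneg ha] with x hx
  exact Real.coe_toNNReal _ (by positivity)

theorem IsOUSolution.tendsto_energyLaw (hX : IsOUSolution F P θ Z X)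
    (hZ : IsLevyProcess F P σ b ν Z) (hν : IsLevyMeasure ν) (hα : α ∈ Set.Ioo (0 : ℝ) 2)
    (hH : RegularlyVarying (tail ν) (-α)) (hθ : 0 < θ) {S : ProbabilityMeasure ℝ}
    (hS : HasStableLaplace (α / 2) S) :
    Tendsto (hX.energyLaw α ν) atTop (𝓝 (stableLimit S (2 * θ))) := by
  -- The continuity theorem concerns sequences; these suffice since `atTop` on the half-line is
  -- countably generated.
  refine tendsto_of_seq_tendsto fun T hT => tendsto_of_tendsto_laplace fun l hl => ?_
  rw [hS.integral_expNeg_stableLimit (by linarith [hα.2]) (by positivity)]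
  exact (hX.tendsto_laplace_energyLaw hZ hν hα hH hθ hl).comp hT

/-- The process itself supplies the stable law: a limit point of its energies at integer times,
multiplied by `2θ`. -/
theorem IsOUSolution.exists_hasStableLaplace (hX : IsOUSolution F P θ Z X)
    (hZ : IsLevyProcess F P σ b ν Z) (hν : IsLevyMeasure ν) (hα : α ∈ Set.Ioo (0 : ℝ) 2)
    (hH : RegularlyVarying (tail ν) (-α)) (hθ : 0 < θ) :
    ∃ S : ProbabilityMeasure ℝ, HasStableLaplace (α / 2) S := by
  have hα' : 0 < α / 2 := half_pos hα.1
  obtain ⟨μ₀, hμ₀⟩ := exists_laplace_eq_of_tendsto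
    (μ := fun n : ℕ => hX.energyLaw α ν n)
    (L := fun l => Real.exp (-(Real.Gamma (1 - α / 2) * ((l : ℝ) / (2 * θ)) ^ (α / 2))))
    (by
      have hc : Continuous fun l : ℝ≥0 =>
          Real.exp (-(Real.Gamma (1 - α / 2) * ((l : ℝ) / (2 * θ)) ^ (α / 2))) := by
        have : Continuous fun l : ℝ≥0 => ((l : ℝ) / (2 * θ)) ^ (α / 2) :=
          (NNReal.continuous_coe.div_const _).rpow_const fun _ => Or.inr hα'.le
        fun_prop
      have := (hc.tendsto 0).mono_left (nhdsWithin_le_nhds (s := Set.Ioi 0))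
      simpa [Real.zero_rpow hα'.ne'] using this)
    (fun l hl => (hX.tendsto_laplace_energyLaw hZ hν hα hH hθ hl).comp
      (tendsto_natCast_atTop_atTop (R := ℝ≥0)))
  refine ⟨μ₀.map (f := fun x : ℝ≥0 => 2 * θ * (x : ℝ)) (by fun_prop), fun l hl => ?_⟩
  change ∫ x, _ ∂((μ₀ : Measure ℝ≥0).map _) = _
  rw [integral_map (by fun_prop) (by fun_prop)]
  rcases hl.eq_or_lt with rfl | hl
  · simp [Real.zero_rpow hα'.ne']
  · have h := hμ₀ (2 * θ * l).toNNReal (Real.toNNReal_pos.2 (by positivity))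
    simp only [expNeg_apply, Real.coe_toNNReal _ (by positivity : 0 ≤ 2 * θ * l)] at h
    rw [mul_div_cancel_left₀ l (by positivity)] at h
    rw [← h]
    refine integral_congr_ae (ae_of_all _ fun x => ?_)
    simp only
    congr 2
    ring

end Conclusion

end LevyOU

end

theorem theorem2p2 {Ω : Type*} {mΩ : MeasurableSpace Ω} (P : Measure Ω) [IsProbabilityMeasure P]
    (F : Filtration ℝ≥0 mΩ) [F.IsRightContinuous]
    (σ b : ℝ) (ν : Measure ℝ) (hν : LevyOU.IsLevyMeasure ν)
    (Z : ℝ≥0 → Ω → ℝ) (hZ : LevyOU.IsLevyProcess F P σ b ν Z)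
    (hσ : 0 < σ)
    (α : ℝ) (hα : α ∈ Set.Ioo (0 : ℝ) 2) (hH : LevyOU.RegularlyVarying (LevyOU.tail ν) (-α))
    (θ₀ : ℝ) (hθ₀ : 0 < θ₀)
    (X : Ω → LevyOU.PathSpace) (hX : LevyOU.IsOUSolution F P θ₀ Z X) :
    (∃ S : ProbabilityMeasure ℝ, LevyOU.HasStableLaplace (α / 2) S) ∧
    ∀ S : ProbabilityMeasure ℝ, LevyOU.HasStableLaplace (α / 2) S →
      TendstoInDistribution (Ω := fun _ : ℝ≥0 => LevyOU.PathSpace)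
        (m := fun T => LevyOU.canonicalFiltration T)
        (fun (T : ℝ≥0) (w : LevyOU.PathSpace) =>
          LevyOU.scaling α ν T ^ 2 * ∫ s in (0 : ℝ)..T, w.1 s.toNNReal ^ 2)
        atTop (fun x : ℝ => x / (2 * θ₀)) (fun T => hX.pathLawUpTo T) (S : Measure ℝ) := by
  refine ⟨hX.exists_hasStableLaplace hZ hν hα hH hθ₀, fun S hS => ?_⟩
  have ha : α / 2 < 1 := by linarith [hα.2]
  refine ⟨fun T => @Measurable.aemeasurable _ _ (LevyOU.canonicalFiltration T) _ _ _
    (LevyOU.measurable_scaledEnergy α ν T), by fun_prop, ?_⟩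
  -- Convergence on the half-line is transported to `ℝ` by the inclusion; the transported laws are
  -- then identified with those under the restricted path measures and with the law of `x / (2θ₀)`
  -- under `S`.
  have h := ProbabilityMeasure.tendsto_map_of_tendsto_of_continuous _ _
    (hX.tendsto_energyLaw hZ hν hα hH hθ₀ hS) NNReal.continuous_coe
  have hlim : (LevyOU.stableLimit S (2 * θ₀)).map NNReal.continuous_coe.aemeasurable =
      ⟨(S : Measure ℝ).map fun x => x / (2 * θ₀),
        Measure.isProbabilityMeasure_map (by fun_prop)⟩ :=
    Subtype.ext (hS.map_coe_stableLimit ha (by positivity))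
  rw [hlim] at h
  exact h.congr fun T => Subtype.ext ((hX.map_coe_energyLaw α ν T).trans
    (hX.map_pathLawUpTo (LevyOU.measurable_scaledEnergy α ν T)).symm)
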